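/- Setting. An instance of the preemptive throughput-maximisation problem $1|pmtn,r_j,E|\sum U_j$ consists of $n\ge 1$ jobs with integer release dates $r_j$, deadlines $d_j>r_j$ and works $p_j\ge 1$, numbered so that $d_1\le\dots\le d_n$ and with $\min_j r_j=0$, a real exponent $\alpha>1$ and an energy budget $E\ge 0$. A single processor runs at a (measurable) speed $s(t)\ge 0$ and processes at most one job at each time; preemption is allowed, no job is processed before its release date or beyond its total work, and the energy is $\int s(t)^\alpha\,dt$. A job is on time if its whole work $p_j$ is done during $[r_j,d_j)$. The task is to find, among the schedules of energy at most $E$, one with the maximum number of jobs on time and, among those, one of minimum energy. Let $L=\max_j d_j$ (the schedule span) and $P=\sum_j p_j$. The dynamic program. Let $\Phi=\{\,s+h\tfrac{\ell}{i}\le L : 0\le s\le L,\ 1\le \ell\le L,\ 1\le i\le P,\ 0\le h\le i\,\}$ (integer $s,h,\ell,i$). Put $G_0(s,t,0)=0$, $G_0(s,t,u)=+\infty$ for $u>0$, and for $1\le k\le n$ let $G_k(s,t,u)$ be the minimum of $G_{k-1}(s,t,u)$ and of all values $$G_{k-1}(s,x,u_1)+F_{k-1}(x,y,u_2,\ell,i,a,h)+p_k\Big(\frac{i}{\ell}\Big)^{\alpha-1}+G_{k-1}(y,t,u-u_1-u_2-1)$$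 over $x,y\in\Phi$ and integers $u_1,u_2\ge 0$, $u_1+u_2\le u-1$, $0\le a\le L$, $1\le\ell\le L$, $1\le i\le P$, $0\le h\le P$ with $y-x=a+(p_k+h)\frac{\ell}{i}$, $s\le r_k\le x\le y\le d_k$ and $y\le t$. Here $F_{k-1}(x,y,0,\ell,i,a,h)=0$, $F_{k-1}(x,y,u,\ell,i,0,0)=+\infty$ for $u>0$, and otherwise $$F_{k-1}(x,y,u,\ell,i,a,h)=\min\{G_{k-1}(x',y',\beta)+F_{k-1}(y',y,u-\beta,\ell,i,a-a',h-h')\}$$ over $0\le a'\le a$, $0\le h'\le h$, $1\le\beta\le u$ and $x'=r_j$ with $j\le k$ such that $x\le x'\le y$ and $y'=x'+a'+h'\frac{\ell}{i}\le y$. Minima over empty sets are $+\infty$. Machine model. A real random access machine with unit-cost operations on integer words, indexed memory for words and for reals, and on reals exact arithmetic, comparison and evaluation of the power function $x\mapsto x^\alpha$ for $x\ge 0$, but no rounding of reals to integers; the stored integers are bounded by a fixed polynomial in $n+L+P$. Space is the number of memory cells. Proposition. There is one program for this machine, not depending on $\alpha$, which on every such instance halts after $O(n^6L^9P^9)$ steps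 and uses $O(nL^6P^6)$ memory cells, with constants independent of the instance and of $\alpha$ and $E$, and outputs the values $G_n(0,L,u)$ for $0\le u\le n$ together with an optimal schedule (maximum throughput under the energy budget, and minimum energy among those), given as a list of intervals each with a job and a constant speed. Moreover the maximum throughput equals $\max\{u : 0\le u\le n,\ G_n(0,L,u)\le E\}$. In particular the problem is solved exactly by the dynamic program in pseudo-polynomial time. -/

import Mathlib

open scoped NNReal ENNReal

noncomputable section

namespace SpeedScaling

/-! ## The scheduling problem -/

/-- An instance with `n` jobs: integer release dates `r`, deadlines `d` and works `p`.
Jobs are numbered by non-decreasing deadline and the earliest release date is `0`. -/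
structure Instance (n : ℕ) where
  r : Fin n → ℕ
  d : Fin n → ℕ
  p : Fin n → ℕ
  window : ∀ j, r j < d j
  work_pos : ∀ j, 0 < p j
  sorted : Monotone d
  release_zero : ∃ j, r j = 0

/-- A schedule of a single processor: at time `t` it runs at speed `speed t` and processes
the job `job t` (no job if `none`). Preemption is allowed without restriction. -/
structure Schedule (n : ℕ) where
  speed : ℝ → ℝ≥0
  job : ℝ → Option (Fin n)
  measurable_speed : Measurable speed
  measurable_job : ∀ j, MeasurableSet {t | job t = some j}

/-- The work done on job `j` during the set of times `A`. -/
def Schedule.work {n : ℕ} (σ : Schedule n) (j : Fin n) (A : Set ℝ) : ℝ≥0∞ :=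
  ∫⁻ t in {t | σ.job t = some j} ∩ A, (σ.speed t : ℝ≥0∞)

/-- The total energy, for the power function `s ↦ s ^ α`. -/
def Schedule.energy {n : ℕ} (σ : Schedule n) (α : ℝ) : ℝ≥0∞ :=
  ∫⁻ t, (σ.speed t : ℝ≥0∞) ^ α

namespace Instance

variable {n : ℕ} (I : Instance n)

/-- The latest deadline `d_max`. As the earliest release date is `0`, this is the span `L`. -/
def L : ℕ := Finset.univ.sup I.d

/-- The total work `P`. -/
def P : ℕ := ∑ j, I.p j

/-- Job `j` is entirely executed during `[r_j, d_j)`. -/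
def OnTime (σ : Schedule n) (j : Fin n) : Prop :=
  σ.work j (Set.Ico (I.r j : ℝ) (I.d j : ℝ)) = (I.p j : ℝ≥0∞)

/-- The number of jobs completed on time. -/
def throughput (σ : Schedule n) : ℕ := {j | I.OnTime σ j}.ncard

/-- No job is processed before its release date or beyond its total work, and the energy
budget `E` is respected. -/
structure Feasible (α E : ℝ) (σ : Schedule n) : Prop where
  release : ∀ t j, σ.job t = some j → (I.r j : ℝ) ≤ t
  work_le : ∀ j, σ.work j Set.univ ≤ (I.p j : ℝ≥0∞)
  energy_le : σ.energy α ≤ ENNReal.ofReal E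

/-- A solution of `1 | pmtn, r_j, E | ∑ U_j`: a feasible schedule of maximum throughput and,
among these, of minimum energy. -/
structure Optimal (α E : ℝ) (σ : Schedule n) : Prop where
  feasible : I.Feasible α E σ
  throughput_max : ∀ τ, I.Feasible α E τ → I.throughput τ ≤ I.throughput σ
  energy_min : ∀ τ, I.Feasible α E τ → I.throughput τ = I.throughput σ →
    σ.energy α ≤ τ.energy α

/-! ## The dynamic program -/

/-- The set `Φ` of relevant times. -/
def Phi : Set ℚ :=
  {x | ∃ s h l i : ℕ, s ≤ I.L ∧ 1 ≤ l ∧ l ≤ I.L ∧ 1 ≤ i ∧ i ≤ I.P ∧ h ≤ i ∧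
    x = s + h * (l / i : ℚ) ∧ x ≤ I.L}

/-- The recursion for `F_m(x, y, u, l, i, a, h)`, where `g` stands for the table `G_m`.
The job `j` (counted from `0`) ranges over the first `m + 1` jobs. -/
def FRec (g : ℚ → ℚ → ℕ → ℝ≥0∞) (m : ℕ) (x y : ℚ) (u l i a h : ℕ) : ℝ≥0∞ :=
  if u = 0 then 0
  else if a = 0 ∧ h = 0 then ⊤
  else ⨅ (j : Fin n) (a' : ℕ) (h' : ℕ) (y' : ℚ) (_ : (j : ℕ) ≤ m)
      (_ : x ≤ I.r j ∧ (I.r j : ℚ) ≤ y) (_ : a' ≤ a ∧ h' ≤ h)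
      (_ : y' = I.r j + a' + h' * (l / i : ℚ) ∧ y' ≤ y)
      (b : ℕ) (_ : 1 ≤ b ∧ b ≤ u),
        g (I.r j) y' b + FRec g m y' y (u - b) l i (a - a') (h - h')
  termination_by u
  decreasing_by omega

/-- The recursion for `G_k(s, t, u)`. The `(k+1)`-st job is the one with index `k` when
counted from `0`. Infima are over finite sets; the infimum of the empty set is `⊤ = +∞`. -/
def G (α : ℝ) : ℕ → ℚ → ℚ → ℕ → ℝ≥0∞
  | 0, _, _, u => if u = 0 then 0 else ⊤
  | k + 1, s, t, u =>
    min (G α k s t u)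
      (⨅ (j : Fin n) (_ : (j : ℕ) = k)
        (x ∈ I.Phi) (y ∈ I.Phi)
        (u₁ : ℕ) (u₂ : ℕ) (_ : u₁ + u₂ + 1 ≤ u)
        (a : ℕ) (l : ℕ) (i : ℕ) (h : ℕ)
        (_ : a ≤ I.L ∧ (1 ≤ l ∧ l ≤ I.L) ∧ (1 ≤ i ∧ i ≤ I.P) ∧ h ≤ I.P)
        (_ : y - x = a + (I.p j + h) * (l / i : ℚ))
        (_ : (s ≤ I.r j ∧ (I.r j : ℚ) ≤ x) ∧ x ≤ y ∧ y ≤ I.d j ∧ y ≤ t),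
          G α k s x u₁ + I.FRec (G α k) k x y u₂ l i a h
            + ENNReal.ofReal ((i / l : ℝ) ^ (α - 1) * I.p j)
            + G α k y t (u - u₁ - u₂ - 1))

end Instance

/-! ## The machine model

A real random access machine with a structured program. It has `K + 4` registers and `K + 4`
arrays of each of two kinds: natural numbers (machine words) and real numbers. Every
elementary operation costs one step. The operations on reals are exact
arithmetic, comparison, and evaluation of the power function `x ↦ x ^ α`; there is no rounding
from reals to integers. -/

/-- Integer expressions. -/
inductive IExp (K : ℕ) where
  | const (c : ℕ)
  | reg (v : Fin (K + 4))
  | get (arr : Fin (K + 4)) (idx : IExp K)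
  | add (e₁ e₂ : IExp K)
  | sub (e₁ e₂ : IExp K)
  | mul (e₁ e₂ : IExp K)
  | div (e₁ e₂ : IExp K)
  | mod (e₁ e₂ : IExp K)

/-- Real expressions. -/
inductive RExp (K : ℕ) where
  | ofInt (e : IExp K)
  | reg (v : Fin (K + 4))
  | get (arr : Fin (K + 4)) (idx : IExp K)
  | add (e₁ e₂ : RExp K)
  | sub (e₁ e₂ : RExp K)
  | mul (e₁ e₂ : RExp K)
  | div (e₁ e₂ : RExp K)
  | power (e : RExp K)

/-- Tests. -/
inductive BExp (K : ℕ) where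
  | ile (e₁ e₂ : IExp K)
  | rle (e₁ e₂ : RExp K)
  | not (b : BExp K)
  | and (b₁ b₂ : BExp K)

/-- Commands. -/
inductive Cmd (K : ℕ) where
  | skip
  | iset (v : Fin (K + 4)) (e : IExp K)
  | rset (v : Fin (K + 4)) (e : RExp K)
  | iput (arr : Fin (K + 4)) (idx e : IExp K)
  | rput (arr : Fin (K + 4)) (idx : IExp K) (e : RExp K)
  | seq (c₁ c₂ : Cmd K)
  | ite (b : BExp K) (c₁ c₂ : Cmd K)
  | while (b : BExp K) (c : Cmd K)

/-- Memory contents: registers and arrays of both kinds. -/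
structure State (K : ℕ) where
  ireg : Fin (K + 4) → ℕ
  rreg : Fin (K + 4) → ℝ
  iarr : Fin (K + 4) → ℕ → ℕ
  rarr : Fin (K + 4) → ℕ → ℝ

namespace State

variable {K : ℕ} (st : State K)

/-- Store `x` in integer register `v`. -/
def setI (v : Fin (K + 4)) (x : ℕ) : State K :=
  { st with ireg := Function.update st.ireg v x }

/-- Store `x` in real register `v`. -/
def setR (v : Fin (K + 4)) (x : ℝ) : State K :=
  { st with rreg := Function.update st.rreg v x }

/-- Store `x` at position `q` of integer array `arr`. -/
def putI (arr : Fin (K + 4)) (q x : ℕ) : State K :=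
  { st with iarr := Function.update st.iarr arr (Function.update (st.iarr arr) q x) }

/-- Store `x` at position `q` of real array `arr`. -/
def putR (arr : Fin (K + 4)) (q : ℕ) (x : ℝ) : State K :=
  { st with rarr := Function.update st.rarr arr (Function.update (st.rarr arr) q x) }

end State

/-- The number of memory cells when all arrays have length `S`. -/
def memoryCells (K S : ℕ) : ℕ := 2 * (K + 4) + 2 * (K + 4) * S

namespace IExp

variable {K : ℕ}

/-- The value of an integer expression; subtraction is truncated. -/
def eval (st : State K) : IExp K → ℕ
  | const c => c
  | reg v => st.ireg v
  | get arr idx => st.iarr arr (idx.eval st)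
  | add e₁ e₂ => e₁.eval st + e₂.eval st
  | sub e₁ e₂ => e₁.eval st - e₂.eval st
  | mul e₁ e₂ => e₁.eval st * e₂.eval st
  | div e₁ e₂ => e₁.eval st / e₂.eval st
  | mod e₁ e₂ => e₁.eval st % e₂.eval st

/-- The evaluation stays within arrays of length `S` and never divides by zero. -/
def Safe (S : ℕ) (st : State K) : IExp K → Prop
  | const _ => True
  | reg _ => True
  | get _ idx => idx.Safe S st ∧ idx.eval st < S
  | add e₁ e₂ => e₁.Safe S st ∧ e₂.Safe S st
  | sub e₁ e₂ => e₁.Safe S st ∧ e₂.Safe S st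
  | mul e₁ e₂ => e₁.Safe S st ∧ e₂.Safe S st
  | div e₁ e₂ => e₁.Safe S st ∧ e₂.Safe S st ∧ e₂.eval st ≠ 0
  | mod e₁ e₂ => e₁.Safe S st ∧ e₂.Safe S st ∧ e₂.eval st ≠ 0

/-- The number of elementary operations of an evaluation. -/
def cost : IExp K → ℕ
  | const _ => 1
  | reg _ => 1
  | get _ idx => idx.cost + 1
  | add e₁ e₂ => e₁.cost + e₂.cost + 1
  | sub e₁ e₂ => e₁.cost + e₂.cost + 1
  | mul e₁ e₂ => e₁.cost + e₂.cost + 1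
  | div e₁ e₂ => e₁.cost + e₂.cost + 1
  | mod e₁ e₂ => e₁.cost + e₂.cost + 1

end IExp

namespace RExp

variable {K : ℕ}

/-- The value of a real expression. -/
def eval (α : ℝ) (st : State K) : RExp K → ℝ
  | ofInt e => (e.eval st : ℝ)
  | reg v => st.rreg v
  | get arr idx => st.rarr arr (idx.eval st)
  | add e₁ e₂ => e₁.eval α st + e₂.eval α st
  | sub e₁ e₂ => e₁.eval α st - e₂.eval α st
  | mul e₁ e₂ => e₁.eval α st * e₂.eval α st
  | div e₁ e₂ => e₁.eval α st / e₂.eval α st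
  | power e => (e.eval α st) ^ α

/-- The evaluation stays within arrays of length `S`, never divides by zero, and applies the
power function to non-negative numbers only. -/
def Safe (α : ℝ) (S : ℕ) (st : State K) : RExp K → Prop
  | ofInt e => e.Safe S st
  | reg _ => True
  | get _ idx => idx.Safe S st ∧ idx.eval st < S
  | add e₁ e₂ => e₁.Safe α S st ∧ e₂.Safe α S st
  | sub e₁ e₂ => e₁.Safe α S st ∧ e₂.Safe α S st
  | mul e₁ e₂ => e₁.Safe α S st ∧ e₂.Safe α S st
  | div e₁ e₂ => e₁.Safe α S st ∧ e₂.Safe α S st ∧ e₂.eval α st ≠ 0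
  | power e => e.Safe α S st ∧ 0 ≤ e.eval α st

/-- The number of elementary operations of an evaluation. -/
def cost : RExp K → ℕ
  | ofInt e => e.cost + 1
  | reg _ => 1
  | get _ idx => idx.cost + 1
  | add e₁ e₂ => e₁.cost + e₂.cost + 1
  | sub e₁ e₂ => e₁.cost + e₂.cost + 1
  | mul e₁ e₂ => e₁.cost + e₂.cost + 1
  | div e₁ e₂ => e₁.cost + e₂.cost + 1
  | power e => e.cost + 1

end RExp

namespace BExp

variable {K : ℕ}

/-- The test succeeds. -/
def Holds (α : ℝ) (st : State K) : BExp K → Prop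
  | ile e₁ e₂ => e₁.eval st ≤ e₂.eval st
  | rle e₁ e₂ => e₁.eval α st ≤ e₂.eval α st
  | not b => ¬ b.Holds α st
  | and b₁ b₂ => b₁.Holds α st ∧ b₂.Holds α st

/-- All expressions in the test are safe. -/
def Safe (α : ℝ) (S : ℕ) (st : State K) : BExp K → Prop
  | ile e₁ e₂ => e₁.Safe S st ∧ e₂.Safe S st
  | rle e₁ e₂ => e₁.Safe α S st ∧ e₂.Safe α S st
  | not b => b.Safe α S st
  | and b₁ b₂ => b₁.Safe α S st ∧ b₂.Safe α S st

/-- The number of elementary operations of a test. -/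
def cost : BExp K → ℕ
  | ile e₁ e₂ => e₁.cost + e₂.cost + 1
  | rle e₁ e₂ => e₁.cost + e₂.cost + 1
  | not b => b.cost + 1
  | and b₁ b₂ => b₁.cost + b₂.cost + 1

end BExp

/-- `Exec α S W c st st' T`: with arrays of length `S` and machine words at most `W`, the
command `c` started in `st` halts in `st'` after exactly `T` steps. Out-of-bounds
accesses, storing an integer larger than `W`, and undefined operations block the execution. -/
inductive Exec {K : ℕ} (α : ℝ) (S W : ℕ) : Cmd K → State K → State K → ℕ → Prop where
  | skip (st : State K) : Exec α S W .skip st st 1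
  | iset (st : State K) (v : Fin (K + 4)) (e : IExp K)
      (he : e.Safe S st) (hw : e.eval st ≤ W) :
      Exec α S W (.iset v e) st (st.setI v (e.eval st)) (e.cost + 1)
  | rset (st : State K) (v : Fin (K + 4)) (e : RExp K) (he : e.Safe α S st) :
      Exec α S W (.rset v e) st (st.setR v (e.eval α st)) (e.cost + 1)
  | iput (st : State K) (arr : Fin (K + 4)) (idx e : IExp K)
      (hi : idx.Safe S st) (hS : idx.eval st < S) (he : e.Safe S st) (hw : e.eval st ≤ W) :
      Exec α S W (.iput arr idx e) st (st.putI arr (idx.eval st) (e.eval st))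
        (idx.cost + e.cost + 1)
  | rput (st : State K) (arr : Fin (K + 4)) (idx : IExp K) (e : RExp K)
      (hi : idx.Safe S st) (hS : idx.eval st < S) (he : e.Safe α S st) :
      Exec α S W (.rput arr idx e) st (st.putR arr (idx.eval st) (e.eval α st))
        (idx.cost + e.cost + 1)
  | seq (st₁ st₂ st₃ : State K) (c₁ c₂ : Cmd K) (T₁ T₂ : ℕ)
      (h₁ : Exec α S W c₁ st₁ st₂ T₁) (h₂ : Exec α S W c₂ st₂ st₃ T₂) :
      Exec α S W (.seq c₁ c₂) st₁ st₃ (T₁ + T₂)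
  | iteTrue (st st' : State K) (b : BExp K) (c₁ c₂ : Cmd K) (T : ℕ)
      (hs : b.Safe α S st) (hb : b.Holds α st) (h : Exec α S W c₁ st st' T) :
      Exec α S W (.ite b c₁ c₂) st st' (b.cost + 1 + T)
  | iteFalse (st st' : State K) (b : BExp K) (c₁ c₂ : Cmd K) (T : ℕ)
      (hs : b.Safe α S st) (hb : ¬ b.Holds α st) (h : Exec α S W c₂ st st' T) :
      Exec α S W (.ite b c₁ c₂) st st' (b.cost + 1 + T)
  | whileTrue (st₁ st₂ st₃ : State K) (b : BExp K) (c : Cmd K) (T₁ T₂ : ℕ)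
      (hs : b.Safe α S st₁) (hb : b.Holds α st₁) (h₁ : Exec α S W c st₁ st₂ T₁)
      (h₂ : Exec α S W (.while b c) st₂ st₃ T₂) :
      Exec α S W (.while b c) st₁ st₃ (b.cost + 1 + T₁ + T₂)
  | whileFalse (st : State K) (b : BExp K) (c : Cmd K)
      (hs : b.Safe α S st) (hb : ¬ b.Holds α st) :
      Exec α S W (.while b c) st st (b.cost + 1)

/-! ## Input and output -/

/-- The initial memory: `n` in integer register `0`, the release dates, deadlines and works in
the integer arrays `0`, `1` and `2`, the budget in real register `0`, and zeros elsewhere. -/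
def initState {n : ℕ} (K : ℕ) (I : Instance n) (E : ℝ) : State K where
  ireg v := if v = 0 then n else 0
  rreg v := if v = 0 then E else 0
  iarr v q :=
    if hq : q < n then
      if v = 0 then I.r ⟨q, hq⟩ else if v = 1 then I.d ⟨q, hq⟩ else if v = 2 then I.p ⟨q, hq⟩
      else 0
    else 0
  rarr _ _ := 0

/-- The memory holds the schedule `σ` as a list of `m` pieces, where `m` is in integer register
`0`: piece `q` processes job `iarr 0 q` at the constant speed `rarr 2 q` during the interval
from `rarr 0 q` to `rarr 1 q`, and the processor is idle outside these intervals. -/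
structure EncodesSchedule {n K : ℕ} (S : ℕ) (st : State K) (σ : Schedule n) : Prop where
  length_le : st.ireg 0 ≤ S
  inside : ∀ q < st.ireg 0, ∀ t ∈ Set.Ico (st.rarr 0 q) (st.rarr 1 q),
    (σ.job t).map Fin.val = some (st.iarr 0 q) ∧ (σ.speed t : ℝ) = st.rarr 2 q
  outside : ∀ t, (∀ q < st.ireg 0, t ∉ Set.Ico (st.rarr 0 q) (st.rarr 1 q)) →
    σ.job t = none ∧ σ.speed t = 0

/-- The memory holds the values `g 0, …, g n`: entry `u` of integer array `1` tells
whether `g u` is finite, and then entry `u` of real array `3` is its value. -/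
def EncodesValues {K : ℕ} (n S : ℕ) (st : State K) (g : ℕ → ℝ≥0∞) : Prop :=
  n < S ∧ ∀ u ≤ n, (st.iarr 1 u = 0 ∧ g u = ⊤) ∨
    (st.iarr 1 u = 1 ∧ g u ≠ ⊤ ∧ st.rarr 3 u = (g u).toReal)

end SpeedScaling

end

open scoped NNReal ENNReal

noncomputable section

namespace SpeedScaling

/-! ## Fractional assignments of work to time slots -/

variable {n : ℕ} (I : Instance n)

namespace Instance

/-! Fix a set J of jobs to be completed on time. Release dates and deadlines are integers, so the
work can be distributed over unit slots. A distribution minimising the sum of the squared slot loads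
is balanced: a job is processed only in slots whose load is least within its window. Hence each job
has a level, the common load of its slots. The tangents of `x ^ α` at the slot loads turn balance
into a duality bound: every schedule completing J on time spends at least the sum of `level ^ (α -
1) * p` over J (`levelEnergy_le`).

Among the minimisers one can be chosen in which smaller indices, that is, deadlines that are no
later, have priority (`exists_isEDFOptimal`). In it a job k is interrupted, between its start and
its end, only by jobs of smaller index released after its start. They come in groups: a group begins
at a release date and ends when k resumes. If l slots have load lam and the jobs of level lam have
total work i, then lam = i / l (`levelSlots_mul`). Counting the slots of load lam in an interval
shows that starts, resumptions and ends have the form s + h l / i, and that the durations have the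
form a + h l / i, where a counts slots of other loads and h is work of level lam (`exists_code`,
`group`, `span`). So integer parameters bounded by L and P suffice, and the other jobs split by
release date into those before, during and after the run of the job of largest index.

The program does not tabulate G and F at all their arguments. It fills a table of integer-coded
cells whose ordinary windows start at integers. The values at the roots are linked by a cycle of
inequalities: G is at most a finite table entry, which is the energy of an explicit plan
(`Table.Correct.sound`); the least energy of a plan is at most G (`optPlan_le_G`); and the root
entry is at most the energy of every schedule with the required number of jobs on time (`planBound`
with `levelEnergy_le`). So all of them agree, comparing the roots with the budget gives the maximum
throughput, and unfolding the recorded moves gives an optimal schedule.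

There are O(n^2 L^4 P^4) cells and as many choices for each. A pair of a cell and a choice takes
constant time, which gives O(n^4 L^8 P^8) steps up to smaller terms. The space bound uses n ≤ P to
trade one factor n. -/

lemma d_le_L (j : Fin n) : I.d j ≤ I.L := Finset.le_sup (f := I.d) (Finset.mem_univ j)

lemma r_lt_L (j : Fin n) : I.r j < I.L := (I.window j).trans_le (I.d_le_L j)

lemma sum_p_le_P (B : Finset (Fin n)) : ∑ j ∈ B, I.p j ≤ I.P :=
  Finset.sum_le_sum_of_subset (Finset.subset_univ B)

lemma n_pos {n : ℕ} (I : Instance n) : 0 < n := by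
  obtain ⟨j, -⟩ := I.release_zero
  exact j.pos

lemma L_pos {n : ℕ} (I : Instance n) : 0 < I.L := by
  obtain ⟨j, -⟩ := I.release_zero
  exact (Nat.zero_le _).trans_lt (I.r_lt_L j)

lemma n_le_P {n : ℕ} (I : Instance n) : n ≤ I.P := by
  calc n = ∑ _j : Fin n, 1 := by simp
    _ ≤ I.P := Finset.sum_le_sum fun j _ => I.work_pos j

lemma P_pos {n : ℕ} (I : Instance n) : 0 < I.P := I.n_pos.trans_le I.n_le_P

end Instance

/-- The total work `∑ j, w j q` processed in the unit slot `q`. -/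
def load (w : Fin n → ℕ → ℝ) (q : ℕ) : ℝ := ∑ j, w j q

/-- An optimal distribution of the work of the jobs in `J` over unit time slots, in which
jobs are processed in order of their indices. -/
structure IsEDFOptimal (J : Finset (Fin n)) (w : Fin n → ℕ → ℝ) : Prop where
  nonneg : ∀ j q, 0 ≤ w j q
  support : ∀ j q, 0 < w j q → j ∈ J ∧ I.r j ≤ q ∧ q < I.d j
  total : ∀ j ∈ J, ∑ q ∈ Finset.range I.L, w j q = I.p j
  balanced : ∀ j q q', 0 < w j q → I.r j ≤ q' → q' < I.d j → load w q ≤ load w q'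
  edf : ∀ j k q q', j < k → I.r j ≤ q → q < q' → 0 < w k q → w j q' = 0

/-- The compact set of distributions of the work of the jobs in `J` over the slots. -/
def assignments (J : Finset (Fin n)) : Set (Fin n → Fin I.L → ℝ) :=
  {w | (∀ j q, 0 ≤ w j q) ∧ (∀ j (q : Fin I.L), ¬ (j ∈ J ∧ I.r j ≤ q ∧ q < I.d j) → w j q = 0) ∧
    ∀ j ∈ J, ∑ q, w j q = I.p j}

lemma isCompact_assignments (J : Finset (Fin n)) : IsCompact (assignments I J) := by
  have hb : assignments I J ⊆ Set.Icc (fun _ _ => 0) (fun j _ => (I.p j : ℝ)) := by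
    rintro w ⟨h0, hs, ht⟩
    refine ⟨fun j q => h0 j q, fun j q => ?_⟩
    by_cases hj : j ∈ J
    · dsimp only
      rw [← ht j hj]
      exact Finset.single_le_sum (f := w j) (fun q _ => h0 j q) (Finset.mem_univ q)
    · dsimp only
      rw [hs j q (fun h => hj h.1)]
      positivity
  refine isCompact_Icc.of_isClosed_subset ?_ hb
  have : assignments I J = (⋂ j, ⋂ q, {w | 0 ≤ w j q}) ∩
      ((⋂ j, ⋂ q : Fin I.L, ⋂ (_ : ¬ (j ∈ J ∧ I.r j ≤ q ∧ q < I.d j)), {w | w j q = 0}) ∩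
      ⋂ j ∈ J, {w | ∑ q, w j q = (I.p j : ℝ)}) := by
    ext w
    simp [assignments]
  rw [this]
  refine IsClosed.inter ?_ (IsClosed.inter ?_ ?_)
  · exact isClosed_iInter fun j => isClosed_iInter fun q =>
      isClosed_le continuous_const (by fun_prop)
  · exact isClosed_iInter fun j => isClosed_iInter fun q => isClosed_iInter fun _ =>
      isClosed_eq (by fun_prop) continuous_const
  · exact isClosed_iInter fun j => isClosed_iInter fun _ =>
      isClosed_eq (by fun_prop) continuous_const

lemma assignments_nonempty (J : Finset (Fin n)) : (assignments I J).Nonempty := by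
  refine ⟨fun j q => if j ∈ J ∧ (q : ℕ) = I.r j then I.p j else 0, ?_, ?_, ?_⟩
  · intro j q
    dsimp only
    split_ifs <;> positivity
  · intro j q h
    refine if_neg ?_
    rintro ⟨h1, h2⟩
    exact h ⟨h1, h2.ge, h2 ▸ I.window j⟩
  · intro j hj
    rw [Finset.sum_eq_single (⟨I.r j, I.r_lt_L j⟩ : Fin I.L)]
    · simp [hj]
    · intro q _ hq
      refine if_neg fun h => hq (Fin.ext h.2)
    · simp

/-- Move the amount `ε` of work of job `j` from slot `q` to slot `q'`. -/
def moveWork {m : ℕ} (w : Fin n → Fin m → ℝ) (j : Fin n) (q q' : Fin m) (ε : ℝ) :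
    Fin n → Fin m → ℝ :=
  fun i s => w i s + if i = j then (if s = q' then ε else 0) - (if s = q then ε else 0) else 0

lemma moveWork_sum {m : ℕ} (w : Fin n → Fin m → ℝ) (j : Fin n) (q q' : Fin m) (ε : ℝ)
    (i : Fin n) : ∑ s, moveWork w j q q' ε i s = ∑ s, w i s := by
  simp only [moveWork, Finset.sum_add_distrib]
  by_cases h : i = j <;> simp [h, Finset.sum_sub_distrib]

lemma moveWork_load {m : ℕ} (w : Fin n → Fin m → ℝ) (j : Fin n) (q q' : Fin m) (ε : ℝ)
    (s : Fin m) : ∑ i, moveWork w j q q' ε i s =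
      ∑ i, w i s + ((if s = q' then ε else 0) - (if s = q then ε else 0)) := by
  simp [moveWork, Finset.sum_add_distrib]

lemma moveWork_weighted {m : ℕ} (w : Fin n → Fin m → ℝ) (j : Fin n) (q q' : Fin m) (ε : ℝ)
    (c : Fin n → Fin m → ℝ) : ∑ i, ∑ s, moveWork w j q q' ε i s * c i s =
      ∑ i, ∑ s, w i s * c i s + ε * (c j q' - c j q) := by
  simp only [moveWork, add_mul, Finset.sum_add_distrib, ite_mul, zero_mul, sub_mul]
  congr 1
  rw [Finset.sum_eq_single j]
  · simp [Finset.sum_sub_distrib]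
    ring
  · intro b _ hb
    simp [hb]
  · simp

lemma moveWork_mem {J : Finset (Fin n)} {w : Fin n → Fin I.L → ℝ} (hw : w ∈ assignments I J)
    {j : Fin n} {q q' : Fin I.L} {ε : ℝ} (h0 : 0 ≤ ε) (hε : ε ≤ w j q)
    (hj : j ∈ J) (hr : I.r j ≤ q) (hd : (q : ℕ) < I.d j) (hr' : I.r j ≤ q')
    (hd' : (q' : ℕ) < I.d j) : moveWork w j q q' ε ∈ assignments I J := by
  obtain ⟨h1, h2, h3⟩ := hw
  refine ⟨fun i s => ?_, fun i s h => ?_, fun i hi => ?_⟩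
  · have := h1 i s
    simp only [moveWork]
    split_ifs with h4 h5 h6 h6
    · linarith
    · linarith
    · subst h4 h6; linarith
    · linarith
    · linarith
  · simp only [moveWork, h2 i s h, zero_add]
    split_ifs with h4 h5 h6 h6
    · simp
    · exact absurd ⟨h4 ▸ hj, h4 ▸ h5 ▸ hr', h4 ▸ h5 ▸ hd'⟩ h
    · exact absurd ⟨h4 ▸ hj, h4 ▸ h6 ▸ hr, h4 ▸ h6 ▸ hd⟩ h
    · simp
    · rfl
  · rw [moveWork_sum, h3 i hi]

/-- Lexicographic minimisation over a compact set: first the sum `F` of squared loads, then `H`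
among the minimisers of `F`. Moving work of a job to a less loaded slot of its window would decrease
`F`, which gives balance. Exchanging work of two jobs between two slots keeps every load and would
decrease `H` if the order were wrong, which gives the priority rule. Since squares are used, the
distribution does not depend on `α`. -/
theorem exists_isEDFOptimal (J : Finset (Fin n)) : ∃ w, IsEDFOptimal I J w := by
  let F : (Fin n → Fin I.L → ℝ) → ℝ := fun w => ∑ q, (∑ j, w j q) ^ 2
  -- The factor `n - j` makes late work on small indices expensive: exchanging `ε` of a larger index
  -- `k` in slot `q` with `ε` of a smaller index `j` in a later slot `q'` lowers `H` by `ε (q' - q)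
  -- (k - j)`.
  let H : (Fin n → Fin I.L → ℝ) → ℝ := fun w => ∑ j, ∑ q, w j q * ((q : ℝ) * (n - (j : ℝ)))
  have hF : Continuous F := by fun_prop
  have hH : Continuous H := by fun_prop
  obtain ⟨w₀, hw₀, hmin₀⟩ := (isCompact_assignments I J).exists_isMinOn
    (assignments_nonempty I J) hF.continuousOn
  have hc : IsCompact (assignments I J ∩ {w | F w = F w₀}) :=
    (isCompact_assignments I J).inter_right (isClosed_eq hF continuous_const)
  obtain ⟨w, ⟨hw, hwF⟩, hmin₁⟩ := hc.exists_isMinOn ⟨w₀, hw₀, rfl⟩ hH.continuousOn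
  have hwF : F w = F w₀ := hwF
  have hminF : ∀ u ∈ assignments I J, F w ≤ F u := fun u hu => hwF ▸ hmin₀ hu
  have hminH : ∀ u ∈ assignments I J, F u = F w → H w ≤ H u :=
    fun u hu h => hmin₁ ⟨hu, h.trans hwF⟩
  have hsupp : ∀ j q, 0 < w j q → j ∈ J ∧ I.r j ≤ q ∧ (q : ℕ) < I.d j := by
    intro j q h
    by_contra h'
    exact h.ne' (hw.2.1 j q h')
  have hbal : ∀ j (q q' : Fin I.L), 0 < w j q → I.r j ≤ q' → (q' : ℕ) < I.d j →
      ∑ i, w i q ≤ ∑ i, w i q' := by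
    intro j q q' hpos hr hd
    by_contra! hlt
    obtain ⟨hj, hrq, hdq⟩ := hsupp j q hpos
    have hne : q ≠ q' := by rintro rfl; exact lt_irrefl _ hlt
    set A := ∑ i, w i q with hA
    set B := ∑ i, w i q' with hB
    -- The move changes `F` by `-2 ε (A - B - ε)`, which is negative for `0 < ε ≤ (A - B) / 2`. The
    -- bound by `w j q` keeps the work nonnegative.
    set ε := min (w j q) ((A - B) / 2) with hε
    have hεpos : 0 < ε := lt_min hpos (by linarith)
    have hε1 : ε ≤ w j q := min_le_left _ _
    have hε2 : ε ≤ (A - B) / 2 := min_le_right _ _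
    have hmem := moveWork_mem I hw hεpos.le hε1 hj hrq hdq hr hd
    have hle := hminF _ hmem
    have hFm : F (moveWork w j q q' ε) = F w + (2 * ε * (B - A) + 2 * ε ^ 2) := by
      have h1 : ∀ s, (∑ i, moveWork w j q q' ε i s) ^ 2 = (∑ i, w i s) ^ 2 +
          ((if s = q' then 2 * ε * B + ε ^ 2 else 0) +
            (if s = q then - 2 * ε * A + ε ^ 2 else 0)) := by
        intro s
        rw [moveWork_load]
        by_cases h1 : s = q'
        · have h2 : s ≠ q := fun h => hne (h.symm.trans h1)
          simp only [h1, if_true, if_neg (h1 ▸ h2 : q' ≠ q), hB]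
          ring
        · by_cases h2 : s = q
          · simp only [h2, hne, if_true, if_false, hA]
            ring
          · simp [h1, h2]
      simp only [F, h1, Finset.sum_add_distrib, Finset.sum_ite_eq', Finset.mem_univ, if_true]
      ring
    nlinarith
  have hedf : ∀ j k (q q' : Fin I.L), j < k → I.r j ≤ q → q < q' → 0 < w k q → w j q' = 0 := by
    intro j k q q' hjk hr hqq hk
    by_contra hne
    have hj : 0 < w j q' := lt_of_le_of_ne (hw.1 j q') (Ne.symm hne)
    obtain ⟨hkJ, hkr, hkd⟩ := hsupp k q hk
    obtain ⟨hjJ, hjr, hjd⟩ := hsupp j q' hj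
    -- The exchange respects both windows: `k` may enter slot `q'` because `q' < d j ≤ d k`, and `j`
    -- may enter slot `q` because it is released by then.
    have hjdk : I.d j ≤ I.d k := I.sorted hjk.le
    have hqq' : (q : ℕ) < q' := hqq
    set ε := min (w k q) (w j q') with hε
    have hεpos : 0 < ε := lt_min hk hj
    have hm1 := moveWork_mem I hw hεpos.le (min_le_left _ _) hkJ hkr hkd
      (hkr.trans hqq'.le) (hjd.trans_le hjdk)
    have hm2 : moveWork (moveWork w k q q' ε) j q' q ε ∈ assignments I J := by
      refine moveWork_mem I hm1 hεpos.le ?_ hjJ hjr hjd hr (hqq'.trans hjd)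
      simp only [moveWork, if_neg hjk.ne, add_zero]
      exact min_le_right _ _
    have hF2 : F (moveWork (moveWork w k q q' ε) j q' q ε) = F w := by
      refine Finset.sum_congr rfl fun s _ => ?_
      rw [moveWork_load, moveWork_load]
      ring
    have := hminH _ hm2 hF2
    simp only [H, moveWork_weighted] at this
    have h1 : (0 : ℝ) < (q' : ℝ) - (q : ℝ) := by
      rw [sub_pos]
      exact_mod_cast hqq'
    have h2 : (0 : ℝ) < (k : ℝ) - (j : ℝ) := by
      rw [sub_pos]
      exact_mod_cast (hjk : (j : ℕ) < k)
    nlinarith [mul_pos hεpos (mul_pos h1 h2)]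
  let w' : Fin n → ℕ → ℝ := fun j q => if h : q < I.L then w j ⟨q, h⟩ else 0
  have hw' : ∀ j q, 0 < w' j q → ∃ h : q < I.L, 0 < w j ⟨q, h⟩ := by
    intro j q h
    by_cases hq : q < I.L
    · exact ⟨hq, by simpa [w', hq] using h⟩
    · simp [w', hq] at h
  have hload : ∀ q (h : q < I.L), load w' q = ∑ j, w j ⟨q, h⟩ := by
    intro q h
    simp [load, w', h]
  refine ⟨w', ?_, ?_, ?_, ?_, ?_⟩
  · intro j q
    by_cases hq : q < I.L
    · simpa [w', hq] using hw.1 j ⟨q, hq⟩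
    · simp [w', hq]
  · intro j q h
    obtain ⟨hq, h⟩ := hw' j q h
    exact hsupp j ⟨q, hq⟩ h
  · intro j hj
    rw [← hw.2.2 j hj, Finset.sum_range]
    refine Finset.sum_congr rfl fun q _ => ?_
    simp [w']
  · intro j q q' h hr hd
    obtain ⟨hq, h⟩ := hw' j q h
    have hq' : q' < I.L := hd.trans_le (I.d_le_L j)
    rw [hload q hq, hload q' hq']
    exact hbal j ⟨q, hq⟩ ⟨q', hq'⟩ h hr hd
  · intro j k q q' hjk hr hqq hk
    obtain ⟨hq, h⟩ := hw' k q hk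
    by_cases hq' : q' < I.L
    · simpa [w', hq'] using hedf j k ⟨q, hq⟩ ⟨q', hq'⟩ hjk hr hqq h
    · simp [w', hq']

end SpeedScaling

end

noncomputable section

namespace SpeedScaling

/-! ## Earliest deadline first assignments -/

variable {n : ℕ} {I : Instance n} {J : Finset (Fin n)} {w : Fin n → ℕ → ℝ}

open Classical in
/-- The common load of the slots in which job `j` is processed. -/
def level (w : Fin n → ℕ → ℝ) (j : Fin n) : ℝ :=
  if h : ∃ q, 0 < w j q then load w (Nat.find h) else 0

/-- The work done in slot `q` on the first `k` jobs. -/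
def workBelow (w : Fin n → ℕ → ℝ) (k q : ℕ) : ℝ :=
  ∑ j ∈ Finset.univ.filter fun j : Fin n => (j : ℕ) < k, w j q

/-- The fraction of slot `q` spent on the first `k` jobs. -/
def fracBelow (w : Fin n → ℕ → ℝ) (k q : ℕ) : ℝ := workBelow w k q / load w q

/-- The jobs of `J` among the first `k` jobs that are released in `[lo, hi)`. -/
def jobsIn (I : Instance n) (J : Finset (Fin n)) (k lo hi : ℕ) : Finset (Fin n) :=
  {j ∈ J | (j : ℕ) < k ∧ lo ≤ I.r j ∧ I.r j < hi}

open Classical in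
/-- The work of the jobs in `B` of level `lam`. -/
def levelWork (I : Instance n) (w : Fin n → ℕ → ℝ) (B : Finset (Fin n)) (lam : ℝ) : ℕ :=
  ∑ j ∈ B with level w j = lam, I.p j

open Classical in
/-- The number of slots in `[lo, hi)` of load `lam`. -/
def levelSlots (w : Fin n → ℕ → ℝ) (lam : ℝ) (lo hi : ℕ) : ℕ :=
  {q ∈ Finset.Ico lo hi | load w q = lam}.card

open Classical in
/-- The number of slots in `[lo, hi)` of a load different from `lam`. -/
def otherSlots (w : Fin n → ℕ → ℝ) (lam : ℝ) (lo hi : ℕ) : ℕ :=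
  {q ∈ Finset.Ico lo hi | load w q ≠ lam}.card

lemma mem_jobsIn {k lo hi : ℕ} {j : Fin n} : j ∈ jobsIn I J k lo hi ↔
    j ∈ J ∧ (j : ℕ) < k ∧ lo ≤ I.r j ∧ I.r j < hi := by
  simp [jobsIn]

lemma levelSlots_add_otherSlots (lam : ℝ) {lo hi : ℕ} (h : lo ≤ hi) :
    (levelSlots w lam lo hi : ℝ) + otherSlots w lam lo hi = (hi : ℝ) - lo := by
  classical
  rw [← Nat.cast_sub h, ← Nat.cast_add, ← Nat.card_Ico lo hi, levelSlots, otherSlots]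
  congr 1
  exact Finset.card_filter_add_card_filter_not _

lemma otherSlots_add (lam : ℝ) {a b c : ℕ} (hab : a ≤ b) (hbc : b ≤ c) :
    otherSlots w lam a b + otherSlots w lam b c = otherSlots w lam a c := by
  classical
  rw [otherSlots, otherSlots, otherSlots, ← Finset.Ico_union_Ico_eq_Ico hab hbc,
    Finset.filter_union, Finset.card_union_of_disjoint]
  exact Finset.disjoint_filter_filter (Finset.Ico_disjoint_Ico_consecutive a b c)

lemma jobsIn_union {k a b c : ℕ} (hab : a ≤ b) (hbc : b ≤ c) :
    jobsIn I J k a b ∪ jobsIn I J k b c = jobsIn I J k a c := by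
  ext j
  simp only [Finset.mem_union, mem_jobsIn]
  constructor
  · rintro (⟨h1, h2, h3, h4⟩ | ⟨h1, h2, h3, h4⟩)
    · exact ⟨h1, h2, h3, by omega⟩
    · exact ⟨h1, h2, by omega, h4⟩
  · rintro ⟨h1, h2, h3, h4⟩
    rcases lt_or_ge (I.r j) b with h | h
    · exact Or.inl ⟨h1, h2, h3, h⟩
    · exact Or.inr ⟨h1, h2, h, h4⟩

lemma jobsIn_disjoint {k a b c : ℕ} :
    Disjoint (jobsIn I J k a b) (jobsIn I J k b c) := by
  rw [Finset.disjoint_left]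
  intro j h1 h2
  rw [mem_jobsIn] at h1 h2
  omega

lemma levelWork_union {A B : Finset (Fin n)} (h : Disjoint A B) (lam : ℝ) :
    levelWork I w (A ∪ B) lam = levelWork I w A lam + levelWork I w B lam := by
  classical
  rw [levelWork, Finset.filter_union, Finset.sum_union]
  · rfl
  · exact Finset.disjoint_filter_filter h

lemma levelWork_mono {A B : Finset (Fin n)} (h : A ⊆ B) (lam : ℝ) :
    levelWork I w A lam ≤ levelWork I w B lam :=
  Finset.sum_le_sum_of_subset (Finset.filter_subset_filter _ h)

lemma levelWork_le_P (A : Finset (Fin n)) (lam : ℝ) : levelWork I w A lam ≤ I.P :=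
  I.sum_p_le_P _

lemma workBelow_succ (k : Fin n) (q : ℕ) :
    workBelow w (k + 1) q = workBelow w k q + w k q := by
  have : ({j : Fin n | (j : ℕ) < k + 1} : Finset (Fin n)) =
      insert k ({j : Fin n | (j : ℕ) < k} : Finset (Fin n)) := by
    ext j
    simp only [Finset.mem_filter, Finset.mem_univ, true_and, Finset.mem_insert, Fin.ext_iff]
    omega
  rw [workBelow, this, Finset.sum_insert (by simp), add_comm]
  rfl

namespace IsEDFOptimal

lemma workBelow_nonneg (hw : IsEDFOptimal I J w) (k q : ℕ) : 0 ≤ workBelow w k q :=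
  Finset.sum_nonneg fun j _ => hw.nonneg j q

lemma load_nonneg (hw : IsEDFOptimal I J w) (q : ℕ) : 0 ≤ load w q :=
  Finset.sum_nonneg fun j _ => hw.nonneg j q

lemma le_load (hw : IsEDFOptimal I J w) (j : Fin n) (q : ℕ) : w j q ≤ load w q :=
  Finset.single_le_sum (f := fun j => w j q) (fun j _ => hw.nonneg j q) (Finset.mem_univ j)

lemma workBelow_mono (hw : IsEDFOptimal I J w) {k k' : ℕ} (h : k ≤ k') (q : ℕ) :
    workBelow w k q ≤ workBelow w k' q := by
  refine Finset.sum_le_sum_of_subset_of_nonneg ?_ fun j _ _ => hw.nonneg j q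
  intro j
  simp only [Finset.mem_filter, Finset.mem_univ, true_and]
  omega

lemma workBelow_le_load (hw : IsEDFOptimal I J w) (k q : ℕ) : workBelow w k q ≤ load w q :=
  Finset.sum_le_sum_of_subset_of_nonneg (Finset.subset_univ _) fun j _ _ => hw.nonneg j q

lemma fracBelow_nonneg (hw : IsEDFOptimal I J w) (k q : ℕ) : 0 ≤ fracBelow w k q :=
  div_nonneg (hw.workBelow_nonneg k q) (hw.load_nonneg q)

lemma fracBelow_le_one (hw : IsEDFOptimal I J w) (k q : ℕ) : fracBelow w k q ≤ 1 :=
  div_le_one_of_le₀ (hw.workBelow_le_load k q) (hw.load_nonneg q)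

lemma fracBelow_mono (hw : IsEDFOptimal I J w) {k k' : ℕ} (h : k ≤ k') (q : ℕ) :
    fracBelow w k q ≤ fracBelow w k' q :=
  div_le_div_of_nonneg_right (hw.workBelow_mono h q) (hw.load_nonneg q)

lemma exists_of_workBelow_lt (hw : IsEDFOptimal I J w) {k q : ℕ}
    (h : workBelow w k q < load w q) : ∃ K : Fin n, k ≤ K ∧ 0 < w K q := by
  by_contra! hc
  have hz : ∀ K : Fin n, k ≤ K → w K q = 0 := fun K hK => le_antisymm (hc K hK) (hw.nonneg K q)
  refine h.ne (Finset.sum_subset (Finset.subset_univ _) fun j _ hj => hz j ?_)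
  simpa using hj

lemma lt_L (hw : IsEDFOptimal I J w) {j : Fin n} {q : ℕ} (h : 0 < w j q) : q < I.L :=
  (hw.support j q h).2.2.trans_le (I.d_le_L j)

lemma load_pos (hw : IsEDFOptimal I J w) {j : Fin n} {q : ℕ} (h : 0 < w j q) : 0 < load w q :=
  h.trans_le (hw.le_load j q)

lemma exists_pos (hw : IsEDFOptimal I J w) {j : Fin n} (hj : j ∈ J) : ∃ q, 0 < w j q := by
  by_contra! h
  have h1 := hw.total j hj
  rw [Finset.sum_eq_zero fun q _ => le_antisymm (h q) (hw.nonneg j q)] at h1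
  have := I.work_pos j
  have h2 : (I.p j : ℝ) ≠ 0 := by positivity
  exact h2 h1.symm

/-- Balance applies in both directions between two slots in which `j` is processed, so their loads
are equal and the first slot chosen in `level` stands for all of them. -/
lemma load_eq_level (hw : IsEDFOptimal I J w) {j : Fin n} {q : ℕ} (h : 0 < w j q) :
    load w q = level w j := by
  classical
  have hex : ∃ q, 0 < w j q := ⟨q, h⟩
  have hf := Nat.find_spec hex
  rw [level, dif_pos hex]
  obtain ⟨-, h1, h2⟩ := hw.support j _ h
  obtain ⟨-, h3, h4⟩ := hw.support j _ hf
  exact le_antisymm (hw.balanced j _ _ h h3 h4) (hw.balanced j _ _ hf h1 h2)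

lemma level_le (hw : IsEDFOptimal I J w) {j : Fin n} (hj : j ∈ J) {q : ℕ} (h1 : I.r j ≤ q)
    (h2 : q < I.d j) : level w j ≤ load w q := by
  obtain ⟨q', h⟩ := hw.exists_pos hj
  rw [← hw.load_eq_level h]
  exact hw.balanced j _ _ h h1 h2

lemma level_pos (hw : IsEDFOptimal I J w) {j : Fin n} (hj : j ∈ J) : 0 < level w j := by
  obtain ⟨q', h⟩ := hw.exists_pos hj
  rw [← hw.load_eq_level h]
  exact hw.load_pos h

/-- While some job of index at least `k` is processed, no released job of smaller index is
left unfinished. -/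
lemma finished (hw : IsEDFOptimal I J w) {k q : ℕ} {K : Fin n} (hkK : k ≤ K) (hK : 0 < w K q)
    {j : Fin n} (hj : (j : ℕ) < k) (hr : I.r j ≤ q) {q' : ℕ} (hq : q < q') : w j q' = 0 :=
  hw.edf j K q q' (Fin.lt_def.2 (hj.trans_le hkK)) hr hq hK

/-- Double counting: a job of level `lam` does no work in slots of another load, so these slots can
be discarded. This converts amounts of work into numbers of slots in all later duration formulas. -/
lemma sum_work_eq (hw : IsEDFOptimal I J w) {B : Finset (Fin n)} {lam : ℝ} {lo hi : ℕ}
    (hB : B ⊆ J) (hlam : ∀ j ∈ B, level w j = lam)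
    (hin : ∀ j ∈ B, ∀ q, 0 < w j q → lo ≤ q ∧ q < hi) :
    ∑ j ∈ B, (I.p j : ℝ) =
      ∑ q ∈ Finset.Ico lo hi, if load w q = lam then ∑ j ∈ B, w j q else 0 := by
  classical
  have h1 : ∀ q, (if load w q = lam then ∑ j ∈ B, w j q else 0) = ∑ j ∈ B, w j q := by
    intro q
    split_ifs with h
    · rfl
    · refine (Finset.sum_eq_zero fun j hj => ?_).symm
      by_contra hne
      have := lt_of_le_of_ne (hw.nonneg j q) (Ne.symm hne)
      exact h ((hw.load_eq_level this).trans (hlam j hj))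
  simp only [h1]
  rw [Finset.sum_comm]
  refine Finset.sum_congr rfl fun j hj => ?_
  rw [← hw.total j (hB hj)]
  have h2 : ∀ s : Finset ℕ, (∀ q, 0 < w j q → q ∈ s) → ∑ q ∈ s, w j q = ∑ᶠ q, w j q := by
    intro s hs
    rw [finsum_eq_sum_of_support_subset]
    intro q hq
    exact hs q (lt_of_le_of_ne (hw.nonneg j q) (Ne.symm hq))
  rw [h2 _ fun q h => Finset.mem_range.2 (hw.lt_L h),
    h2 _ fun q h => Finset.mem_Ico.2 (hin j hj q h)]

/-- The slots of load `lam` are filled exactly by the jobs of level `lam`. Hence every speed that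
occurs is a quotient `i / l` of a total work `i ≤ P` by a number of slots `l ≤ L`, which is why the
recursion only tries such speeds. -/
lemma levelSlots_mul (hw : IsEDFOptimal I J w) (lam : ℝ) :
    lam * levelSlots w lam 0 I.L = levelWork I w J lam := by
  classical
  rw [levelWork, Nat.cast_sum, hw.sum_work_eq (lo := 0) (hi := I.L) (lam := lam)
    (Finset.filter_subset _ _) (fun j hj => (Finset.mem_filter.1 hj).2)
    (fun j _ q h => ⟨Nat.zero_le _, hw.lt_L h⟩)]
  rw [← Finset.sum_filter, levelSlots, mul_comm, ← nsmul_eq_mul, ← Finset.sum_const]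
  refine Finset.sum_congr rfl fun q hq => ?_
  have hq := (Finset.mem_filter.1 hq).2
  refine hq.symm.trans ((Finset.sum_subset (Finset.subset_univ _) fun j _ hj => ?_).symm)
  by_contra hne
  have h := lt_of_le_of_ne (hw.nonneg j q) (Ne.symm hne)
  exact hj (Finset.mem_filter.2 ⟨(hw.support j q h).1, (hw.load_eq_level h).symm.trans hq⟩)

lemma levelSlots_pos {q : ℕ} (hq : q < I.L) : 0 < levelSlots w (load w q) 0 I.L := by
  classical
  exact Finset.card_pos.2 ⟨q, Finset.mem_filter.2 ⟨Finset.mem_Ico.2 ⟨Nat.zero_le _, hq⟩, rfl⟩⟩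

lemma levelSlots_le (lam : ℝ) : levelSlots w lam 0 I.L ≤ I.L := by
  classical
  exact (Finset.card_filter_le _ _).trans (by simp)

lemma levelWork_pos (hw : IsEDFOptimal I J w) {q : ℕ} (hq : q < I.L) (h : 0 < load w q) :
    0 < levelWork I w J (load w q) := by
  have h1 := hw.levelSlots_mul (load w q)
  have h2 : (0 : ℝ) < levelSlots w (load w q) 0 I.L := by exact_mod_cast levelSlots_pos hq
  have h3 := mul_pos h h2
  rw [h1] at h3
  exact_mod_cast h3

/-- The time per unit of work at this level, in the form `l / i` in which the recursion measures
time. -/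
lemma inv_load (hw : IsEDFOptimal I J w) {q : ℕ} (h : 0 < load w q) (hq : q < I.L) :
    ((levelSlots w (load w q) 0 I.L : ℝ) / levelWork I w J (load w q)) = (load w q)⁻¹ := by
  have h1 := hw.levelSlots_mul (load w q)
  have h2 : (0 : ℝ) < levelWork I w J (load w q) := by exact_mod_cast hw.levelWork_pos hq h
  field_simp
  linarith

/-! ### Start, resumption and end times expressed through works and numbers of slots. -/

/-- The work of the jobs of one level that are released and processed in a segment which
these jobs fill completely. -/
lemma segment (hw : IsEDFOptimal I J w) {k m q : ℕ} (hm : m ≤ q)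
    (hdm : ∀ j : Fin n, (j : ℕ) < k → I.r j < m → ∀ q', m ≤ q' → w j q' = 0)
    (hdq : ∀ j : Fin n, (j : ℕ) < k → I.r j ≤ q → ∀ q', q < q' → w j q' = 0)
    (hfull : ∀ q', m ≤ q' → q' < q → load w q' = load w q → workBelow w k q' = load w q) :
    (levelWork I w (jobsIn I J k m (q + 1)) (load w q) : ℝ) =
      load w q * levelSlots w (load w q) m q + workBelow w k q := by
  classical
  set B := {j ∈ jobsIn I J k m (q + 1) | level w j = load w q} with hB
  have hBm : ∀ j, j ∈ B ↔ (j ∈ J ∧ (j : ℕ) < k ∧ m ≤ I.r j ∧ I.r j < q + 1) ∧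
      level w j = load w q := by
    intro j
    rw [hB, Finset.mem_filter, mem_jobsIn]
  rw [levelWork, Nat.cast_sum, hw.sum_work_eq (lo := m) (hi := q + 1) (lam := load w q)
    (fun j hj => ((hBm j).1 hj).1.1) (fun j hj => ((hBm j).1 hj).2) ?_]
  -- In such a slot the work on the first `k` jobs belongs to `B`: the load fixes the level, and a
  -- job released before `m` no longer runs from `m` on.
  · have hin : ∀ q', m ≤ q' → q' ≤ q → load w q' = load w q →
        ∑ j ∈ B, w j q' = workBelow w k q' := by
      intro q' h1 h2 h3
      refine Finset.sum_subset (fun j hj => ?_) fun j hjk hj => ?_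
      · simpa using ((hBm j).1 hj).1.2.1
      · by_contra hne
        have h := lt_of_le_of_ne (hw.nonneg j q') (Ne.symm hne)
        have hjk : (j : ℕ) < k := by simpa using hjk
        obtain ⟨h4, h5, h6⟩ := hw.support j q' h
        refine hj ((hBm j).2 ⟨⟨h4, hjk, ?_, by omega⟩, (hw.load_eq_level h).symm.trans h3⟩)
        by_contra! hlt
        exact hne (hdm j hjk hlt q' h1)
    rw [Finset.sum_Ico_succ_top hm, if_pos rfl, hin q hm le_rfl rfl, ← Finset.sum_filter,
      levelSlots, mul_comm, ← nsmul_eq_mul, ← Finset.sum_const]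
    congr 1
    refine Finset.sum_congr rfl fun q' hq' => ?_
    obtain ⟨hq', h3⟩ := Finset.mem_filter.1 hq'
    obtain ⟨h1, h2⟩ := Finset.mem_Ico.1 hq'
    rw [hin q' h1 h2.le h3, hfull q' h1 h2 h3]
  · intro j hj q' h
    obtain ⟨⟨h1, h2, h3, h4⟩, -⟩ := (hBm j).1 hj
    refine ⟨h3.trans (hw.support j q' h).2.1, ?_⟩
    by_contra! hlt
    exact h.ne' (hdq j h2 (by omega) q' (by omega))

/-- The times at which a job can start, resume or end lie in `Φ`. -/
lemma exists_code (hw : IsEDFOptimal I J w) (k : ℕ) {q : ℕ} (hL : q < I.L)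
    (hq : 0 < load w q) :
    ∃ s h : ℕ, s ≤ I.L ∧ h ≤ levelWork I w J (load w q) ∧
      (s : ℝ) + h * ((levelSlots w (load w q) 0 I.L : ℝ) / levelWork I w J (load w q)) =
        q + fracBelow w k q := by
  classical
  -- If the first `k` jobs fill the slot, the time in question is the integer `q + 1`.
  rcases (hw.workBelow_le_load k q).eq_or_lt with he | hlt
  · refine ⟨q + 1, 0, hL, Nat.zero_le _, ?_⟩
    simp [fracBelow, he, hq.ne']
  -- `Q` consists of the earlier slots of the same load that are shared with a job of index at least
  -- `k`, and `m` is one past the last of them. At `m` no smaller job released earlier is left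
  -- unfinished, and from `m` to `q` the slots of this load are filled by smaller jobs. Dividing the
  -- work in this segment by the load gives the number of those slots plus `fracBelow w k q`, whence
  -- the witnesses `s` and `h`.
  let Q : Finset ℕ := {q' ∈ Finset.range q | load w q' = load w q ∧ workBelow w k q' < load w q}
  let m := Q.sup (fun x => x + 1)
  have hmq : m ≤ q := Finset.sup_le fun x hx => by
    have := (Finset.mem_filter.1 hx).1
    exact Finset.mem_range.1 this
  have hseg := hw.segment (k := k) (m := m) (q := q) hmq ?_ ?_ ?_
  · refine ⟨q - levelSlots w (load w q) m q, levelWork I w (jobsIn I J k m (q + 1)) (load w q),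
      (Nat.sub_le _ _).trans hL.le, levelWork_mono (Finset.filter_subset _ _) _, ?_⟩
    have hle : levelSlots w (load w q) m q ≤ q :=
      (Finset.card_filter_le _ _).trans (by simp)
    rw [hw.inv_load hq hL, hseg, Nat.cast_sub hle, fracBelow]
    field_simp
    ring
  · intro j hj hr q' hq'
    -- For empty `Q` the supremum is `m = 0`, and no release date lies below it.
    have hne : Q.Nonempty := by
      by_contra hne
      rw [Finset.not_nonempty_iff_eq_empty] at hne
      simp [m, hne] at hr
    obtain ⟨x, hx, hxm⟩ := Finset.exists_mem_eq_sup Q hne (fun x => x + 1)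
    obtain ⟨-, hx1, hx2⟩ := Finset.mem_filter.1 hx
    obtain ⟨K, hK, hKx⟩ := hw.exists_of_workBelow_lt (hx1 ▸ hx2)
    have hm : m = x + 1 := hxm
    exact hw.finished hK hKx hj (by omega) (by omega)
  · intro j hj hr q' hq'
    obtain ⟨K, hK, hKq⟩ := hw.exists_of_workBelow_lt hlt
    exact hw.finished hK hKq hj hr hq'
  · intro q' h1 h2 h3
    by_contra hne
    have hlt' : workBelow w k q' < load w q :=
      lt_of_le_of_ne (h3 ▸ hw.workBelow_le_load k q') hne
    have : q' ∈ Q := Finset.mem_filter.2 ⟨Finset.mem_range.2 h2, h3, hlt'⟩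
    have := Finset.le_sup (f := fun x => x + 1) this
    change q' + 1 ≤ m at this
    omega

/-- While job `k` is waiting, only jobs of smaller index are processed. -/
lemma waiting (hw : IsEDFOptimal I J w) {k : Fin n} {q q₁ : ℕ} (hr : I.r k ≤ q) (hlt : q < q₁)
    (hk : 0 < w k q₁) : workBelow w (k + 1) q = load w q ∧ level w k ≤ load w q := by
  obtain ⟨hkJ, h1, h2⟩ := hw.support k q₁ hk
  refine ⟨?_, hw.level_le hkJ hr (hlt.trans h2)⟩
  refine (hw.workBelow_le_load _ q).eq_or_lt.resolve_right fun h => ?_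
  obtain ⟨K, hK, hKq⟩ := hw.exists_of_workBelow_lt h
  exact hk.ne' (hw.finished hK hKq (Nat.lt_succ_self _) hr hlt)

/-- The duration of a group of jobs that interrupts job `k`: the group starts with the
release date `s` and job `k` resumes in slot `q`. -/
lemma group (hw : IsEDFOptimal I J w) {k : Fin n} {s q : ℕ} (hr : I.r k ≤ s) (hsq : s ≤ q)
    (hk : 0 < w k q) (hno : ∀ q', s ≤ q' → q' < q → w k q' = 0)
    (hds : ∀ j : Fin n, (j : ℕ) < k → I.r j < s → ∀ q', s ≤ q' → w j q' = 0) :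
    (s : ℝ) + otherSlots w (level w k) s q + levelWork I w (jobsIn I J k s (q + 1)) (level w k) *
      ((levelSlots w (level w k) 0 I.L : ℝ) / levelWork I w J (level w k)) =
      q + fracBelow w k q := by
  have hlev := hw.load_eq_level hk
  -- While `k` waits, slots of its level are filled by smaller jobs. The work of that level
  -- therefore measures these slots together with the initial part of slot `q`, and the slots of
  -- other loads are counted as whole units of time.
  have hseg := hw.segment (k := k) hsq hds
    (fun j hj hr q' hq' => hw.finished le_rfl hk hj hr hq') ?_
  · rw [← hlev, hw.inv_load (hw.load_pos hk) (hw.lt_L hk), hseg, fracBelow]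
    have h1 := levelSlots_add_otherSlots (w := w) (load w q) hsq
    have := (hw.load_pos hk).ne'
    field_simp
    linear_combination load w q * h1
  · intro q' h1 h2 h3
    have h := (hw.waiting (hr.trans h1) h2 hk).1
    rw [workBelow_succ, hno q' h1 h2, add_zero] at h
    rw [h, h3]

/-- The total duration from the start of job `k` in slot `q₀` to its end in slot `q₁`. -/
lemma span (hw : IsEDFOptimal I J w) {k : Fin n} {q₀ q₁ : ℕ} (h₀ : 0 < w k q₀) (h₁ : 0 < w k q₁)
    (hfirst : ∀ q, 0 < w k q → q₀ ≤ q) (hlast : ∀ q, 0 < w k q → q ≤ q₁) :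
    (q₁ + fracBelow w (k + 1) q₁) - (q₀ + fracBelow w k q₀) =
      otherSlots w (level w k) q₀ q₁ +
      (I.p k + levelWork I w (jobsIn I J k (q₀ + 1) (q₁ + 1)) (level w k)) *
      ((levelSlots w (level w k) 0 I.L : ℝ) / levelWork I w J (level w k)) := by
  classical
  have hlev := hw.load_eq_level h₁
  have hlev₀ := hw.load_eq_level h₀
  have h01 : q₀ ≤ q₁ := hfirst q₁ h₁
  obtain ⟨hkJ, hkr, hkd⟩ := hw.support k q₀ h₀
  set lam := level w k with hlam
  set B := insert k {j ∈ jobsIn I J k (q₀ + 1) (q₁ + 1) | level w j = lam} with hB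
  have hkB : k ∉ {j ∈ jobsIn I J k (q₀ + 1) (q₁ + 1) | level w j = lam} := by
    simp [mem_jobsIn]
  have hBm : ∀ j, j ∈ B ↔ j = k ∨ (j ∈ J ∧ (j : ℕ) < k ∧ q₀ + 1 ≤ I.r j ∧ I.r j < q₁ + 1) ∧
      level w j = lam := by
    intro j
    rw [hB, Finset.mem_insert, Finset.mem_filter, mem_jobsIn]
  have hsum : (I.p k + levelWork I w (jobsIn I J k (q₀ + 1) (q₁ + 1)) lam : ℝ) =
      ∑ j ∈ B, (I.p j : ℝ) := by
    rw [hB, Finset.sum_insert hkB, levelWork, Nat.cast_sum]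
  have hcount := hw.sum_work_eq (B := B) (lo := q₀) (hi := q₁ + 1) (lam := lam) ?_ ?_ ?_
  -- Only in slot `q₀` can smaller jobs outside `B` appear: they were released by `q₀` and finish
  -- there before `k` starts. This accounts for the correction `workBelow w k q₀`.
  · have hin : ∀ q, q₀ ≤ q → q ≤ q₁ → load w q = lam → ∑ j ∈ B, w j q =
        workBelow w (k + 1) q - if q = q₀ then workBelow w k q₀ else 0 := by
      intro q h1 h2 h3
      split_ifs with h
      · subst h
        rw [workBelow_succ, add_sub_cancel_left]
        refine Finset.sum_eq_single k (fun j hj hne => ?_)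
          fun h => absurd ((hBm k).2 (Or.inl rfl)) h
        by_contra hne'
        have hpos := lt_of_le_of_ne (hw.nonneg j q) (Ne.symm hne')
        have := (hw.support j q hpos).2.1
        have := ((hBm j).1 hj).resolve_left hne
        omega
      · rw [sub_zero]
        refine Finset.sum_subset (fun j hj => ?_) fun j hjk hj => ?_
        · rcases (hBm j).1 hj with h | h
          · simp [h]
          · simp only [Finset.mem_filter, Finset.mem_univ, true_and]
            omega
        · by_contra hne
          have hpos := lt_of_le_of_ne (hw.nonneg j q) (Ne.symm hne)
          have hjk : (j : ℕ) < k + 1 := by simpa using hjk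
          obtain ⟨h4, h5, h6⟩ := hw.support j q hpos
          have hne' : j ≠ k := fun h => hj ((hBm j).2 (Or.inl h))
          have hjk' : (j : ℕ) < k := by
            have : (j : ℕ) ≠ k := fun h => hne' (Fin.ext h)
            omega
          refine hj ((hBm j).2 (Or.inr ⟨⟨h4, hjk', ?_, by omega⟩,
            (hw.load_eq_level hpos).symm.trans h3⟩))
          by_contra! hlt
          exact hne (hw.finished le_rfl h₀ hjk' (by omega) (by omega))
    have hsplit : (∑ q ∈ Finset.Ico q₀ (q₁ + 1), if load w q = lam then ∑ j ∈ B, w j q else 0) =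
        (∑ q ∈ Finset.Ico q₀ (q₁ + 1), if load w q = lam then workBelow w (k + 1) q else 0) -
        ∑ q ∈ Finset.Ico q₀ (q₁ + 1), if q = q₀ then workBelow w k q₀ else 0 := by
      rw [← Finset.sum_sub_distrib]
      refine Finset.sum_congr rfl fun q hq => ?_
      obtain ⟨h1, h2⟩ := Finset.mem_Ico.1 hq
      split_ifs with h3 h4 h4
      · rw [hin q h1 (by omega) h3, if_pos h4]
      · rw [hin q h1 (by omega) h3, if_neg h4]
      · exact absurd (h4 ▸ hlev₀) h3
      · simp
    have hfull : (∑ q ∈ Finset.Ico q₀ q₁, if load w q = lam then workBelow w (k + 1) q else 0) =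
        lam * levelSlots w lam q₀ q₁ := by
      rw [← Finset.sum_filter, levelSlots, mul_comm, ← nsmul_eq_mul, ← Finset.sum_const]
      refine Finset.sum_congr rfl fun q hq => ?_
      obtain ⟨hq, h3⟩ := Finset.mem_filter.1 hq
      obtain ⟨h1, h2⟩ := Finset.mem_Ico.1 hq
      rw [(hw.waiting (hkr.trans h1) h2 h₁).1, h3]
    rw [hsplit, Finset.sum_Ico_succ_top h01, hfull, if_pos hlev, Finset.sum_ite_eq',
      if_pos (Finset.mem_Ico.2 ⟨le_rfl, by omega⟩)] at hcount
    have h2 := hw.inv_load (hw.load_pos h₁) (hw.lt_L h₁)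
    rw [hlev] at h2
    rw [hsum, hcount, h2, fracBelow, fracBelow, hlev, hlev₀]
    have h1 := levelSlots_add_otherSlots (w := w) lam h01
    have : lam ≠ 0 := (hw.level_pos hkJ).ne'
    field_simp
    linear_combination - lam * h1
  · intro j hj
    rcases (hBm j).1 hj with h | h
    · exact h ▸ hkJ
    · exact h.1.1
  · intro j hj
    rcases (hBm j).1 hj with h | h
    · exact h ▸ rfl
    · exact h.2
  · intro j hj q hpos
    rcases (hBm j).1 hj with h | ⟨⟨h1, h2, h3, h4⟩, -⟩
    · subst h
      exact ⟨hfirst q hpos, Nat.lt_succ_of_le (hlast q hpos)⟩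
    · refine ⟨by have := (hw.support j q hpos).2.1; omega, ?_⟩
      by_contra! hlt
      exact hpos.ne' (hw.finished le_rfl h₁ h2 (by omega) (by omega))

/-- As long as no job of smaller index is released, job `k` runs alone. -/
lemma otherSlots_eq_zero (hw : IsEDFOptimal I J w) {k : Fin n} {q₀ s q₁ : ℕ}
    (h₀ : 0 < w k q₀) (h₁ : 0 < w k q₁) (hs : s ≤ q₁)
    (hno : jobsIn I J k (q₀ + 1) s = ∅) : otherSlots w (level w k) q₀ s = 0 := by
  classical
  rw [otherSlots, Finset.card_eq_zero, Finset.filter_eq_empty_iff]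
  intro q hq
  obtain ⟨h1, h2⟩ := Finset.mem_Ico.1 hq
  rw [not_not]
  rcases h1.eq_or_lt with rfl | h1
  · exact hw.load_eq_level h₀
  obtain ⟨hkJ, hkr, hkd⟩ := hw.support k q₀ h₀
  obtain ⟨hf, hle⟩ := hw.waiting (hkr.trans h1.le) (h2.trans_le hs) h₁
  -- The slot is filled by the first `k + 1` jobs. Since none of the first `k` can be present, it is
  -- `k` that runs, so the slot has the level of `k`.
  have hpos : 0 < workBelow w (k + 1) q := hf ▸ (hw.level_pos hkJ).trans_le hle
  have hz : workBelow w k q = 0 := by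
    refine Finset.sum_eq_zero fun j hj => ?_
    have hj : (j : ℕ) < k := by simpa using hj
    by_contra hne
    have hp := lt_of_le_of_ne (hw.nonneg j q) (Ne.symm hne)
    obtain ⟨h4, h5, h6⟩ := hw.support j q hp
    rcases le_or_gt (I.r j) q₀ with h | h
    · exact hne (hw.finished le_rfl h₀ hj h h1)
    · have : j ∈ jobsIn I J k (q₀ + 1) s := mem_jobsIn.2 ⟨h4, hj, by omega, by omega⟩
      simp [hno] at this
  rw [workBelow_succ, hz, zero_add] at hpos
  exact hw.load_eq_level hpos

end IsEDFOptimal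

end SpeedScaling

end

noncomputable section

namespace SpeedScaling

/-! ## The lower bound for the energy -/

open MeasureTheory

variable {n : ℕ} {I : Instance n} {J : Finset (Fin n)} {w : Fin n → ℕ → ℝ}

/-- The energy spent on a set of jobs, each processed at the speed given by its level. -/
def levelEnergy (I : Instance n) (w : Fin n → ℕ → ℝ) (α : ℝ) (B : Finset (Fin n)) : ℝ :=
  ∑ j ∈ B, level w j ^ (α - 1) * I.p j

/-- The tangent of the power function at `v` lies below it. -/
lemma tangent_le {α v s : ℝ} (hα : 1 < α) (hv : 0 ≤ v) (hs : 0 ≤ s) :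
    α * v ^ (α - 1) * s ≤ s ^ α + (α - 1) * v ^ α := by
  -- Young's inequality for `s` and `v ^ (α - 1)` with the exponents `α` and `α / (α - 1)`.
  have hq : α.HolderConjugate (α / (α - 1)) := Real.HolderConjugate.conjExponent hα
  have h := Real.young_inequality_of_nonneg hs (Real.rpow_nonneg hv (α - 1)) hq
  have h1 : α - 1 ≠ 0 := by linarith
  have h0 : (0 : ℝ) < α := by linarith
  rw [← Real.rpow_mul hv, mul_div_cancel₀ _ h1] at h
  calc α * v ^ (α - 1) * s = α * (s * v ^ (α - 1)) := by ring
    _ ≤ α * (s ^ α / α + v ^ α / (α / (α - 1))) := by gcongr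
    _ = s ^ α + (α - 1) * v ^ α := by field_simp

namespace IsEDFOptimal

lemma levelEnergy_nonneg (hw : IsEDFOptimal I J w) (α : ℝ) {B : Finset (Fin n)} (hB : B ⊆ J) :
    0 ≤ levelEnergy I w α B :=
  Finset.sum_nonneg fun _ hj =>
    mul_nonneg (Real.rpow_nonneg (hw.level_pos (hB hj)).le _) (Nat.cast_nonneg _)

/-- Write `load ^ α` as the sum of `load ^ (α - 1) * w j q` over the jobs, replace the load by the
level of each job present, and sum over the slots first. So the lower bound is the energy of the
balanced distribution itself, run at constant speed in each slot. -/
lemma sum_load_rpow (hw : IsEDFOptimal I J w) {α : ℝ} (hα : 1 < α) :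
    ∑ q ∈ Finset.range I.L, load w q ^ α = levelEnergy I w α J := by
  have h1 : ∀ q, load w q ^ α = ∑ j, level w j ^ (α - 1) * w j q := by
    intro q
    have h2 : ∀ j, level w j ^ (α - 1) * w j q = load w q ^ (α - 1) * w j q := by
      intro j
      rcases (hw.nonneg j q).eq_or_lt with h | h
      · simp [← h]
      · rw [hw.load_eq_level h]
    rw [Finset.sum_congr rfl fun j _ => h2 j, ← Finset.mul_sum]
    change _ = _ * load w q
    rcases (hw.load_nonneg q).eq_or_lt with h | h
    · simp [← h, Real.zero_rpow (by linarith : α ≠ 0)]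
    · nth_rw 3 [← Real.rpow_one (load w q)]
      rw [← Real.rpow_add h]
      congr 1
      ring
  rw [Finset.sum_congr rfl fun q _ => h1 q, Finset.sum_comm, levelEnergy,
    ← Finset.sum_subset (Finset.subset_univ J)]
  · refine Finset.sum_congr rfl fun j hj => ?_
    rw [← Finset.mul_sum, hw.total j hj]
  · intro j _ hj
    refine Finset.sum_eq_zero fun q _ => ?_
    have : w j q = 0 := by
      by_contra hne
      exact hj (hw.support j q (lt_of_le_of_ne (hw.nonneg j q) (Ne.symm hne))).1
    simp [this]

/-- Every schedule that completes the jobs of `J` on time spends at least the energy given by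
the levels. -/
theorem levelEnergy_le (hw : IsEDFOptimal I J w) {α : ℝ} (hα : 1 < α) (σ : Schedule n)
    (hσ : ∀ j ∈ J, I.OnTime σ j) : ENNReal.ofReal (levelEnergy I w α J) ≤ σ.energy α := by
  classical
  let slot : ℕ → Set ℝ := fun q => Set.Ico (q : ℝ) (q + 1)
  let A : Fin n → Set ℝ := fun j => {t | σ.job t = some j} ∩ Set.Ico (I.r j : ℝ) (I.d j : ℝ)
  have hA : ∀ j, MeasurableSet (A j) := fun j => (σ.measurable_job j).inter measurableSet_Ico
  have hs : Measurable fun t => (σ.speed t : ℝ≥0∞) := σ.measurable_speed.coe_nnreal_ennreal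
  have h0 : (0 : ℝ) < α := by linarith
  -- The pointwise form of the duality bound: at most one job runs at time `t`, its level is at most
  -- the load of the slot containing `t`, and the tangent is taken at that load.
  have hpt : ∀ t, ∑ j ∈ J, (A j).indicator
      (fun t => ENNReal.ofReal (α * level w j ^ (α - 1)) * (σ.speed t : ℝ≥0∞)) t ≤
      (σ.speed t : ℝ≥0∞) ^ α + ∑ q ∈ Finset.range I.L, (slot q).indicator
        (fun _ => ENNReal.ofReal ((α - 1) * load w q ^ α)) t := by
    intro t
    by_cases hex : ∃ j ∈ J, t ∈ A j
    · obtain ⟨j, hj, htj⟩ := hex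
      have huniq : ∀ i ∈ J, i ≠ j → (A i).indicator
          (fun t => ENNReal.ofReal (α * level w i ^ (α - 1)) * (σ.speed t : ℝ≥0∞)) t = 0 := by
        intro i _ hij
        refine Set.indicator_of_notMem (fun hti => hij ?_) _
        exact Option.some_injective _ (hti.1.symm.trans htj.1)
      rw [Finset.sum_eq_single_of_mem j hj huniq, Set.indicator_of_mem htj]
      obtain ⟨-, h1, h2⟩ := htj
      have ht0 : 0 ≤ t := (Nat.cast_nonneg _).trans h1
      -- As release dates and deadlines are integers, the whole slot around `t` lies in the window
      -- of `j`.
      set q := ⌊t⌋₊ with hq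
      have hq1 : (q : ℝ) ≤ t := Nat.floor_le ht0
      have hq2 : t < q + 1 := Nat.lt_floor_add_one t
      have hr : I.r j ≤ q := Nat.le_floor h1
      have hd : q < I.d j := by exact_mod_cast hq1.trans_lt h2
      have hqL : q ∈ Finset.range I.L := Finset.mem_range.2 (hd.trans_le (I.d_le_L j))
      have hle : level w j ^ (α - 1) ≤ load w q ^ (α - 1) :=
        Real.rpow_le_rpow (hw.level_pos hj).le (hw.level_le hj hr hd) (by linarith)
      have hmain : α * level w j ^ (α - 1) * σ.speed t ≤
          (σ.speed t : ℝ) ^ α + (α - 1) * load w q ^ α :=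
        (by gcongr : α * level w j ^ (α - 1) * σ.speed t ≤
          α * load w q ^ (α - 1) * σ.speed t).trans
          (tangent_le hα (hw.load_nonneg q) (NNReal.coe_nonneg (σ.speed t)))
      calc ENNReal.ofReal (α * level w j ^ (α - 1)) * (σ.speed t : ℝ≥0∞)
          = ENNReal.ofReal (α * level w j ^ (α - 1) * σ.speed t) := by
            rw [ENNReal.ofReal_mul' (NNReal.coe_nonneg (σ.speed t)), ENNReal.ofReal_coe_nnreal]
        _ ≤ ENNReal.ofReal ((σ.speed t : ℝ) ^ α + (α - 1) * load w q ^ α) :=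
            ENNReal.ofReal_le_ofReal hmain
        _ = (σ.speed t : ℝ≥0∞) ^ α + ENNReal.ofReal ((α - 1) * load w q ^ α) := by
            rw [ENNReal.ofReal_add (by positivity) (mul_nonneg (by linarith)
              (Real.rpow_nonneg (hw.load_nonneg q) _)),
              ← ENNReal.ofReal_rpow_of_nonneg (NNReal.coe_nonneg (σ.speed t)) h0.le,
              ENNReal.ofReal_coe_nnreal]
        _ ≤ _ := by
            gcongr
            refine le_trans (le_of_eq ?_) (Finset.single_le_sum (f := fun q => (slot q).indicator
              (fun _ => ENNReal.ofReal ((α - 1) * load w q ^ α)) t) (fun _ _ => zero_le)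
              hqL)
            exact (Set.indicator_of_mem (show t ∈ slot q from ⟨hq1, hq2⟩)
              (fun _ => ENNReal.ofReal ((α - 1) * load w q ^ α))).symm
    · push Not at hex
      rw [Finset.sum_eq_zero fun j hj => Set.indicator_of_notMem (hex j hj) _]
      exact zero_le
  have hint := lintegral_mono (μ := volume) hpt
  rw [lintegral_finsetSum _ fun j _ => (hs.const_mul _).indicator (hA j),
    lintegral_add_left (hs.pow_const α),
    lintegral_finsetSum _ fun q _ => measurable_const.indicator measurableSet_Ico] at hint
  have hL : ∀ j ∈ J, ∫⁻ t, (A j).indicator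
      (fun t => ENNReal.ofReal (α * level w j ^ (α - 1)) * (σ.speed t : ℝ≥0∞)) t =
      ENNReal.ofReal (α * (level w j ^ (α - 1) * I.p j)) := by
    intro j hj
    have hon : ∫⁻ t in A j, (σ.speed t : ℝ≥0∞) = I.p j := hσ j hj
    rw [lintegral_indicator (hA j), lintegral_const_mul _ hs, hon, ← mul_assoc,
      ENNReal.ofReal_mul' (Nat.cast_nonneg (I.p j)), ENNReal.ofReal_natCast]
  have hR : ∀ q ∈ Finset.range I.L, ∫⁻ t, (slot q).indicator
      (fun _ => ENNReal.ofReal ((α - 1) * load w q ^ α)) t =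
      ENNReal.ofReal ((α - 1) * load w q ^ α) := by
    intro q _
    rw [lintegral_indicator measurableSet_Ico, setLIntegral_const, Real.volume_Ico]
    simp
  rw [Finset.sum_congr rfl hL, Finset.sum_congr rfl hR,
    ← ENNReal.ofReal_sum_of_nonneg, ← ENNReal.ofReal_sum_of_nonneg, ← Finset.mul_sum,
    ← Finset.mul_sum, hw.sum_load_rpow hα] at hint
  · change ENNReal.ofReal (α * levelEnergy I w α J) ≤ σ.energy α + _ at hint
    have hX := hw.levelEnergy_nonneg α (B := J) subset_rfl
    -- The left side integrates to `α` times the level energy and the slot terms to `α - 1` times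
    -- it. Cancelling this finite amount leaves the bound.
    have hsplit : α * levelEnergy I w α J =
        levelEnergy I w α J + (α - 1) * levelEnergy I w α J := by ring
    rw [hsplit, ENNReal.ofReal_add hX (mul_nonneg (by linarith) hX)] at hint
    exact (ENNReal.add_le_add_iff_right ENNReal.ofReal_ne_top).1 hint
  · intro q _
    exact mul_nonneg (by linarith) (Real.rpow_nonneg (hw.load_nonneg q) _)
  · intro j hj
    exact mul_nonneg h0.le (mul_nonneg (Real.rpow_nonneg (hw.level_pos hj).le _)
      (Nat.cast_nonneg _))

end IsEDFOptimal

end SpeedScaling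

end

noncomputable section

namespace SpeedScaling

/-! ## Schedules given by lists of pieces -/

open MeasureTheory

/-- A piece of a schedule: one job at a constant speed during `[start, finish)`. -/
structure Piece (n : ℕ) where
  job : Fin n
  start : ℝ
  finish : ℝ
  speed : ℝ≥0

variable {n : ℕ}

namespace Piece

/-- The pieces follow one another within `[a, b)`. -/
def Chain : ℝ → List (Piece n) → ℝ → Prop
  | a, [], b => a ≤ b
  | a, p :: l, b => a ≤ p.start ∧ p.start ≤ p.finish ∧ Chain p.finish l b

/-- The work done on job `j`. -/
def work (j : Fin n) (l : List (Piece n)) : ℝ :=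
  (l.map fun p => if p.job = j then (p.finish - p.start) * (p.speed : ℝ) else 0).sum

/-- The energy spent. -/
def energy (α : ℝ) (l : List (Piece n)) : ℝ :=
  (l.map fun p => (p.finish - p.start) * (p.speed : ℝ) ^ α).sum

/-- The function with the value `φ job speed` during each piece and `0` elsewhere. -/
def eval {β : Type*} (φ : Fin n → ℝ≥0 → β) (b : β) : List (Piece n) → ℝ → β
  | [], _ => b
  | p :: l, t => open Classical in if t ∈ Set.Ico p.start p.finish then φ p.job p.speed
      else eval φ b l t

@[simp] lemma work_nil (j : Fin n) : work j [] = 0 := rfl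

@[simp] lemma work_cons (j : Fin n) (p : Piece n) (l : List (Piece n)) : work j (p :: l) =
    (if p.job = j then (p.finish - p.start) * p.speed else 0) + work j l := rfl

@[simp] lemma work_append (j : Fin n) (l l' : List (Piece n)) :
    work j (l ++ l') = work j l + work j l' := by simp [work]

@[simp] lemma energy_nil (α : ℝ) : energy α ([] : List (Piece n)) = 0 := rfl

@[simp] lemma energy_cons (α : ℝ) (p : Piece n) (l : List (Piece n)) : energy α (p :: l) =
    (p.finish - p.start) * (p.speed : ℝ) ^ α + energy α l := rfl

@[simp] lemma energy_append (α : ℝ) (l l' : List (Piece n)) :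
    energy α (l ++ l') = energy α l + energy α l' := by simp [energy]

lemma work_eq_zero {j : Fin n} {l : List (Piece n)} (h : ∀ p ∈ l, p.job ≠ j) :
    work j l = 0 := by
  induction l with
  | nil => rfl
  | cons p l ih =>
    rw [work_cons, if_neg (h p (by simp)), ih fun q hq => h q (by simp [hq]), add_zero]

lemma Chain.le {l : List (Piece n)} {a b : ℝ} (h : Chain a l b) : a ≤ b := by
  induction l generalizing a with
  | nil => exact h
  | cons p l ih => exact h.1.trans (h.2.1.trans (ih h.2.2))

lemma Chain.mono {l : List (Piece n)} {a a' b b' : ℝ} (h : Chain a l b) (ha : a' ≤ a)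
    (hb : b ≤ b') : Chain a' l b' := by
  induction l generalizing a a' with
  | nil => exact ha.trans (le_trans h hb)
  | cons p l ih => exact ⟨ha.trans h.1, h.2.1, ih h.2.2 le_rfl⟩

lemma Chain.append {l l' : List (Piece n)} {a b c : ℝ} (h : Chain a l b) (h' : Chain b l' c) :
    Chain a (l ++ l') c := by
  induction l generalizing a with
  | nil => exact h'.mono h le_rfl
  | cons p l ih => exact ⟨h.1, h.2.1, ih h.2.2⟩

lemma Chain.bounds {l : List (Piece n)} {a b : ℝ} (h : Chain a l b) {p : Piece n} (hp : p ∈ l) :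
    a ≤ p.start ∧ p.start ≤ p.finish ∧ p.finish ≤ b := by
  induction l generalizing a with
  | nil => simp at hp
  | cons q l ih =>
    rcases List.mem_cons.1 hp with rfl | hp
    · exact ⟨h.1, h.2.1, h.2.2.le⟩
    · obtain ⟨h1, h2, h3⟩ := ih h.2.2 hp
      exact ⟨(h.1.trans h.2.1).trans h1, h2, h3⟩

lemma Chain.energy_nonneg {l : List (Piece n)} {a b : ℝ} (h : Chain a l b) (α : ℝ) :
    0 ≤ energy α l := by
  refine List.sum_nonneg fun x hx => ?_
  obtain ⟨p, hp, rfl⟩ := List.mem_map.1 hx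
  exact mul_nonneg (sub_nonneg.2 (h.bounds hp).2.1) (by positivity)

lemma eval_of_notMem {β : Type*} (φ : Fin n → ℝ≥0 → β) (b : β) {l : List (Piece n)} {t : ℝ}
    (h : ∀ p ∈ l, t ∉ Set.Ico p.start p.finish) : eval φ b l t = b := by
  induction l with
  | nil => rfl
  | cons p l ih =>
    rw [eval, if_neg (h p (by simp)), ih fun q hq => h q (by simp [hq])]

lemma Chain.eval_of_mem {β : Type*} (φ : Fin n → ℝ≥0 → β) (b : β) {l : List (Piece n)}
    {a c t : ℝ} (h : Chain a l c) {p : Piece n} (hp : p ∈ l) (ht : t ∈ Set.Ico p.start p.finish) :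
    eval φ b l t = φ p.job p.speed := by
  induction l generalizing a with
  | nil => simp at hp
  | cons q l ih =>
    rcases List.mem_cons.1 hp with rfl | hp
    · rw [eval, if_pos ht]
    · rw [eval, if_neg, ih h.2.2 hp]
      have := (h.2.2.bounds hp).1
      exact fun h' => absurd (h'.2.trans_le this) (not_lt.2 ht.1)

lemma measurable_eval {β : Type*} [MeasurableSpace β] (φ : Fin n → ℝ≥0 → β) (b : β)
    (l : List (Piece n)) : Measurable (eval φ b l) := by
  induction l with
  | nil => exact measurable_const
  | cons p l ih => exact Measurable.ite measurableSet_Ico measurable_const ih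

lemma eval_comp {β γ : Type*} (φ : Fin n → ℝ≥0 → β) (b : β) (f : β → γ) (l : List (Piece n))
    (t : ℝ) : f (eval φ b l t) = eval (fun j s => f (φ j s)) (f b) l t := by
  induction l with
  | nil => rfl
  | cons p l ih =>
    rw [eval, eval]
    split_ifs
    · rfl
    · exact ih

/-- Consecutive pieces are disjoint, so the integrand is a sum of indicator functions. Work and
energy are both instances. -/
lemma Chain.lintegral_eval (φ : Fin n → ℝ≥0 → ℝ≥0) {l : List (Piece n)} {a b : ℝ}
    (h : Chain a l b) : ∫⁻ t, eval (fun j s => (φ j s : ℝ≥0∞)) 0 l t =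
      ENNReal.ofReal (l.map fun p => (p.finish - p.start) * (φ p.job p.speed : ℝ)).sum := by
  induction l generalizing a with
  | nil => simp [eval]
  | cons p l ih =>
    have h1 : eval (fun j s => (φ j s : ℝ≥0∞)) 0 (p :: l) = fun t =>
        (Set.Ico p.start p.finish).indicator (fun _ => (φ p.job p.speed : ℝ≥0∞)) t +
          eval (fun j s => (φ j s : ℝ≥0∞)) 0 l t := by
      funext t
      rw [eval]
      split_ifs with ht
      · rw [Set.indicator_of_mem ht, eval_of_notMem, add_zero]
        intro q hq hq'
        exact absurd (ht.2.trans_le (h.2.2.bounds hq).1) (not_lt.2 hq'.1)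
      · rw [Set.indicator_of_notMem ht, zero_add]
    rw [h1, lintegral_add_right _ (measurable_eval _ _ _), ih h.2.2,
      lintegral_indicator measurableSet_Ico, setLIntegral_const, Real.volume_Ico, List.map_cons,
      List.sum_cons, ENNReal.ofReal_add, mul_comm, ENNReal.ofReal_mul (sub_nonneg.2 h.2.1),
      ENNReal.ofReal_coe_nnreal]
    · exact mul_nonneg (sub_nonneg.2 h.2.1) (NNReal.coe_nonneg _)
    · refine List.sum_nonneg fun x hx => ?_
      obtain ⟨q, hq, rfl⟩ := List.mem_map.1 hx
      exact mul_nonneg (sub_nonneg.2 (h.2.2.bounds hq).2.1) (NNReal.coe_nonneg _)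

/-- The schedule given by a list of pieces. -/
def toSchedule (l : List (Piece n)) : Schedule n where
  speed := eval (fun _ s => s) 0 l
  job := eval (fun j _ => some j) none l
  measurable_speed := measurable_eval _ _ _
  measurable_job j := by
    -- The set is a level set of a real-valued step function, so that `measurable_eval` applies.
    have : {t | eval (fun j _ => some j) none l t = some j} =
        (eval (fun i _ => if i = j then (1 : ℝ) else 0) 0 l) ⁻¹' {1} := by
      ext t
      have := eval_comp (fun (i : Fin n) _ => some i) none
        (fun o => if o = some j then (1 : ℝ) else 0) l t
      simp only [Option.some.injEq, reduceCtorEq, if_false] at this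
      rw [Set.mem_preimage, ← this, Set.mem_singleton_iff, Set.mem_ofPred_eq]
      split_ifs with h <;> simp [h]
    rw [this]
    exact measurable_eval _ _ _ (measurableSet_singleton _)

lemma Chain.energy_toSchedule {l : List (Piece n)} {a b α : ℝ} (h : Chain a l b) (hα : 0 < α) :
    (toSchedule l).energy α = ENNReal.ofReal (energy α l) := by
  have h1 := h.lintegral_eval fun _ s => s ^ α
  rw [Schedule.energy, energy]
  simp only [NNReal.coe_rpow] at h1
  rw [← h1]
  refine lintegral_congr fun t => ?_
  have := eval_comp (fun (_ : Fin n) s => s) 0 (fun s : ℝ≥0 => (s : ℝ≥0∞) ^ α) l t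
  simp only [ENNReal.coe_zero, ENNReal.zero_rpow_of_pos hα] at this
  refine this.trans ?_
  simp only [ENNReal.coe_rpow_of_nonneg _ hα.le]

lemma Chain.work_toSchedule {l : List (Piece n)} {a b : ℝ} (h : Chain a l b) (j : Fin n)
    {A : Set ℝ} (hA : ∀ p ∈ l, p.job = j → Set.Ico p.start p.finish ⊆ A) :
    (toSchedule l).work j A = ENNReal.ofReal (work j l) := by
  have hset : {t | (toSchedule l).job t = some j} ∩ A = {t | (toSchedule l).job t = some j} := by
    refine Set.inter_eq_left.2 fun t ht => ?_
    by_contra hne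
    have hex : ∃ p ∈ l, t ∈ Set.Ico p.start p.finish := by
      by_contra! hno
      have : (toSchedule l).job t = none := eval_of_notMem _ _ hno
      rw [Set.mem_ofPred_eq, this] at ht
      exact absurd ht (by simp)
    obtain ⟨p, hp, hpt⟩ := hex
    have hj : (toSchedule l).job t = some p.job := h.eval_of_mem _ _ hp hpt
    rw [Set.mem_ofPred_eq, hj] at ht
    exact hne (hA p hp (Option.some_injective _ ht) hpt)
  have h1 := h.lintegral_eval fun i s => if i = j then s else 0
  rw [Schedule.work, hset, ← lintegral_indicator ((toSchedule l).measurable_job j), work]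
  have h2 : ∀ p : Piece n, (p.finish - p.start) * (((if p.job = j then p.speed else 0 : ℝ≥0)) : ℝ) =
      if p.job = j then (p.finish - p.start) * (p.speed : ℝ) else 0 := by
    intro p
    split_ifs <;> simp
  simp only [h2] at h1
  rw [← h1]
  refine lintegral_congr fun t => ?_
  by_cases hex : ∃ p ∈ l, t ∈ Set.Ico p.start p.finish
  · obtain ⟨p, hp, hpt⟩ := hex
    have hj : (toSchedule l).job t = some p.job := h.eval_of_mem _ _ hp hpt
    have hs : (toSchedule l).speed t = p.speed := h.eval_of_mem _ _ hp hpt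
    rw [h.eval_of_mem _ _ hp hpt]
    have hm : t ∈ {t | (toSchedule l).job t = some j} ↔ p.job = j := by
      rw [Set.mem_ofPred_eq, hj, Option.some.injEq]
    by_cases hpj : p.job = j
    · rw [Set.indicator_of_mem (hm.2 hpj), hs, if_pos hpj]
    · rw [Set.indicator_of_notMem (hm.not.2 hpj), if_neg hpj, ENNReal.coe_zero]
  · push Not at hex
    have hj : (toSchedule l).job t = none := eval_of_notMem _ _ hex
    rw [eval_of_notMem _ _ hex, Set.indicator_of_notMem]
    exact fun h' => absurd (hj.symm.trans h') (by simp)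

end Piece

/-! ### Plans and host plans: lists of pieces that complete a given set of jobs. -/

open Piece

/-- The pieces complete the jobs of `U`, which are among the first `k` jobs and released in
`[s, t)`, within `[s, t)`. -/
structure Plan (I : Instance n) (k : ℕ) (U : Finset (Fin n)) (s t : ℝ) (l : List (Piece n)) :
    Prop where
  chain : Chain s l t
  pieces : ∀ p ∈ l, p.job ∈ U ∧ (I.r p.job : ℝ) ≤ p.start ∧ p.finish ≤ I.d p.job
  work : ∀ j ∈ U, work j l = I.p j
  jobs : ∀ j ∈ U, (j : ℕ) < k ∧ s ≤ I.r j ∧ (I.r j : ℝ) < t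

/-- The pieces complete the jobs of `U` within `[z, y)` in groups of total duration `A`; in the
remaining time job `k` is processed at speed `v`. -/
structure HostPlan (I : Instance n) (k : Fin n) (U : Finset (Fin n)) (z y A : ℝ) (v : ℝ≥0)
    (l : List (Piece n)) : Prop where
  chain : Chain z l y
  pieces : ∀ p ∈ l, p.job = k ∨ p.job ∈ U ∧ (I.r p.job : ℝ) ≤ p.start ∧ p.finish ≤ I.d p.job
  work : ∀ j ∈ U, work j l = I.p j
  host : Piece.work k l = (y - z - A) * v
  jobs : ∀ j ∈ U, (j : ℕ) < k ∧ z ≤ I.r j ∧ (I.r j : ℝ) < y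

variable {I : Instance n}

lemma Plan.nil (k : ℕ) {s t : ℝ} (h : s ≤ t) : Plan I k ∅ s t [] :=
  ⟨h, by simp, by simp, by simp⟩

lemma Plan.mono {k k' : ℕ} {U : Finset (Fin n)} {s t : ℝ} {l : List (Piece n)}
    (h : Plan I k U s t l) (hk : k ≤ k') : Plan I k' U s t l :=
  ⟨h.chain, h.pieces, h.work, fun j hj => ⟨(h.jobs j hj).1.trans_le hk, (h.jobs j hj).2⟩⟩

lemma HostPlan.single (k : Fin n) {z y : ℝ} (h : z ≤ y) (v : ℝ≥0) :
    HostPlan I k ∅ z y 0 v [⟨k, z, y, v⟩] :=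
  ⟨⟨le_rfl, h, le_rfl⟩, by simp, by simp, by simp, by simp⟩

/-- Release dates separate the two sets: they lie before `y'` in the first and from `y'` on in the
second. -/
lemma Plan.disjoint_hostPlan {k : Fin n} {U₁ U₂ : Finset (Fin n)} {r y' y A : ℝ} {v : ℝ≥0}
    {l₁ l₂ : List (Piece n)} (h₁ : Plan I k U₁ r y' l₁) (h₂ : HostPlan I k U₂ y' y A v l₂) :
    Disjoint U₁ U₂ :=
  Finset.disjoint_left.2 fun j hj hj' =>
    absurd ((h₁.jobs j hj).2.2.trans_le (h₂.jobs j hj').2.1) (lt_irrefl _)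

/-- The host runs until the release date `r`, the group occupies `[r, y')`, and a further host plan
covers the rest; the group durations add up. No job is counted twice because all interrupting jobs
have index below `k` and the groups differ in their release dates. -/
lemma HostPlan.cons {k : Fin n} {U₁ U₂ : Finset (Fin n)} {z r y' y A : ℝ} {v : ℝ≥0}
    {l₁ l₂ : List (Piece n)} (hz : z ≤ r) (h₁ : Plan I k U₁ r y' l₁)
    (h₂ : HostPlan I k U₂ y' y A v l₂) :
    HostPlan I k (U₁ ∪ U₂) z y ((y' - r) + A) v (⟨k, z, r, v⟩ :: (l₁ ++ l₂)) := by
  have hd := h₁.disjoint_hostPlan h₂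
  refine ⟨⟨le_rfl, hz, h₁.chain.append h₂.chain⟩, ?_, ?_, ?_, ?_⟩
  · intro p hp
    simp only [List.mem_cons, List.mem_append] at hp
    rcases hp with rfl | hp | hp
    · exact Or.inl rfl
    · exact Or.inr ⟨Finset.mem_union_left _ (h₁.pieces p hp).1, (h₁.pieces p hp).2⟩
    · refine (h₂.pieces p hp).imp_right fun h => ⟨Finset.mem_union_right _ h.1, h.2⟩
  · intro j hj
    rw [work_cons, work_append]
    rcases Finset.mem_union.1 hj with hj | hj
    · have hjk := (h₁.jobs j hj).1
      rw [if_neg (by rintro rfl; exact lt_irrefl _ hjk), h₁.work j hj, work_eq_zero, zero_add,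
        add_zero]
      intro p hp hpj
      rcases h₂.pieces p hp with h | h
      · rw [← hpj, h] at hjk
        exact lt_irrefl _ hjk
      · exact Finset.disjoint_left.1 hd hj (hpj ▸ h.1)
    · have hjk := (h₂.jobs j hj).1
      rw [if_neg (by rintro rfl; exact lt_irrefl _ hjk), h₂.work j hj, work_eq_zero, zero_add,
        zero_add]
      intro p hp hpj
      exact Finset.disjoint_left.1 hd (hpj ▸ (h₁.pieces p hp).1) hj
  · rw [work_cons, work_append, if_pos rfl, h₂.host, work_eq_zero]
    · ring
    · intro p hp hpk
      have := (h₁.jobs _ (h₁.pieces p hp).1).1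
      rw [hpk] at this
      exact lt_irrefl _ this
  · intro j hj
    have hy := h₂.chain.le
    have hr := h₁.chain.le
    rcases Finset.mem_union.1 hj with hj | hj
    · obtain ⟨h3, h4, h5⟩ := h₁.jobs j hj
      exact ⟨h3, by linarith, by linarith⟩
    · obtain ⟨h3, h4, h5⟩ := h₂.jobs j hj
      exact ⟨h3, by linarith, by linarith⟩

/-- The union step of the recursion for `G`. The three sets of smaller jobs are released in
consecutive windows, hence are disjoint, and `hv` makes the host time just sufficient for job `k`.
-/
lemma Plan.combine {k : Fin n} {U₁ U₂ U₃ : Finset (Fin n)} {s x y t A : ℝ} {v : ℝ≥0}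
    {l₁ l₂ l₃ : List (Piece n)} (h₁ : Plan I k U₁ s x l₁) (h₂ : HostPlan I k U₂ x y A v l₂)
    (h₃ : Plan I k U₃ y t l₃) (hs : s ≤ I.r k) (hr : (I.r k : ℝ) ≤ x) (hy : y ≤ I.d k)
    (hv : (y - x - A) * v = I.p k) :
    Plan I (k + 1) (insert k (U₁ ∪ U₂ ∪ U₃)) s t (l₁ ++ (l₂ ++ l₃)) ∧
      (insert k (U₁ ∪ U₂ ∪ U₃)).card = U₁.card + U₂.card + U₃.card + 1 := by
  have hsx := h₁.chain.le
  have hxy := h₂.chain.le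
  have hyt := h₃.chain.le
  have hd12 := h₁.disjoint_hostPlan h₂
  have hd13 : Disjoint U₁ U₃ := Finset.disjoint_left.2 fun j hj hj' => by
    have := (h₁.jobs j hj).2.2
    have := (h₃.jobs j hj').2.1
    linarith
  have hd23 : Disjoint U₂ U₃ := Finset.disjoint_left.2 fun j hj hj' => by
    have := (h₂.jobs j hj).2.2
    have := (h₃.jobs j hj').2.1
    linarith
  have hk1 : k ∉ U₁ := fun h => lt_irrefl _ (h₁.jobs k h).1
  have hk2 : k ∉ U₂ := fun h => lt_irrefl _ (h₂.jobs k h).1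
  have hk3 : k ∉ U₃ := fun h => lt_irrefl _ (h₃.jobs k h).1
  have hw1 : ∀ j, j ∉ U₁ → Piece.work j l₁ = 0 := fun j hj =>
    work_eq_zero fun p hp hpj => hj (hpj ▸ (h₁.pieces p hp).1)
  have hw3 : ∀ j, j ∉ U₃ → Piece.work j l₃ = 0 := fun j hj =>
    work_eq_zero fun p hp hpj => hj (hpj ▸ (h₃.pieces p hp).1)
  have hw2 : ∀ j, j ≠ k → j ∉ U₂ → Piece.work j l₂ = 0 := fun j hjk hj =>
    work_eq_zero fun p hp hpj => (h₂.pieces p hp).elim (fun h => hjk (hpj ▸ h))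
      fun h => hj (hpj ▸ h.1)
  have hp3 : (0 : ℝ) < I.p k := by exact_mod_cast I.work_pos k
  -- Strictness gives the release date of `k` strictly before `t`. If `x = y`, all pieces of the
  -- host plan have length zero and leave no time for the positive work of `k`.
  have hlt : x < y := by
    rcases hxy.eq_or_lt with h | h
    · exfalso
      have h0 : Piece.work k l₂ ≤ 0 := by
        refine le_of_eq ?_
        rw [Piece.work]
        refine List.sum_eq_zero fun c hc => ?_
        obtain ⟨p, hp, rfl⟩ := List.mem_map.1 hc
        obtain ⟨h4, h5, h6⟩ := h₂.chain.bounds hp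
        have : p.finish - p.start = 0 := by linarith
        simp [this]
      rw [h₂.host, hv] at h0
      linarith
    · exact h
  refine ⟨⟨h₁.chain.append (h₂.chain.append h₃.chain), ?_, ?_, ?_⟩, ?_⟩
  · intro p hp
    simp only [List.mem_append] at hp
    simp only [Finset.mem_insert, Finset.mem_union]
    rcases hp with hp | hp | hp
    · have := h₁.pieces p hp
      tauto
    · obtain ⟨h4, h5, h6⟩ := h₂.chain.bounds hp
      rcases h₂.pieces p hp with h | h
      · rw [h]
        exact ⟨Or.inl rfl, by linarith, by linarith⟩
      · tauto
    · have := h₃.pieces p hp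
      tauto
  · intro j hj
    simp only [work_append]
    rcases Finset.mem_insert.1 hj with rfl | hj
    · rw [hw1 _ hk1, hw3 _ hk3, h₂.host, hv]
      ring
    · simp only [Finset.mem_union] at hj
      rcases hj with (hj | hj) | hj
      · rw [h₁.work j hj, hw2 j (fun h => hk1 (h ▸ hj)) (Finset.disjoint_left.1 hd12 hj),
          hw3 j (Finset.disjoint_left.1 hd13 hj)]
        ring
      · rw [h₂.work j hj, hw1 j (Finset.disjoint_right.1 hd12 hj),
          hw3 j (Finset.disjoint_left.1 hd23 hj)]
        ring
      · rw [h₃.work j hj, hw1 j (Finset.disjoint_right.1 hd13 hj),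
          hw2 j (fun h => hk3 (h ▸ hj)) (Finset.disjoint_right.1 hd23 hj)]
        ring
  · intro j hj
    rcases Finset.mem_insert.1 hj with rfl | hj
    · exact ⟨Nat.lt_succ_self _, hs, by linarith⟩
    · simp only [Finset.mem_union] at hj
      rcases hj with (hj | hj) | hj
      · obtain ⟨h4, h5, h6⟩ := h₁.jobs j hj
        exact ⟨h4.trans (Nat.lt_succ_self _), h5, by linarith⟩
      · obtain ⟨h4, h5, h6⟩ := h₂.jobs j hj
        exact ⟨h4.trans (Nat.lt_succ_self _), by linarith, by linarith⟩
      · obtain ⟨h4, h5, h6⟩ := h₃.jobs j hj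
        exact ⟨h4.trans (Nat.lt_succ_self _), by linarith, h6⟩
  · rw [Finset.card_insert_of_notMem (by simp [hk1, hk2, hk3]),
      Finset.card_union_of_disjoint (by rw [Finset.disjoint_union_left]; exact ⟨hd13, hd23⟩),
      Finset.card_union_of_disjoint hd12]

/-- The schedule of a plan completes exactly the planned jobs. -/
lemma Plan.onTime_iff {k : ℕ} {U : Finset (Fin n)} {s t : ℝ} {l : List (Piece n)}
    (h : Plan I k U s t l) (j : Fin n) : I.OnTime (toSchedule l) j ↔ j ∈ U := by
  rw [Instance.OnTime, h.chain.work_toSchedule]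
  · constructor
    · intro hj
      by_contra hne
      rw [work_eq_zero (j := j) fun p hp hpj => hne (hpj ▸ (h.pieces p hp).1)] at hj
      have := I.work_pos j
      rw [ENNReal.ofReal_zero] at hj
      exact this.ne (by exact_mod_cast hj)
    · intro hj
      rw [h.work j hj, ENNReal.ofReal_natCast]
  · rintro p hp rfl
    exact Set.Ico_subset_Ico (h.pieces p hp).2.1 (h.pieces p hp).2.2

lemma Plan.throughput {k : ℕ} {U : Finset (Fin n)} {s t : ℝ} {l : List (Piece n)}
    (h : Plan I k U s t l) : I.throughput (toSchedule l) = U.card := by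
  rw [Instance.throughput]
  simp only [h.onTime_iff]
  exact Set.ncard_coe_finset U

lemma Plan.feasible {k : ℕ} {U : Finset (Fin n)} {s t α E : ℝ} {l : List (Piece n)}
    (h : Plan I k U s t l) (hα : 0 < α) (hE : energy α l ≤ E) :
    I.Feasible α E (toSchedule l) := by
  refine ⟨fun t' j hj => ?_, fun j => ?_, ?_⟩
  · have hex : ∃ p ∈ l, t' ∈ Set.Ico p.start p.finish := by
      by_contra! hno
      have : (toSchedule l).job t' = none := eval_of_notMem _ _ hno
      rw [this] at hj
      exact absurd hj (by simp)
    obtain ⟨p, hp, hpt⟩ := hex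
    have hpj : (toSchedule l).job t' = some p.job := h.chain.eval_of_mem _ _ hp hpt
    rw [hpj] at hj
    rw [← Option.some_injective _ hj]
    exact (h.pieces p hp).2.1.trans hpt.1
  · rw [h.chain.work_toSchedule j fun _ _ _ => Set.subset_univ _]
    by_cases hj : j ∈ U
    · rw [h.work j hj, ENNReal.ofReal_natCast]
    · rw [work_eq_zero (j := j) fun p hp hpj => hj (hpj ▸ (h.pieces p hp).1)]
      simp
  · rw [h.chain.energy_toSchedule hα]
    exact ENNReal.ofReal_le_ofReal hE

end SpeedScaling

end

noncomputable section

namespace SpeedScaling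

/-! ## The dynamic program is an upper bound for plans -/

open Piece

variable {n : ℕ} (I : Instance n) (α : ℝ)

/-- The least energy of a plan for `u` of the first `k` jobs in `[s, t)`. -/
def optPlan (k : ℕ) (s t : ℝ) (u : ℕ) : ℝ≥0∞ :=
  ⨅ (U : Finset (Fin n)) (l : List (Piece n)) (_ : Plan I k U s t l) (_ : U.card = u),
    ENNReal.ofReal (energy α l)

/-- The least energy spent on `u` jobs that interrupt job `k` in `[z, y)`, for a total
duration of at most `A`. -/
def optHost (k : Fin n) (z y A : ℝ) (u : ℕ) : ℝ≥0∞ :=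
  ⨅ (U : Finset (Fin n)) (A' : ℝ) (e : ℝ) (_ : U.card = u) (_ : A' ≤ A) (_ : 0 ≤ e)
    (_ : ∀ v, ∃ l, HostPlan I k U z y A' v l ∧ energy α l = e + (y - z - A') * (v : ℝ) ^ α),
    ENNReal.ofReal e

variable {I α}

lemma optPlan_le {k u : ℕ} {s t : ℝ} {U : Finset (Fin n)} {l : List (Piece n)}
    (h : Plan I k U s t l) (hu : U.card = u) : optPlan I α k s t u ≤ ENNReal.ofReal (energy α l) :=
  iInf_le_of_le U <| iInf_le_of_le l <| iInf_le_of_le h <| iInf_le_of_le hu le_rfl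

lemma optHost_le {k : Fin n} {z y A A' e : ℝ} {U : Finset (Fin n)} {u : ℕ} (hu : U.card = u)
    (hA : A' ≤ A) (he : 0 ≤ e) (h : ∀ v, ∃ l, HostPlan I k U z y A' v l ∧
      energy α l = e + (y - z - A') * (v : ℝ) ^ α) :
    optHost I α k z y A u ≤ ENNReal.ofReal e :=
  iInf_le_of_le U <| iInf_le_of_le A' <| iInf_le_of_le e <| iInf_le_of_le hu <|
    iInf_le_of_le hA <| iInf_le_of_le he <| iInf_le_of_le h le_rfl

/-- Opens one infimum inside a sum while the other summands are kept in `Y`, so that plans can be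
chosen one after another. -/
lemma le_optPlan_add {k u : ℕ} {s t : ℝ} {X Y : ℝ≥0∞}
    (h : ∀ U l, Plan I k U s t l → U.card = u → X ≤ ENNReal.ofReal (energy α l) + Y) :
    X ≤ optPlan I α k s t u + Y := by
  simp only [optPlan, ENNReal.iInf_add]
  exact le_iInf fun U => le_iInf fun l => le_iInf fun h1 => le_iInf fun h2 => h U l h1 h2

lemma le_optHost_add {k : Fin n} {z y A : ℝ} {u : ℕ} {X Y : ℝ≥0∞}
    (h : ∀ (U : Finset (Fin n)) (A' e : ℝ), U.card = u → A' ≤ A → 0 ≤ e →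
      (∀ v, ∃ l, HostPlan I k U z y A' v l ∧ energy α l = e + (y - z - A') * (v : ℝ) ^ α) →
      X ≤ ENNReal.ofReal e + Y) :
    X ≤ optHost I α k z y A u + Y := by
  simp only [optHost, ENNReal.iInf_add]
  exact le_iInf fun U => le_iInf fun A' => le_iInf fun e => le_iInf fun h1 => le_iInf fun h2 =>
    le_iInf fun h3 => le_iInf fun h4 => h U A' e h1 h2 h3 h4

/-- Induction on `u`: every alternative of the recursion is realised by `HostPlan.cons`. The
recursion may stop with unused `a` and `h`, so the groups last at most the prescribed time, not
exactly. For this reason the host speed stays universally quantified until the remaining time is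
known. -/
theorem optHost_le_FRec {g : ℚ → ℚ → ℕ → ℝ≥0∞} (k : Fin n)
    (hg : ∀ (s t : ℚ) b, s ≤ t → optPlan I α k s t b ≤ g s t b) (l i : ℕ) (u : ℕ) :
    ∀ (x y : ℚ) (a h : ℕ), x ≤ y →
      optHost I α k x y (a + h * (l / i : ℝ)) u ≤ I.FRec g k x y u l i a h := by
  induction u using Nat.strong_induction_on with
  | _ u ih =>
    intro x y a h hxy
    have hxy' : (x : ℝ) ≤ y := by exact_mod_cast hxy
    rw [Instance.FRec]
    split_ifs with hu ha
    · subst hu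
      refine (optHost_le (U := ∅) (A' := 0) (e := 0) rfl (by positivity) le_rfl
        fun v => ⟨_, HostPlan.single k hxy' v, ?_⟩).trans (by simp)
      simp
    · exact le_top
    · refine le_iInf fun j => le_iInf fun a' => le_iInf fun h' => le_iInf fun y' =>
        le_iInf fun hjk => le_iInf fun ⟨hxr, hry⟩ => le_iInf fun ⟨ha', hh'⟩ =>
        le_iInf fun ⟨hy', hyy⟩ => le_iInf fun b => le_iInf fun ⟨hb1, hbu⟩ => ?_
      have hry' : (I.r j : ℚ) ≤ y' := by
        rw [hy', add_assoc]
        exact le_add_of_nonneg_right (by positivity)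
      refine le_trans ?_ (add_le_add (hg _ _ b hry')
        (ih (u - b) (by omega) y' y (a - a') (h - h') hyy))
      refine le_optPlan_add fun U₁ l₁ h₁ hc₁ => ?_
      rw [add_comm (ENNReal.ofReal _)]
      refine le_optHost_add fun U₂ A' e hc₂ hA' he hpl => ?_
      have he1 := h₁.chain.energy_nonneg α
      -- A host plan of any speed shows that the two sets of jobs are disjoint; speed `0` serves.
      obtain ⟨l₀, h₀, -⟩ := hpl 0
      have hd := h₁.disjoint_hostPlan h₀
      rw [← ENNReal.ofReal_add he he1]
      refine optHost_le (U := U₁ ∪ U₂) (A' := ((y' : ℝ) - I.r j) + A') ?_ ?_ (by positivity) ?_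
      · rw [Finset.card_union_of_disjoint hd]
        omega
      · have h3 : (y' : ℝ) = I.r j + a' + h' * (l / i : ℝ) := by
          rw [hy']
          push_cast
          rfl
        rw [Nat.cast_sub ha', Nat.cast_sub hh'] at hA'
        rw [h3]
        linarith
      · intro v
        obtain ⟨l₂, h₂, he₂⟩ := hpl v
        have hxr' : (x : ℝ) ≤ ((I.r j : ℚ) : ℝ) := by exact_mod_cast hxr
        refine ⟨_, by simpa using HostPlan.cons hxr' h₁ h₂, ?_⟩
        rw [energy_cons, energy_append, he₂]
        push_cast
        ring

/-- Each alternative for `G` is realised or undercut by a plan. Interruption time that the groups do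
not use goes to the host, which then runs no faster than `i / l` and spends at most the charged `(i
/ l) ^ (α - 1) * p`. -/
theorem optPlan_le_G (hα : 1 < α) (k : ℕ) : ∀ (s t : ℚ) (u : ℕ), s ≤ t →
    optPlan I α k s t u ≤ I.G α k s t u := by
  induction k with
  | zero =>
    intro s t u hst
    rw [Instance.G]
    split_ifs with hu
    · have hst' : (s : ℝ) ≤ t := by exact_mod_cast hst
      exact (optPlan_le (Plan.nil 0 hst') (by simp [hu])).trans (by simp)
    · exact le_top
  | succ k ih =>
    intro s t u hst
    rw [Instance.G]
    refine le_min ?_ ?_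
    · refine le_trans ?_ (ih s t u hst)
      rw [← add_zero (optPlan I α k s t u)]
      refine le_optPlan_add fun U l h hu => ?_
      rw [add_zero]
      exact optPlan_le (h.mono (Nat.le_succ k)) hu
    · refine le_iInf fun j => le_iInf fun hj => le_iInf fun x => le_iInf fun _ =>
        le_iInf fun y => le_iInf fun _ => le_iInf fun u₁ => le_iInf fun u₂ => le_iInf fun hu =>
        le_iInf fun a => le_iInf fun l => le_iInf fun i => le_iInf fun h =>
        le_iInf fun ⟨_, ⟨hl, _⟩, ⟨hi, _⟩, _⟩ => le_iInf fun heq =>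
        le_iInf fun ⟨⟨hs, hr⟩, hxy, hyd, hyt⟩ => ?_
      subst hj
      have hF := optHost_le_FRec j ih l i u₂ x y a h hxy
      refine le_trans ?_ (add_le_add (add_le_add (add_le_add (ih s x u₁ (hs.trans hr)) hF)
        le_rfl) (ih y t (u - u₁ - u₂ - 1) hyt))
      set c := ENNReal.ofReal ((i / l : ℝ) ^ (α - 1) * I.p j) with hc
      rw [add_assoc, add_assoc]
      refine le_optPlan_add fun U₁ l₁ h₁ hc₁ => ?_
      rw [add_left_comm]
      refine le_optHost_add fun U₂ A e hc₂ hA he hpl => ?_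
      rw [show ∀ a b d : ℝ≥0∞, a + (b + (c + d)) = d + (c + (a + b)) by intros; ring]
      refine le_optPlan_add fun U₃ l₃ h₃ hc₃ => ?_
      have hp : (0 : ℝ) < I.p j := by exact_mod_cast I.work_pos j
      have hl' : (0 : ℝ) < l := by exact_mod_cast hl
      have hi' : (0 : ℝ) < i := by exact_mod_cast hi
      have heq' : (y : ℝ) - x = a + (I.p j + h) * (l / i : ℝ) := by
        have h1 := congrArg (fun q : ℚ => (q : ℝ)) heq
        push_cast at h1
        exact h1
      have hT : (I.p j : ℝ) * (l / i) ≤ (y : ℝ) - x - A := by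
        rw [heq']
        linarith
      have hTpos : 0 < (y : ℝ) - x - A := lt_of_lt_of_le (by positivity) hT
      -- The speed at which the host exactly fills the time that the groups leave over.
      set v : ℝ≥0 := ⟨I.p j / ((y : ℝ) - x - A), by positivity⟩ with hv
      have hv' : (v : ℝ) = I.p j / ((y : ℝ) - x - A) := rfl
      obtain ⟨l₂, h₂, he₂⟩ := hpl v
      obtain ⟨hP, hcard⟩ := Plan.combine h₁ h₂ h₃ (by exact_mod_cast hs) (by exact_mod_cast hr)
        (by exact_mod_cast hyd) (by rw [hv']; field_simp)
      have hvle : (v : ℝ) ≤ i / l := by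
        rw [hv', div_le_div_iff₀ hTpos hl']
        calc (I.p j : ℝ) * l = i * (I.p j * (l / i)) := by field_simp
          _ ≤ i * ((y : ℝ) - x - A) := by gcongr
      have hvpos : (0 : ℝ) < v := by
        rw [hv']
        positivity
      have hpow : ((y : ℝ) - x - A) * (v : ℝ) ^ α ≤ (i / l : ℝ) ^ (α - 1) * I.p j := by
        have h1 : (v : ℝ) ^ α = v ^ (α - 1) * v := by
          rw [← Real.rpow_add_one hvpos.ne', sub_add_cancel]
        have h2 : ((y : ℝ) - x - A) * v = I.p j := by
          rw [hv']
          field_simp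
        rw [h1, mul_left_comm, h2]
        gcongr
      refine (optPlan_le hP (by omega)).trans ?_
      rw [hc, ← ENNReal.ofReal_add he (h₁.chain.energy_nonneg α),
        ← ENNReal.ofReal_add (by positivity)
          (add_nonneg he (h₁.chain.energy_nonneg α)),
        ← ENNReal.ofReal_add (h₃.chain.energy_nonneg α)
          (add_nonneg (by positivity) (add_nonneg he (h₁.chain.energy_nonneg α)))]
      refine ENNReal.ofReal_le_ofReal ?_
      rw [energy_append, energy_append, he₂]
      linarith

end SpeedScaling

end

noncomputable section

namespace SpeedScaling

/-! ## The cells and moves of the table -/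

/-- The digit at position `m` of `x` in the mixed radix system with the given bases, least
significant digit first. -/
def digit : List ℕ → ℕ → ℕ → ℕ
  | [], _, x => x
  | b :: _, 0, x => x % b
  | b :: bs, m + 1, x => digit bs m (x / b)

/-- The number with the given digits. -/
def encode : List ℕ → List ℕ → ℕ
  | b :: bs, x :: xs => x + b * encode bs xs
  | _, _ => 0

lemma digit_lt {bs : List ℕ} (hb : ∀ b ∈ bs, 0 < b) {m : ℕ} (hm : m < bs.length) (x : ℕ) :
    digit bs m x < bs[m] := by
  induction bs generalizing m x with
  | nil => simp at hm
  | cons b bs ih =>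
    cases m with
    | zero => exact Nat.mod_lt _ (hb b (by simp))
    | succ m => exact ih (fun b hb' => hb b (by simp [hb'])) (by simpa using hm) _

lemma digit_encode {bs xs : List ℕ} (h : List.Forall₂ (fun x b => x < b) xs bs) {m : ℕ}
    (hm : m < xs.length) : digit bs m (encode bs xs) = xs[m] := by
  induction h generalizing m with
  | nil => simp at hm
  | @cons x b xs bs hx _ ih =>
    cases m with
    | zero => simp [digit, encode, Nat.mod_eq_of_lt hx]
    | succ m =>
      have : (x + b * encode bs xs) / b = encode bs xs := by
        rw [Nat.add_mul_div_left _ _ (by omega), Nat.div_eq_of_lt hx, zero_add]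
      simp only [digit, encode, this]
      exact ih (by simpa using hm)

lemma encode_lt {bs xs : List ℕ} (h : List.Forall₂ (fun x b => x < b) xs bs) :
    encode bs xs < bs.prod := by
  induction h with
  | nil => simp [encode]
  | @cons x b xs bs hx _ ih =>
    rw [encode, List.prod_cons]
    calc x + b * encode bs xs < b + b * encode bs xs := by omega
      _ = b * (encode bs xs + 1) := by ring
      _ ≤ b * bs.prod := Nat.mul_le_mul_left b ih

lemma encode_append {bs xs : List ℕ} (h : bs.length = xs.length) (bs' xs' : List ℕ) :
    encode (bs ++ bs') (xs ++ xs') = encode bs xs + bs.prod * encode bs' xs' := by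
  induction bs generalizing xs with
  | nil =>
    cases xs with
    | nil => simp [encode]
    | cons => simp at h
  | cons b bs ih =>
    cases xs with
    | nil => simp at h
    | cons x xs =>
      simp only [List.cons_append, encode, List.prod_cons]
      rw [ih (by simpa using h)]
      ring

lemma encode_digit {bs : List ℕ} {x : ℕ} (hx : x < bs.prod) :
    encode bs ((List.range bs.length).map fun m => digit bs m x) = x := by
  induction bs generalizing x with
  | nil =>
    have : x = 0 := by simpa using hx
    simp [encode, this]
  | cons b bs ih =>
    rw [List.length_cons, List.range_succ_eq_map, List.map_cons, encode, List.map_map]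
    rw [List.prod_cons] at hx
    have := ih (x := x / b) (Nat.div_lt_of_lt_mul hx)
    have h2 : ((fun m => digit (b :: bs) m x) ∘ Nat.succ) = fun m => digit bs m (x / b) := rfl
    rw [h2, this]
    exact Nat.mod_add_div x b

/-- An entry of the table. With `mode = 0` it stands for `u` of the first `k` jobs in the window
from `s` to `q + h l / i`; with `mode = 1` it stands for `u` jobs that interrupt job `k`, running
at speed `i / l`, between `s + g l / i` and `q + h l / i`, for a duration of `a + b l / i`. -/
structure Cell where
  q : ℕ
  h : ℕ
  l : ℕ
  i : ℕ
  s : ℕ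
  g : ℕ
  a : ℕ
  b : ℕ
  u : ℕ
  mode : ℕ
  k : ℕ

/-- The parameters of one alternative in the recursion: job `k` runs from `qx + hx l / i` to
`qy + hy l / i`. -/
structure Choice where
  qy : ℕ
  hy : ℕ
  l : ℕ
  i : ℕ
  qx : ℕ
  hx : ℕ
  a : ℕ
  h : ℕ
  u₁ : ℕ
  u₂ : ℕ

/-- The bases of the digits of a cell. -/
def cellBases (n L P : ℕ) : List ℕ :=
  [L + 1, P + 1, L + 1, P + 1, L + 1, P + 1, L + 1, P + 1, n + 1, 2, n + 1]

/-- The bases of the digits of a choice. -/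
def choiceBases (n L P : ℕ) : List ℕ :=
  [L + 1, P + 1, L + 1, P + 1, L + 1, P + 1, L + 1, P + 1, n + 1, n + 1]

variable {n : ℕ} (I : Instance n)

namespace Cell

/-- The cell of the empty plan. -/
def zero : Cell := ⟨0, 0, 0, 0, 0, 0, 0, 0, 0, 0, 0⟩

/-- All entries are in range. -/
def Valid (X : Cell) : Prop :=
  (X.q ≤ I.L ∧ X.h ≤ I.P ∧ X.l ≤ I.L ∧ X.i ≤ I.P) ∧
  (X.s ≤ I.L ∧ X.g ≤ I.P ∧ X.a ≤ I.L ∧ X.b ≤ I.P) ∧ X.u ≤ n ∧ X.mode ≤ 1 ∧ X.k ≤ n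

/-- The index of a cell in the table. -/
def code (X : Cell) : ℕ :=
  encode (cellBases n I.L I.P) [X.q, X.h, X.l, X.i, X.s, X.g, X.a, X.b, X.u, X.mode, X.k]

/-- The cell of a given index. -/
def decode (x : ℕ) : Cell :=
  let D := fun m => digit (cellBases n I.L I.P) m x
  ⟨D 0, D 1, D 2, D 3, D 4, D 5, D 6, D 7, D 8, D 9, D 10⟩

/-- The position of a cell in the order of evaluation. -/
def rank (n : ℕ) (X : Cell) : ℕ := X.u + (n + 1) * (X.mode + 2 * X.k)

end Cell

namespace Choice

/-- All entries are in range. -/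
def Valid (Y : Choice) : Prop :=
  (Y.qy ≤ I.L ∧ Y.hy ≤ I.P ∧ Y.l ≤ I.L ∧ Y.i ≤ I.P) ∧
  (Y.qx ≤ I.L ∧ Y.hx ≤ I.P ∧ Y.a ≤ I.L ∧ Y.h ≤ I.P) ∧ Y.u₁ ≤ n ∧ Y.u₂ ≤ n

/-- The index of a choice. -/
def code (Y : Choice) : ℕ :=
  encode (choiceBases n I.L I.P) [Y.qy, Y.hy, Y.l, Y.i, Y.qx, Y.hx, Y.a, Y.h, Y.u₁, Y.u₂]

/-- The choice of a given index. -/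
def decode (x : ℕ) : Choice :=
  let D := fun m => digit (choiceBases n I.L I.P) m x
  ⟨D 0, D 1, D 2, D 3, D 4, D 5, D 6, D 7, D 8, D 9⟩

end Choice

/-- The number of cells. -/
def cellCount (n L P : ℕ) : ℕ := (cellBases n L P).prod

/-- The number of choices. -/
def choiceCount (n L P : ℕ) : ℕ := (choiceBases n L P).prod

variable {I}

lemma Cell.Valid.forall₂ {X : Cell} (h : X.Valid I) : List.Forall₂ (fun x b => x < b)
    [X.q, X.h, X.l, X.i, X.s, X.g, X.a, X.b, X.u, X.mode, X.k] (cellBases n I.L I.P) := by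
  obtain ⟨⟨h1, h2, h3, h4⟩, ⟨h5, h6, h7, h8⟩, h9, h10, h11⟩ := h
  simp only [cellBases, List.forall₂_cons, List.forall₂_nil_left_iff, and_true]
  omega

lemma Cell.Valid.decode_code {X : Cell} (h : X.Valid I) : Cell.decode I (X.code I) = X := by
  have h2 := h.forall₂
  have key := fun m hm => digit_encode (m := m) h2 hm
  have e0 := key 0 (by simp)
  have e1 := key 1 (by simp)
  have e2 := key 2 (by simp)
  have e3 := key 3 (by simp)
  have e4 := key 4 (by simp)
  have e5 := key 5 (by simp)
  have e6 := key 6 (by simp)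
  have e7 := key 7 (by simp)
  have e8 := key 8 (by simp)
  have e9 := key 9 (by simp)
  have e10 := key 10 (by simp)
  simp only [List.getElem_cons_zero, List.getElem_cons_succ] at e0 e1 e2 e3 e4 e5 e6 e7 e8 e9 e10
  simp only [Cell.decode, Cell.code, e0, e1, e2, e3, e4, e5, e6, e7, e8, e9, e10]

lemma Cell.Valid.code_lt {X : Cell} (h : X.Valid I) : X.code I < cellCount n I.L I.P :=
  encode_lt h.forall₂

lemma Cell.decode_valid (x : ℕ) : (Cell.decode I x).Valid I := by
  have hb : ∀ b ∈ cellBases n I.L I.P, 0 < b := by simp [cellBases]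
  have h := fun m hm => digit_lt (m := m) hb hm x
  refine ⟨⟨?_, ?_, ?_, ?_⟩, ⟨?_, ?_, ?_, ?_⟩, ?_, ?_, ?_⟩
  · exact Nat.lt_succ_iff.1 (h 0 (by simp [cellBases]))
  · exact Nat.lt_succ_iff.1 (h 1 (by simp [cellBases]))
  · exact Nat.lt_succ_iff.1 (h 2 (by simp [cellBases]))
  · exact Nat.lt_succ_iff.1 (h 3 (by simp [cellBases]))
  · exact Nat.lt_succ_iff.1 (h 4 (by simp [cellBases]))
  · exact Nat.lt_succ_iff.1 (h 5 (by simp [cellBases]))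
  · exact Nat.lt_succ_iff.1 (h 6 (by simp [cellBases]))
  · exact Nat.lt_succ_iff.1 (h 7 (by simp [cellBases]))
  · exact Nat.lt_succ_iff.1 (h 8 (by simp [cellBases]))
  · exact Nat.lt_succ_iff.1 (h 9 (by simp [cellBases]))
  · exact Nat.lt_succ_iff.1 (h 10 (by simp [cellBases]))

lemma Cell.code_decode {x : ℕ} (hx : x < cellCount n I.L I.P) : (Cell.decode I x).code I = x :=
  encode_digit hx

lemma Cell.code_zero : Cell.zero.code I = 0 := by
  simp [Cell.code, Cell.zero, encode, cellBases]

lemma Cell.zero_valid : Cell.zero.Valid I := by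
  simp [Cell.Valid, Cell.zero]

lemma Cell.Valid.eq_zero {X : Cell} (h : X.Valid I) (h0 : X.code I = 0) : X = Cell.zero := by
  rw [← h.decode_code, h0, ← Cell.code_zero (I := I), Cell.zero_valid.decode_code]

/-- The digits `u`, `mode`, `k` are the most significant ones, and together they form the rank. So
increasing codes is an order of evaluation compatible with the recursion. -/
lemma Cell.Valid.code_lt_code {X Y : Cell} (hX : X.Valid I) (h : X.rank n < Y.rank n) :
    X.code I < Y.code I := by
  have key : ∀ Z : Cell, Z.code I =
      encode ((cellBases n I.L I.P).take 8) [Z.q, Z.h, Z.l, Z.i, Z.s, Z.g, Z.a, Z.b] +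
        ((cellBases n I.L I.P).take 8).prod * Z.rank n := by
    intro Z
    rw [Cell.code, Cell.rank]
    have := encode_append (bs := (cellBases n I.L I.P).take 8)
      (xs := [Z.q, Z.h, Z.l, Z.i, Z.s, Z.g, Z.a, Z.b]) rfl [n + 1, 2, n + 1] [Z.u, Z.mode, Z.k]
    refine this.trans ?_
    simp [encode]
  rw [key X, key Y]
  have h2 := encode_lt (List.forall₂_take 8 hX.forall₂)
  simp only [List.take_succ_cons, List.take_zero] at h2
  refine (Nat.add_lt_add_right h2 _).trans_le (le_trans ?_ (Nat.le_add_left _ _))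
  rw [add_comm, ← Nat.mul_succ]
  exact Nat.mul_le_mul_left _ h

lemma Choice.Valid.forall₂ {Y : Choice} (h : Y.Valid I) : List.Forall₂ (fun x b => x < b)
    [Y.qy, Y.hy, Y.l, Y.i, Y.qx, Y.hx, Y.a, Y.h, Y.u₁, Y.u₂] (choiceBases n I.L I.P) := by
  obtain ⟨⟨h1, h2, h3, h4⟩, ⟨h5, h6, h7, h8⟩, h9, h10⟩ := h
  simp only [choiceBases, List.forall₂_cons, List.forall₂_nil_left_iff, and_true]
  omega

lemma Choice.Valid.decode_code {Y : Choice} (h : Y.Valid I) :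
    Choice.decode I (Y.code I) = Y := by
  have h2 := h.forall₂
  have key := fun m hm => digit_encode (m := m) h2 hm
  have e0 := key 0 (by simp)
  have e1 := key 1 (by simp)
  have e2 := key 2 (by simp)
  have e3 := key 3 (by simp)
  have e4 := key 4 (by simp)
  have e5 := key 5 (by simp)
  have e6 := key 6 (by simp)
  have e7 := key 7 (by simp)
  have e8 := key 8 (by simp)
  have e9 := key 9 (by simp)
  simp only [List.getElem_cons_zero, List.getElem_cons_succ] at e0 e1 e2 e3 e4 e5 e6 e7 e8 e9
  simp only [Choice.decode, Choice.code, e0, e1, e2, e3, e4, e5, e6, e7, e8, e9]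

lemma Choice.Valid.code_lt {Y : Choice} (h : Y.Valid I) : Y.code I < choiceCount n I.L I.P :=
  encode_lt h.forall₂

lemma Choice.decode_valid (x : ℕ) : (Choice.decode I x).Valid I := by
  have hb : ∀ b ∈ choiceBases n I.L I.P, 0 < b := by simp [choiceBases]
  have h := fun m hm => digit_lt (m := m) hb hm x
  refine ⟨⟨?_, ?_, ?_, ?_⟩, ⟨?_, ?_, ?_, ?_⟩, ?_, ?_⟩
  · exact Nat.lt_succ_iff.1 (h 0 (by simp [choiceBases]))
  · exact Nat.lt_succ_iff.1 (h 1 (by simp [choiceBases]))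
  · exact Nat.lt_succ_iff.1 (h 2 (by simp [choiceBases]))
  · exact Nat.lt_succ_iff.1 (h 3 (by simp [choiceBases]))
  · exact Nat.lt_succ_iff.1 (h 4 (by simp [choiceBases]))
  · exact Nat.lt_succ_iff.1 (h 5 (by simp [choiceBases]))
  · exact Nat.lt_succ_iff.1 (h 6 (by simp [choiceBases]))
  · exact Nat.lt_succ_iff.1 (h 7 (by simp [choiceBases]))
  · exact Nat.lt_succ_iff.1 (h 8 (by simp [choiceBases]))
  · exact Nat.lt_succ_iff.1 (h 9 (by simp [choiceBases]))

/-! ### Moves of the recursion and the correctness of a table. -/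

/-- One alternative for a cell: the sum of three smaller cells and a weight. If `emit = 1` a
piece of job `job` precedes the pieces of the three cells. -/
structure Move where
  c₁ : Cell := Cell.zero
  c₂ : Cell := Cell.zero
  c₃ : Cell := Cell.zero
  emit : ℕ := 0
  job : ℕ := 0
  weight : ℝ := 0
  start : ℝ := 0
  finish : ℝ := 0
  speed : ℝ := 0

variable (I)

namespace Instance

/-- The release date of job `j`, and `0` if there is no such job. -/
def rOr (j : ℕ) : ℕ := if h : j < n then I.r ⟨j, h⟩ else 0

/-- The deadline of job `j`, and `0` if there is no such job. -/
def dOr (j : ℕ) : ℕ := if h : j < n then I.d ⟨j, h⟩ else 0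

/-- The work of job `j`, and `0` if there is no such job. -/
def pOr (j : ℕ) : ℕ := if h : j < n then I.p ⟨j, h⟩ else 0

@[simp] lemma rOr_val (j : Fin n) : I.rOr j = I.r j := by simp [rOr]

@[simp] lemma dOr_val (j : Fin n) : I.dOr j = I.d j := by simp [dOr]

@[simp] lemma pOr_val (j : Fin n) : I.pOr j = I.p j := by simp [pOr]

end Instance

/-- Job `X.k - 1` can be processed as described by `Y`. -/
def UseOK (X : Cell) (Y : Choice) : Prop :=
  (1 ≤ X.i ∧ 1 ≤ Y.i ∧ Y.hx ≤ Y.i ∧ Y.hy ≤ Y.i) ∧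
  (Y.qx * Y.i + Y.hx * Y.l ≤ I.L * Y.i ∧ Y.qy * Y.i + Y.hy * Y.l ≤ I.L * Y.i) ∧
  Y.qy * Y.i + Y.hy * Y.l =
    Y.qx * Y.i + Y.hx * Y.l + (Y.a * Y.i + (I.pOr (X.k - 1) + Y.h) * Y.l) ∧
  (X.s ≤ I.rOr (X.k - 1) ∧ I.rOr (X.k - 1) * Y.i ≤ Y.qx * Y.i + Y.hx * Y.l) ∧
  Y.qy * Y.i + Y.hy * Y.l ≤ I.dOr (X.k - 1) * Y.i ∧
  (Y.qy * Y.i + Y.hy * Y.l) * X.i ≤ (X.q * X.i + X.h * X.l) * Y.i ∧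
  Y.u₁ + Y.u₂ + 1 ≤ X.u

/-- The first group of jobs that interrupts job `X.k` can be as described by `Y`. -/
def GroupOK (X : Cell) (Y : Choice) : Prop :=
  (X.k + 1 ≤ n ∧ 1 ≤ X.l ∧ 1 ≤ X.i) ∧ Y.u₂ ≤ X.k ∧
  (X.s * X.i + X.g * X.l ≤ I.rOr Y.u₂ * X.i ∧ I.rOr Y.u₂ * X.i ≤ X.q * X.i + X.h * X.l) ∧
  (Y.a ≤ X.a ∧ Y.h ≤ X.b) ∧
  ((I.rOr Y.u₂ + Y.a) * X.i + Y.h * X.l ≤ X.q * X.i + X.h * X.l ∧ I.rOr Y.u₂ + Y.a ≤ I.L) ∧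
  1 ≤ Y.u₁ ∧ Y.u₁ ≤ X.u

/-- No group is left. -/
def LastOK (n : ℕ) (X : Cell) : Prop :=
  (X.a ≤ 0 ∧ X.b ≤ 0) ∧ X.k + 1 ≤ n ∧ 1 ≤ X.l ∧ 1 ≤ X.i

open Classical in
/-- The alternative that `Y` describes for `X`. -/
def moveOf (α : ℝ) (X : Cell) (Y : Choice) : Option Move :=
  if X.mode ≤ 0 then
    if X.u ≤ 0 then some {}
    else if X.k ≤ 0 then none
    else if Y.l ≤ 0 then some { c₁ := { X with k := X.k - 1 } }
    else if UseOK I X Y then some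
      { c₁ := ⟨Y.qx, Y.hx, Y.l, Y.i, X.s, 0, 0, 0, Y.u₁, 0, X.k - 1⟩
        c₂ := ⟨Y.qy, Y.hy, Y.l, Y.i, Y.qx, Y.hx, Y.a, Y.h, Y.u₂, 1, X.k - 1⟩
        c₃ := ⟨X.q, X.h, X.l, X.i, Y.qy + (Y.hy * Y.l + Y.i - 1) / Y.i, 0, 0, 0,
          X.u - Y.u₁ - Y.u₂ - 1, 0, X.k - 1⟩
        weight := ((Y.i : ℝ) / Y.l) ^ α * ((Y.l : ℝ) / Y.i) * I.pOr (X.k - 1) }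
    else none
  else if X.u ≤ 0 then
    if LastOK n X then some
      { emit := 1
        job := X.k
        start := X.s + X.g * ((X.l : ℝ) / X.i)
        finish := X.q + X.h * ((X.l : ℝ) / X.i)
        speed := (X.i : ℝ) / X.l }
    else none
  else if GroupOK I X Y then some
    { c₁ := ⟨I.rOr Y.u₂ + Y.a, Y.h, X.l, X.i, I.rOr Y.u₂, 0, 0, 0, Y.u₁, 0, X.k⟩
      c₂ := ⟨X.q, X.h, X.l, X.i, I.rOr Y.u₂ + Y.a, Y.h, X.a - Y.a, X.b - Y.h, X.u - Y.u₁, 1, X.k⟩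
      emit := 1
      job := X.k
      start := X.s + X.g * ((X.l : ℝ) / X.i)
      finish := I.rOr Y.u₂
      speed := (X.i : ℝ) / X.l }
  else none

/-- The table computed by the program. -/
structure Table where
  fin : ℕ → ℕ
  c₁ : ℕ → ℕ
  c₂ : ℕ → ℕ
  c₃ : ℕ → ℕ
  emit : ℕ → ℕ
  job : ℕ → ℕ
  val : ℕ → ℝ
  start : ℕ → ℝ
  finish : ℕ → ℝ
  speed : ℕ → ℝ

namespace Table

variable (T : Table)

/-- The cells of the move have been found to be finite. -/
def Available (m : Move) : Prop :=
  1 ≤ T.fin (m.c₁.code I) ∧ 1 ≤ T.fin (m.c₂.code I) ∧ 1 ≤ T.fin (m.c₃.code I)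

/-- The value of the move. -/
def total (m : Move) : ℝ :=
  m.weight + T.val (m.c₁.code I) + T.val (m.c₂.code I) + T.val (m.c₃.code I)

/-- The move is recorded for the cell `x`. -/
structure Stores (m : Move) (x : ℕ) : Prop where
  fin : T.fin x = 1
  c₁ : T.c₁ x = m.c₁.code I
  c₂ : T.c₂ x = m.c₂.code I
  c₃ : T.c₃ x = m.c₃.code I
  emit : T.emit x = m.emit
  job : T.job x = m.job
  val : T.val x = T.total I m
  start : T.start x = m.start
  finish : T.finish x = m.finish
  speed : T.speed x = m.speed

/-- The entry `x` is a best move among the first `C` choices. -/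
def CellOK (α : ℝ) (C x : ℕ) : Prop :=
  (T.fin x = 0 ∧ ∀ c < C, ∀ m, moveOf I α (Cell.decode I x) (Choice.decode I c) = some m →
    ¬ T.Available I m) ∨
  ((∃ c < C, ∃ m, moveOf I α (Cell.decode I x) (Choice.decode I c) = some m ∧
    T.Available I m ∧ T.Stores I m x) ∧
  ∀ c < C, ∀ m, moveOf I α (Cell.decode I x) (Choice.decode I c) = some m →
    T.Available I m → T.val x ≤ T.total I m)

/-- All entries below `N` are correct. -/
structure Correct (α : ℝ) (N : ℕ) : Prop where
  fin_zero : T.fin 0 = 1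
  val_zero : T.val 0 = 0
  cell : ∀ x, 0 < x → x < N → T.CellOK I α (choiceCount n I.L I.P) x

end Table

variable {I}

/-- The end of the run is at most the integer `L`, hence so is its ceiling, at which the third cell
starts. -/
lemma UseOK.ceil_le {X : Cell} {Y : Choice} (h : UseOK I X Y) :
    Y.qy + (Y.hy * Y.l + Y.i - 1) / Y.i ≤ I.L := by
  obtain ⟨⟨-, hi, -⟩, ⟨-, h2⟩, -⟩ := h
  have : (Y.qy * Y.i + (Y.hy * Y.l + Y.i - 1)) / Y.i = Y.qy + (Y.hy * Y.l + Y.i - 1) / Y.i := by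
    rw [add_comm, Nat.add_mul_div_right _ _ hi, add_comm]
  rw [← this]
  refine Nat.le_of_lt_succ (Nat.div_lt_of_lt_mul ?_)
  calc Y.qy * Y.i + (Y.hy * Y.l + Y.i - 1) < Y.qy * Y.i + Y.hy * Y.l + Y.i := by omega
    _ ≤ I.L * Y.i + Y.i := by omega
    _ = Y.i * (I.L + 1) := by ring

/-- The cells of a move are in range and precede the given cell. -/
lemma moveOf_children {α : ℝ} {X : Cell} {Y : Choice} {m : Move} (hX : X.Valid I)
    (hY : Y.Valid I) (h : moveOf I α X Y = some m) (h0 : X.code I ≠ 0) :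
    (m.c₁.Valid I ∧ m.c₁.code I < X.code I) ∧ (m.c₂.Valid I ∧ m.c₂.code I < X.code I) ∧
      (m.c₃.Valid I ∧ m.c₃.code I < X.code I) := by
  have hz : Cell.zero.Valid I ∧ Cell.zero.code I < X.code I :=
    ⟨Cell.zero_valid, by rw [Cell.code_zero]; omega⟩
  have hlt : ∀ Z : Cell, Z.Valid I → Z.rank n < X.rank n → Z.Valid I ∧ Z.code I < X.code I :=
    fun Z hZ hr => ⟨hZ, hZ.code_lt_code hr⟩
  -- Lowering `k` by one outweighs any values of `u` and `mode` in the rank.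
  have hstep : ∀ k, X.k - 1 = k → 0 < X.k → ∀ u md, u ≤ n → md ≤ 1 →
      u + (n + 1) * (md + 2 * k) < X.rank n := by
    intro k hk hpos u md hu hmd
    rw [Cell.rank]
    have : X.k = k + 1 := by omega
    rw [this]
    have : (n + 1) * (md + 2 * k) ≤ (n + 1) * (1 + 2 * k) := by gcongr
    nlinarith [Nat.zero_le X.u, Nat.zero_le ((n + 1) * X.mode)]
  obtain ⟨⟨hX1, hX2, hX3, hX4⟩, ⟨hX5, hX6, hX7, hX8⟩, hX9, hX10, hX11⟩ := hX
  obtain ⟨⟨hY1, hY2, hY3, hY4⟩, ⟨hY5, hY6, hY7, hY8⟩, hY9, hY10⟩ := hY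
  rw [moveOf] at h
  split_ifs at h with hm hu hk hl hU hu hL hG
  · obtain rfl := Option.some_injective _ h
    exact ⟨hz, hz, hz⟩
  · obtain rfl := Option.some_injective _ h
    refine ⟨hlt _ ?_ (hstep _ rfl (by omega) _ _ hX9 hX10), hz, hz⟩
    refine ⟨⟨hX1, hX2, hX3, hX4⟩, ⟨hX5, hX6, hX7, hX8⟩, hX9, hX10, ?_⟩
    change X.k - 1 ≤ n
    omega
  · obtain rfl := Option.some_injective _ h
    have hc := hU.ceil_le
    have hu := hU.2.2.2.2.2.2
    refine ⟨hlt _ ?_ (hstep _ rfl (by omega) _ 0 hY9 (Nat.zero_le _)),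
      hlt _ ?_ (hstep _ rfl (by omega) _ 1 hY10 le_rfl),
      hlt _ ?_ (hstep _ rfl (by omega) _ 0 (show X.u - Y.u₁ - Y.u₂ - 1 ≤ n by omega)
        (Nat.zero_le _))⟩ <;>
    · simp only [Cell.Valid]
      omega
  · obtain rfl := Option.some_injective _ h
    exact ⟨hz, hz, hz⟩
  · obtain rfl := Option.some_injective _ h
    obtain ⟨⟨hG1, hG2, hG3⟩, hG4, -, ⟨hG5, hG6⟩, ⟨-, hG7⟩, hG8, hG9⟩ := hG
    -- The first cell has the same `k` but the lower mode; the second keeps both and has smaller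
    -- `u`, since a group contains at least one job.
    have hmode : X.mode = 1 := by omega
    refine ⟨hlt _ ?_ ?_, hlt _ ?_ ?_, hz⟩
    · simp only [Cell.Valid]
      omega
    · simp only [Cell.rank, hmode]
      nlinarith
    · simp only [Cell.Valid]
      omega
    · simp only [Cell.rank, hmode]
      omega

namespace Table.Correct

variable {T : Table} {α : ℝ}

/-- Every available move bounds the value of its cell. -/
lemma le_total (hT : T.Correct I α (cellCount n I.L I.P)) {X : Cell} {Y : Choice} {m : Move}
    (hX : X.Valid I) (hY : Y.Valid I) (hm : moveOf I α X Y = some m) (ha : T.Available I m) :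
    T.fin (X.code I) = 1 ∧ T.val (X.code I) ≤ T.total I m := by
  -- Cell `0` is preset and not covered by the condition on cells. Its only move is the empty one,
  -- which refers to cell `0` itself.
  rcases Nat.eq_zero_or_pos (X.code I) with h0 | h0
  · obtain rfl := hX.eq_zero h0
    have hm' : moveOf I α Cell.zero Y = some {} := by simp [moveOf, Cell.zero]
    obtain rfl := Option.some_injective _ (hm'.symm.trans hm)
    simp [Table.total, Cell.code_zero, hT.fin_zero, hT.val_zero]
  · have := hT.cell _ h0 hX.code_lt
    rw [Table.CellOK, hX.decode_code] at this
    rcases this with ⟨-, h2⟩ | ⟨⟨c, -, m', -, -, hs⟩, h3⟩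
    · exact absurd ha (h2 _ hY.code_lt m (by rw [hY.decode_code, hm]))
    · exact ⟨hs.fin, h3 _ hY.code_lt m (by rw [hY.decode_code, hm]) ha⟩

/-- A finite cell other than the first one records an available move. -/
lemma exists_move (hT : T.Correct I α (cellCount n I.L I.P)) {X : Cell} (hX : X.Valid I)
    (h0 : X.code I ≠ 0) (hfin : 1 ≤ T.fin (X.code I)) :
    ∃ Y m, Y.Valid I ∧ moveOf I α X Y = some m ∧ T.Available I m ∧ T.Stores I m (X.code I) := by
  have := hT.cell _ (Nat.pos_of_ne_zero h0) hX.code_lt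
  rw [Table.CellOK, hX.decode_code] at this
  rcases this with ⟨h1, -⟩ | ⟨⟨c, -, m, hm, ha, hs⟩, -⟩
  · omega
  · exact ⟨_, m, Choice.decode_valid c, hm, ha, hs⟩

end Table.Correct

attribute [irreducible] Cell.code Choice.code Cell.decode Choice.decode cellCount choiceCount

end SpeedScaling

end

noncomputable section

namespace SpeedScaling

/-! ## Soundness of the table -/

variable {n : ℕ} {I : Instance n} {α : ℝ}

lemma G_le_use {j : Fin n} {s t x y : ℚ} {u u₁ u₂ a l i h : ℕ} (hx : x ∈ I.Phi)
    (hy : y ∈ I.Phi) (hu : u₁ + u₂ + 1 ≤ u)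
    (hb : a ≤ I.L ∧ (1 ≤ l ∧ l ≤ I.L) ∧ (1 ≤ i ∧ i ≤ I.P) ∧ h ≤ I.P)
    (hyx : y - x = a + (I.p j + h) * (l / i : ℚ))
    (hc : (s ≤ I.r j ∧ (I.r j : ℚ) ≤ x) ∧ x ≤ y ∧ y ≤ I.d j ∧ y ≤ t) :
    I.G α (j + 1) s t u ≤ I.G α j s x u₁ + I.FRec (I.G α j) j x y u₂ l i a h
      + ENNReal.ofReal ((i / l : ℝ) ^ (α - 1) * I.p j) + I.G α j y t (u - u₁ - u₂ - 1) := by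
  rw [Instance.G]
  refine (min_le_right _ _).trans ?_
  exact iInf_le_of_le j <| iInf_le_of_le rfl <| iInf_le_of_le x <| iInf_le_of_le hx <|
    iInf_le_of_le y <| iInf_le_of_le hy <| iInf_le_of_le u₁ <| iInf_le_of_le u₂ <|
    iInf_le_of_le hu <| iInf_le_of_le a <| iInf_le_of_le l <| iInf_le_of_le i <|
    iInf_le_of_le h <| iInf_le_of_le hb <| iInf_le_of_le hyx <| iInf_le_of_le hc le_rfl

lemma G_succ_le (k : ℕ) (s t : ℚ) (u : ℕ) : I.G α (k + 1) s t u ≤ I.G α k s t u := by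
  rw [Instance.G]
  exact min_le_left _ _

lemma G_zero (k : ℕ) (s t : ℚ) : I.G α k s t 0 = 0 := by
  induction k with
  | zero => simp [Instance.G]
  | succ k ih => exact le_antisymm ((G_succ_le k s t 0).trans ih.le) zero_le

/-- A later start only removes alternatives, as `s` enters through `s ≤ r j` and the leftmost term.
This lets the table start the right part at the ceiling of `y` while the recursion starts it at `y`.
-/
lemma G_mono {k : ℕ} {s s' t : ℚ} {u : ℕ} (h : s ≤ s') : I.G α k s t u ≤ I.G α k s' t u := by
  induction k generalizing s s' t u with
  | zero => simp [Instance.G]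
  | succ k ih =>
    conv_rhs => rw [Instance.G]
    refine le_min ((G_succ_le k s t u).trans (ih h)) ?_
    refine le_iInf fun j => le_iInf fun hj => le_iInf fun x => le_iInf fun hx =>
        le_iInf fun y => le_iInf fun hy => le_iInf fun u₁ => le_iInf fun u₂ => le_iInf fun hu =>
        le_iInf fun a => le_iInf fun l => le_iInf fun i => le_iInf fun h' =>
        le_iInf fun hb => le_iInf fun heq => le_iInf fun ⟨⟨hs, hr⟩, hc⟩ => ?_
    subst hj
    refine (G_le_use hx hy hu hb heq ⟨⟨h.trans hs, hr⟩, hc⟩).trans ?_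
    gcongr
    exact ih h

lemma FRec_le_group {g : ℚ → ℚ → ℕ → ℝ≥0∞} {m : ℕ} {x y y' : ℚ} {u l i a h a' h' b : ℕ}
    {j : Fin n} (hj : (j : ℕ) ≤ m) (hxy : x ≤ I.r j ∧ (I.r j : ℚ) ≤ y) (ha : a' ≤ a ∧ h' ≤ h)
    (hy : y' = I.r j + a' + h' * (l / i : ℚ) ∧ y' ≤ y) (hb : 1 ≤ b ∧ b ≤ u)
    (h0 : ¬ (a = 0 ∧ h = 0)) :
    I.FRec g m x y u l i a h ≤
      g (I.r j) y' b + I.FRec g m y' y (u - b) l i (a - a') (h - h') := by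
  rw [Instance.FRec, if_neg (by omega), if_neg h0]
  exact iInf_le_of_le j <| iInf_le_of_le a' <| iInf_le_of_le h' <| iInf_le_of_le y' <|
    iInf_le_of_le hj <| iInf_le_of_le hxy <| iInf_le_of_le ha <| iInf_le_of_le hy <|
    iInf_le_of_le b <| iInf_le_of_le hb le_rfl

lemma FRec_zero {g : ℚ → ℚ → ℕ → ℝ≥0∞} {m : ℕ} {x y : ℚ} {l i a h : ℕ} :
    I.FRec g m x y 0 l i a h = 0 := by
  rw [Instance.FRec, if_pos rfl]

/-- The list of pieces recorded for an entry of the table, and the number of entries visited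
when it is put together. -/
inductive Table.Extract (T : Table) (N : ℕ) : ℕ → List (Piece n) → ℕ → Prop where
  | zero : Extract T N 0 [] 1
  | silent (x : ℕ) (l₁ l₂ l₃ : List (Piece n)) (s₁ s₂ s₃ : ℕ) (hx : x ≠ 0 ∧ x < N)
      (he : T.emit x = 0) (h₁ : Extract T N (T.c₁ x) l₁ s₁) (h₂ : Extract T N (T.c₂ x) l₂ s₂)
      (h₃ : Extract T N (T.c₃ x) l₃ s₃) : Extract T N x (l₁ ++ (l₂ ++ l₃)) (1 + s₁ + s₂ + s₃)
  | emit (x : ℕ) (p : Piece n) (l₁ l₂ l₃ : List (Piece n)) (s₁ s₂ s₃ : ℕ) (hx : x ≠ 0 ∧ x < N)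
      (he : T.emit x = 1) (hj : T.job x = p.job) (hs : T.start x = p.start)
      (ht : T.finish x = p.finish) (hv : T.speed x = p.speed)
      (h₁ : Extract T N (T.c₁ x) l₁ s₁) (h₂ : Extract T N (T.c₂ x) l₂ s₂)
      (h₃ : Extract T N (T.c₃ x) l₃ s₃) :
      Extract T N x (p :: (l₁ ++ (l₂ ++ l₃))) (1 + s₁ + s₂ + s₃)

namespace Cell

/-- The end of the window of a cell. -/
def hi (X : Cell) : ℚ := X.q + X.h * ((X.l : ℚ) / X.i)

/-- The start of the window of a cell of mode `1`. -/
def lo (X : Cell) : ℚ := X.s + X.g * ((X.l : ℚ) / X.i)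

/-- The duration of the groups of a cell of mode `1`. -/
def span (X : Cell) : ℝ := X.a + X.b * ((X.l : ℝ) / X.i)

end Cell

/-- The entry of a cell of mode `0` describes a plan. -/
def PlanCell (I : Instance n) (α : ℝ) (T : Table) (X : Cell) : Prop :=
  0 ≤ T.val (X.code I) ∧ I.G α X.k X.s X.hi X.u ≤ ENNReal.ofReal (T.val (X.code I)) ∧
  ∃ (U : Finset (Fin n)) (l : List (Piece n)) (sz : ℕ),
    T.Extract (cellCount n I.L I.P) (X.code I) l sz ∧
    sz ≤ 4 + 9 * X.k * X.u ∧ U.card = X.u ∧ Piece.energy α l = T.val (X.code I) ∧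
    ∀ s₀ : ℝ, s₀ ≤ X.s → s₀ ≤ X.hi → Plan I X.k U s₀ X.hi l

/-- The entry of a cell of mode `1` describes the groups that interrupt a job. -/
def HostCell (I : Instance n) (α : ℝ) (T : Table) (X : Cell) : Prop :=
  ∃ hk : X.k < n, (1 ≤ X.l ∧ 1 ≤ X.i) ∧ 0 ≤ T.val (X.code I) ∧
  I.FRec (I.G α X.k) X.k X.lo X.hi X.u X.l X.i X.a X.b ≤ ENNReal.ofReal (T.val (X.code I)) ∧
  ∃ (U : Finset (Fin n)) (l : List (Piece n)) (sz : ℕ) (v : ℝ≥0),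
    T.Extract (cellCount n I.L I.P) (X.code I) l sz ∧
    sz ≤ 4 + (9 * X.k + 6) * X.u ∧ U.card = X.u ∧ (v : ℝ) = (X.i : ℝ) / X.l ∧
    Piece.energy α l = T.val (X.code I) + ((X.hi : ℝ) - X.lo - X.span) * (v : ℝ) ^ α ∧
    HostPlan I ⟨X.k, hk⟩ U X.lo X.hi X.span v l

lemma zero_planCell {T : Table} (h0 : T.val 0 = 0) : PlanCell I α T Cell.zero := by
  refine ⟨by rw [Cell.code_zero, h0], ?_, ∅, [], 1, ?_, by simp [Cell.zero], rfl, ?_, ?_⟩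
  · refine le_trans (le_of_eq ?_) zero_le
    exact G_zero _ _ _
  · rw [Cell.code_zero]
    exact .zero
  · rw [Cell.code_zero, h0]
    rfl
  · intro s₀ _ h
    exact Plan.nil _ h

/-- Times with a common denominator. -/
lemma time_eq (q h l : ℕ) {i : ℕ} (hi : 1 ≤ i) :
    (q : ℚ) + h * ((l : ℚ) / i) = ((q * i + h * l : ℕ) : ℚ) / i := by
  have : (i : ℚ) ≠ 0 := by positivity
  push_cast
  field_simp

lemma time_le_time {q h l i q' h' l' i' : ℕ} (hi : 1 ≤ i) (hi' : 1 ≤ i')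
    (hle : (q * i + h * l) * i' ≤ (q' * i' + h' * l') * i) :
    (q : ℚ) + h * ((l : ℚ) / i) ≤ q' + h' * ((l' : ℚ) / i') := by
  rw [time_eq q h l hi, time_eq q' h' l' hi', div_le_div_iff₀ (by positivity) (by positivity)]
  exact_mod_cast hle

lemma time_le_nat {q h l i m : ℕ} (hi : 1 ≤ i) (hle : q * i + h * l ≤ m * i) :
    (q : ℚ) + h * ((l : ℚ) / i) ≤ m := by
  rw [time_eq q h l hi, div_le_iff₀ (by positivity)]
  exact_mod_cast hle

lemma nat_le_time {q h l i m : ℕ} (hi : 1 ≤ i) (hle : m * i ≤ q * i + h * l) :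
    (m : ℚ) ≤ q + h * ((l : ℚ) / i) := by
  rw [time_eq q h l hi, le_div_iff₀ (by positivity)]
  exact_mod_cast hle

lemma time_le_ceil {q h l i : ℕ} (hi : 1 ≤ i) :
    (q : ℚ) + h * ((l : ℚ) / i) ≤ (q + (h * l + i - 1) / i : ℕ) := by
  refine time_le_nat hi ?_
  rw [add_mul]
  have h1 := Nat.div_add_mod (h * l + i - 1) i
  have h2 := Nat.mod_lt (h * l + i - 1) hi
  rw [mul_comm] at h1
  omega

/-- The machine evaluates only the power with exponent `α`, so the weight is obtained by dividing by
the speed. -/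
lemma weight_eq {i l : ℕ} (hi : 1 ≤ i) (hl : 1 ≤ l) (p : ℕ) :
    ((i : ℝ) / l) ^ α * ((l : ℝ) / i) * p = (i / l : ℝ) ^ (α - 1) * p := by
  have h1 : (0 : ℝ) < i := by exact_mod_cast hi
  have h2 : (0 : ℝ) < l := by exact_mod_cast hl
  rw [Real.rpow_sub_one (by positivity)]
  field_simp

/-- The cells `c₁`, `c₂`, `c₃` supply the plans before, during and after the run of the job, which
`Plan.combine` joins. Only times in `Φ` occur, so the same move is an alternative in the recursion
for `G`. The value of the entry thus bounds `G` and is at the same time the energy of a plan. -/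
lemma use_planCell {T : Table} {X : Cell} {Y : Choice} {m : Move} (hY : Y.Valid I)
    (hX : X.Valid I)
    (hk : 1 ≤ X.k) (hl : 1 ≤ Y.l) (hU : UseOK I X Y) (hc₁ : m.c₁ =
      ⟨Y.qx, Y.hx, Y.l, Y.i, X.s, 0, 0, 0, Y.u₁, 0, X.k - 1⟩) (hc₂ : m.c₂ =
      ⟨Y.qy, Y.hy, Y.l, Y.i, Y.qx, Y.hx, Y.a, Y.h, Y.u₂, 1, X.k - 1⟩) (hc₃ : m.c₃ =
      ⟨X.q, X.h, X.l, X.i, Y.qy + (Y.hy * Y.l + Y.i - 1) / Y.i, 0, 0, 0,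
          X.u - Y.u₁ - Y.u₂ - 1, 0, X.k - 1⟩) (hw : m.weight =
      ((Y.i : ℝ) / Y.l) ^ α * ((Y.l : ℝ) / Y.i) * I.pOr (X.k - 1)) (he : m.emit = 0)
    (h0 : X.code I ≠ 0 ∧ X.code I < cellCount n I.L I.P) (hs : T.Stores I m (X.code I))
    (h₁ : PlanCell I α T m.c₁)
    (h₂ : m.c₂.lo ≤ m.c₂.hi → HostCell I α T m.c₂) (h₃ : PlanCell I α T m.c₃) :
    PlanCell I α T X := by
  obtain ⟨⟨hXi, hYi, hhx, hhy⟩, ⟨hxL, hyL⟩, hyx, ⟨hsr, hrx⟩, hyd, hyt, hu⟩ := hU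
  obtain ⟨⟨hY1, hY2, hY3, hY4⟩, ⟨hY5, hY6, hY7, hY8⟩, hY9, hY10⟩ := hY
  have hXk : X.k ≤ n := hX.2.2.2.2
  obtain ⟨k, hkk⟩ : ∃ k, X.k = k + 1 := ⟨X.k - 1, by omega⟩
  have hkn : k < n := by omega
  have hk1 : X.k - 1 = k := by omega
  simp only [hk1] at hsr hrx hyd hyx hw hc₁ hc₂ hc₃
  let j : Fin n := ⟨k, hkn⟩
  have hrj : I.rOr k = I.r j := I.rOr_val j
  have hdj : I.dOr k = I.d j := I.dOr_val j
  have hpj : I.pOr k = I.p j := I.pOr_val j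
  rw [hrj] at hsr hrx
  rw [hdj] at hyd
  rw [hpj] at hyx hw
  set x : ℚ := Y.qx + Y.hx * ((Y.l : ℚ) / Y.i) with hx
  set y : ℚ := Y.qy + Y.hy * ((Y.l : ℚ) / Y.i) with hy
  have hhi₁ : m.c₁.hi = x := by rw [hc₁]; rfl
  have hhi₂ : m.c₂.hi = y := by rw [hc₂]; rfl
  have hlo₂ : m.c₂.lo = x := by rw [hc₂]; rfl
  have hhi₃ : m.c₃.hi = X.hi := by rw [hc₃]; rfl
  have hYi' : (0 : ℚ) < Y.i := by exact_mod_cast hYi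
  have hYl' : (0 : ℚ) < Y.l := by exact_mod_cast hl
  have hxPhi : x ∈ I.Phi := ⟨Y.qx, Y.hx, Y.l, Y.i, hY5, hl, hY3, hYi, hY4, hhx, rfl,
    time_le_nat hYi hxL⟩
  have hyPhi : y ∈ I.Phi := ⟨Y.qy, Y.hy, Y.l, Y.i, hY1, hl, hY3, hYi, hY4, hhy, rfl,
    time_le_nat hYi hyL⟩
  have hyx' : y - x = Y.a + (I.p j + Y.h) * ((Y.l : ℚ) / Y.i) := by
    rw [hx, hy, time_eq _ _ _ hYi, time_eq _ _ _ hYi, hyx]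
    push_cast
    field_simp
    ring
  have hxy : x ≤ y := by
    rw [← sub_nonneg, hyx']
    positivity
  have hrx' : (I.r j : ℚ) ≤ x := nat_le_time hYi hrx
  have hyd' : y ≤ I.d j := time_le_nat hYi hyd
  have hyt' : y ≤ X.hi := time_le_time hYi hXi hyt
  have hsr' : (X.s : ℚ) ≤ I.r j := by exact_mod_cast hsr
  have hceil : y ≤ m.c₃.s := by
    rw [hc₃]
    exact time_le_ceil hYi
  obtain ⟨hv₁, hG₁, U₁, l₁, s₁, hE₁, hs₁, hu₁, he₁, hP₁⟩ := h₁
  obtain ⟨hkn₂, -, hv₂, hF₂, U₂, l₂, s₂, v, hE₂, hs₂, hu₂, hv, he₂, hP₂⟩ := h₂ (by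
    rwa [hhi₂, hlo₂])
  obtain ⟨hv₃, hG₃, U₃, l₃, s₃, hE₃, hs₃, hu₃, he₃, hP₃⟩ := h₃
  have hw' : m.weight = (Y.i / Y.l : ℝ) ^ (α - 1) * I.p j := hw.trans (weight_eq hYi hl _)
  have hwpos : 0 ≤ m.weight := by
    rw [hw']
    positivity
  have hval := hs.val
  rw [Table.total] at hval
  have hYiR : (0 : ℝ) < Y.i := by exact_mod_cast hYi
  have hYlR : (0 : ℝ) < Y.l := by exact_mod_cast hl
  have hspan : m.c₂.span = Y.a + Y.h * ((Y.l : ℝ) / Y.i) := by rw [hc₂]; rfl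
  have hv' : (v : ℝ) = Y.i / Y.l := by rw [hv, hc₂]
  have hyxR : (y : ℝ) - x = Y.a + (I.p j + Y.h) * ((Y.l : ℝ) / Y.i) := by
    have h1 := congrArg (fun q : ℚ => (q : ℝ)) hyx'
    push_cast at h1
    exact h1
  -- In the table the groups use exactly the prescribed duration, so the host runs at exactly `i /
  -- l`.
  have hlen : (y : ℝ) - x - m.c₂.span = I.p j * ((Y.l : ℝ) / Y.i) := by
    rw [hspan, hyxR]
    ring
  have hk₁ : m.c₁.k = k := by rw [hc₁]
  have hk₃ : m.c₃.k = k := by rw [hc₃]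
  have hk₂ : m.c₂.k = k := by rw [hc₂]
  have hj₂ : (⟨m.c₂.k, hkn₂⟩ : Fin n) = j := Fin.ext hk₂
  have hsx : (X.s : ℚ) ≤ x := hsr'.trans hrx'
  have hs₁' : m.c₁.s = X.s := by rw [hc₁]
  rw [hj₂, hlo₂, hhi₂] at hP₂
  rw [hhi₁, hk₁, hs₁'] at hP₁
  rw [hhi₃, hk₃] at hP₃
  have hP : ∀ s₀ : ℝ, s₀ ≤ X.s → Plan I (j + 1) (insert j (U₁ ∪ U₂ ∪ U₃)) s₀ X.hi
      (l₁ ++ (l₂ ++ l₃)) ∧ (insert j (U₁ ∪ U₂ ∪ U₃)).card =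
        U₁.card + U₂.card + U₃.card + 1 := by
    intro s₀ hs₀
    have h1 : (X.s : ℝ) ≤ x := by exact_mod_cast hsx
    -- The third cell starts at the ceiling of `y`, but its plan may be started at `y` itself and
    -- then adjoins the host plan.
    refine Plan.combine (hP₁ s₀ hs₀ (hs₀.trans h1)) hP₂
      (hP₃ y (by exact_mod_cast hceil) (by exact_mod_cast hyt')) ?_ ?_ ?_ ?_
    · exact hs₀.trans (by exact_mod_cast hsr)
    · exact_mod_cast hrx'
    · exact_mod_cast hyd'
    · rw [hlen, hv']
      field_simp
  refine ⟨by rw [hval]; positivity, ?_, insert j (U₁ ∪ U₂ ∪ U₃), l₁ ++ (l₂ ++ l₃),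
    1 + s₁ + s₂ + s₃, ?_, ?_, ?_, ?_, ?_⟩
  · rw [hkk, hval, ENNReal.ofReal_add (by positivity) hv₃, ENNReal.ofReal_add (by positivity) hv₂,
      ENNReal.ofReal_add hwpos hv₁]
    refine (G_le_use (j := j) hxPhi hyPhi hu ⟨hY7, ⟨hl, hY3⟩, ⟨hYi, hY4⟩, hY8⟩ hyx'
      ⟨⟨hsr', hrx'⟩, hxy, hyd', hyt'⟩).trans ?_
    rw [hhi₁, hk₁, hs₁'] at hG₁
    rw [hhi₂, hlo₂] at hF₂
    rw [hhi₃, hk₃] at hG₃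
    have hG₃' := (G_mono hceil).trans hG₃
    have e₁ : m.c₁.u = Y.u₁ := by rw [hc₁]
    have e₃ : m.c₃.u = X.u - Y.u₁ - Y.u₂ - 1 := by rw [hc₃]
    rw [e₁] at hG₁
    rw [e₃] at hG₃'
    have hF₂' : I.FRec (I.G α k) k x y Y.u₂ Y.l Y.i Y.a Y.h ≤
        ENNReal.ofReal (T.val (m.c₂.code I)) := by
      refine le_trans (le_of_eq ?_) hF₂
      rw [hc₂]
    refine (add_le_add (add_le_add (add_le_add hG₁ hF₂') (ENNReal.ofReal_le_ofReal hw'.ge))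
      hG₃').trans (le_of_eq ?_)
    ring
  · refine .silent _ _ _ _ _ _ _ h0 (by rw [hs.emit, he]) ?_ ?_ ?_
    · rwa [hs.c₁]
    · rwa [hs.c₂]
    · rwa [hs.c₃]
  -- Three children cost at most `4` each beyond their linear terms. With the visit itself this
  -- makes `13 = 4 + 9`, and the coefficient `9` pays for the additional job.
  · simp only [hc₁] at hs₁
    simp only [hc₂] at hs₂
    simp only [hc₃] at hs₃
    obtain ⟨u₃, hu₃⟩ : ∃ u₃, X.u = Y.u₁ + Y.u₂ + u₃ + 1 := ⟨X.u - Y.u₁ - Y.u₂ - 1, by omega⟩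
    rw [hu₃, show Y.u₁ + Y.u₂ + u₃ + 1 - Y.u₁ - Y.u₂ - 1 = u₃ by omega] at hs₃
    rw [hkk, hu₃]
    have e : 4 + 9 * (k + 1) * (Y.u₁ + Y.u₂ + u₃ + 1) = 13 + 9 * k * Y.u₁ + 9 * k * Y.u₂ +
        9 * k * u₃ + 9 * k + 9 * (Y.u₁ + Y.u₂ + u₃) := by ring
    rw [add_mul] at hs₂
    omega
  · rw [(hP X.s le_rfl).2, hu₁, hu₂, hu₃, hc₁, hc₂, hc₃]
    dsimp only
    omega
  · rw [Piece.energy_append, Piece.energy_append, he₁, he₂, he₃, hval, hhi₂, hlo₂, hlen, hw', hv',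
      ← weight_eq hYi hl]
    ring
  · intro s₀ hs₀ _
    rw [hkk]
    exact (hP s₀ hs₀).1

/-- With no duration left for groups, job `k` runs alone to the end of the window. The four visits
are the entry itself and three times the empty cell. -/
lemma last_hostCell {T : Table} {X : Cell} {m : Move} (hL : LastOK n X) (hu : X.u = 0)
    (hc₁ : m.c₁ = Cell.zero) (hc₂ : m.c₂ = Cell.zero) (hc₃ : m.c₃ = Cell.zero)
    (hw : m.weight = 0) (he : m.emit = 1) (hj : m.job = X.k)
    (hst : m.start = X.s + X.g * ((X.l : ℝ) / X.i))
    (hsp : m.finish = X.q + X.h * ((X.l : ℝ) / X.i)) (hv : m.speed = (X.i : ℝ) / X.l)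
    (h0 : X.code I ≠ 0 ∧ X.code I < cellCount n I.L I.P) (hT : T.val 0 = 0)
    (hs : T.Stores I m (X.code I)) (hle : X.lo ≤ X.hi) :
    HostCell I α T X := by
  obtain ⟨⟨ha, hb⟩, hk, hl, hi⟩ := hL
  have hval := hs.val
  rw [Table.total, hc₁, hc₂, hc₃, hw, Cell.code_zero, hT] at hval
  have hval : T.val (X.code I) = 0 := by rw [hval]; ring
  have hspan : X.span = 0 := by
    simp [Cell.span, Nat.le_zero.1 ha, Nat.le_zero.1 hb]
  have hle' : (X.lo : ℝ) ≤ X.hi := by exact_mod_cast hle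
  refine ⟨by omega, ⟨hl, hi⟩, hval.ge, by simp [hu, FRec_zero], ∅,
    [⟨⟨X.k, by omega⟩, X.lo, X.hi, ⟨(X.i : ℝ) / X.l, by positivity⟩⟩], 1 + 1 + 1 + 1,
    ⟨(X.i : ℝ) / X.l, by positivity⟩, ?_, by omega, by simp [hu], rfl, ?_, ?_⟩
  · refine .emit _ _ [] [] [] _ _ _ h0 (by rw [hs.emit, he]) (by rw [hs.job, hj]) ?_ ?_ ?_ ?_ ?_ ?_
    · rw [hs.start, hst, Cell.lo]
      push_cast
      rfl
    · rw [hs.finish, hsp, Cell.hi]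
      push_cast
      rfl
    · rw [hs.speed, hv]
      rfl
    · rw [hs.c₁, hc₁, Cell.code_zero]
      exact .zero
    · rw [hs.c₂, hc₂, Cell.code_zero]
      exact .zero
    · rw [hs.c₃, hc₃, Cell.code_zero]
      exact .zero
  · simp [hspan, hval]
  · rw [hspan]
    exact HostPlan.single _ hle' _

/-- One piece of the host up to the release date, the plan of the group, and the remaining host
plan, joined by `HostPlan.cons`. The same splitting is an alternative in the recursion for `F`. -/
lemma group_hostCell {T : Table} {X : Cell} {Y : Choice} {m : Move} (hG : GroupOK I X Y)
    (hc₁ : m.c₁ =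
      ⟨I.rOr Y.u₂ + Y.a, Y.h, X.l, X.i, I.rOr Y.u₂, 0, 0, 0, Y.u₁, 0, X.k⟩) (hc₂ : m.c₂ =
      ⟨X.q, X.h, X.l, X.i, I.rOr Y.u₂ + Y.a, Y.h, X.a - Y.a, X.b - Y.h, X.u - Y.u₁, 1, X.k⟩)
    (hc₃ : m.c₃ = Cell.zero)
    (hw : m.weight = 0) (he : m.emit = 1) (hj : m.job = X.k)
    (hst : m.start = X.s + X.g * ((X.l : ℝ) / X.i))
    (hsp : m.finish = I.rOr Y.u₂) (hv : m.speed = (X.i : ℝ) / X.l)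
    (h0 : X.code I ≠ 0 ∧ X.code I < cellCount n I.L I.P) (hT : T.val 0 = 0)
    (hs : T.Stores I m (X.code I))
    (h₁ : PlanCell I α T m.c₁) (h₂ : m.c₂.lo ≤ m.c₂.hi → HostCell I α T m.c₂) :
    HostCell I α T X := by
  obtain ⟨⟨hk, hl, hi⟩, hjk, ⟨hzr, hry⟩, ⟨ha, hb⟩, ⟨hyy, -⟩, hb1, hbu⟩ := hG
  have hkn : X.k < n := by omega
  have hjn : Y.u₂ < n := by omega
  have hiR : (0 : ℝ) < X.i := by exact_mod_cast hi
  have hlR : (0 : ℝ) < X.l := by exact_mod_cast hl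
  have hiQ : (0 : ℚ) < X.i := by exact_mod_cast hi
  let j : Fin n := ⟨Y.u₂, hjn⟩
  have hrj : I.rOr Y.u₂ = I.r j := I.rOr_val j
  rw [hrj] at hzr hry hyy hc₁ hc₂ hsp
  have hzr' : X.lo ≤ I.r j := time_le_nat hi hzr
  have hry' : (I.r j : ℚ) ≤ X.hi := nat_le_time hi hry
  set y' : ℚ := I.r j + Y.a + Y.h * ((X.l : ℚ) / X.i) with hy'
  have hy'' : y' = ((I.r j + Y.a : ℕ) : ℚ) + Y.h * ((X.l : ℚ) / X.i) := by
    rw [hy']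
    push_cast
    rfl
  have hyy' : y' ≤ X.hi := by
    rw [hy'']
    refine time_le_time hi hi ?_
    gcongr
  have hhi₁ : m.c₁.hi = y' := by rw [hc₁, hy'']; rfl
  have hhi₂ : m.c₂.hi = X.hi := by rw [hc₂]; rfl
  have hlo₂ : m.c₂.lo = y' := by rw [hc₂, hy'']; rfl
  have hspan₂ : m.c₂.span = (X.a - Y.a : ℕ) + (X.b - Y.h : ℕ) * ((X.l : ℝ) / X.i) := by
    rw [hc₂]; rfl
  obtain ⟨hv₁, hG₁, U₁, l₁, s₁, hE₁, hs₁, hu₁, he₁, hP₁⟩ := h₁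
  obtain ⟨hkn₂, -, hv₂, hF₂, U₂, l₂, s₂, v, hE₂, hs₂, hu₂, hv', he₂, hP₂⟩ := h₂ (by
    rwa [hhi₂, hlo₂])
  have hval := hs.val
  rw [Table.total, hw, hc₃, Cell.code_zero, hT, zero_add, add_zero] at hval
  have hv'' : (v : ℝ) = X.i / X.l := by rw [hv', hc₂]
  have hk₁ : m.c₁.k = X.k := by rw [hc₁]
  have hs₁' : m.c₁.s = I.r j := by rw [hc₁]
  have hu₁' : m.c₁.u = Y.u₁ := by rw [hc₁]
  have hu₂' : m.c₂.u = X.u - Y.u₁ := by rw [hc₂]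
  have hk₂ : m.c₂.k = X.k := by rw [hc₂]
  have hj₂ : (⟨m.c₂.k, hkn₂⟩ : Fin n) = ⟨X.k, hkn⟩ := Fin.ext hk₂
  have hry'' : (I.r j : ℝ) ≤ y' := by
    rw [hy']
    push_cast
    rw [add_assoc]
    exact le_add_of_nonneg_right (by positivity)
  rw [hhi₁, hk₁, hs₁'] at hP₁
  rw [hj₂, hlo₂, hhi₂] at hP₂
  have hP₁' := hP₁ (I.r j) le_rfl hry''
  have hspan : ((y' : ℝ) - I.r j) + m.c₂.span = X.span := by
    rw [hspan₂, Cell.span, hy', Nat.cast_sub ha, Nat.cast_sub hb]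
    push_cast
    ring
  refine ⟨hkn, ⟨hl, hi⟩, by rw [hval]; positivity, ?_, U₁ ∪ U₂,
    ⟨⟨X.k, hkn⟩, X.lo, I.r j, v⟩ :: (l₁ ++ (l₂ ++ [])),
    1 + s₁ + s₂ + 1, v, ?_, ?_, ?_, hv'', ?_, ?_⟩
  · rw [hval, ENNReal.ofReal_add hv₁ hv₂]
    -- Here `F` is infinite by definition, while the move does not test for this case. It cannot
    -- occur: the group would have duration zero, yet it contains a job released strictly before its
    -- end.
    by_cases hab : X.a = 0 ∧ X.b = 0
    · exfalso
      have hyr : (y' : ℝ) = I.r j := by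
        have e1 : Y.a = 0 := by omega
        have e2 : Y.h = 0 := by omega
        rw [hy', e1, e2]
        simp
      have hUe : U₁.Nonempty := by
        rw [← Finset.card_pos, hu₁, hu₁']
        omega
      obtain ⟨x, hx⟩ := hUe
      have := hP₁'.jobs x hx
      linarith
    · refine (FRec_le_group (j := j) hjk ⟨hzr', hry'⟩ ⟨ha, hb⟩ ⟨hy', hyy'⟩ ⟨hb1, hbu⟩ hab).trans ?_
      rw [hhi₁, hk₁, hs₁', hu₁'] at hG₁
      rw [hhi₂, hlo₂, hu₂'] at hF₂
      refine add_le_add hG₁ (le_trans (le_of_eq ?_) hF₂)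
      rw [hc₂]
  · refine .emit _ _ _ _ _ _ _ _ h0 (by rw [hs.emit, he]) (by rw [hs.job, hj]) ?_ ?_ ?_ ?_ ?_ ?_
    · rw [hs.start, hst, Cell.lo]
      push_cast
      rfl
    · rw [hs.finish, hsp]
    · rw [hs.speed, hv, hv'']
    · rwa [hs.c₁]
    · rwa [hs.c₂]
    · rw [hs.c₃, hc₃, Cell.code_zero]
      exact .zero
  -- A group adds at most `6` visits beyond those charged to its jobs; this is paid by the summand
  -- `6` since the group is nonempty.
  · rw [hk₁, hu₁'] at hs₁
    rw [show m.c₂.k = X.k by rw [hc₂], hu₂'] at hs₂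
    obtain ⟨u₂, hu₂⟩ : ∃ u₂, X.u = Y.u₁ + u₂ := ⟨X.u - Y.u₁, by omega⟩
    rw [hu₂, show Y.u₁ + u₂ - Y.u₁ = u₂ by omega] at hs₂
    rw [hu₂]
    nlinarith
  · rw [Finset.card_union_of_disjoint (hP₁'.disjoint_hostPlan hP₂), hu₁, hu₂, hu₁', hu₂']
    omega
  · rw [Piece.energy_cons, List.append_nil, Piece.energy_append, he₁, he₂, hval, ← hspan, hhi₂,
      hlo₂]
    ring
  · rw [← hspan, List.append_nil]
    exact HostPlan.cons (by exact_mod_cast hzr') hP₁' hP₂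

/-- Every finite entry of a correct table describes a plan or the groups interrupting a job. -/
theorem Table.Correct.sound {T : Table} (hT : T.Correct I α (cellCount n I.L I.P)) {X : Cell}
    (hX : X.Valid I) (hfin : 1 ≤ T.fin (X.code I)) :
    (X.mode = 0 → PlanCell I α T X) ∧ (X.mode = 1 → X.lo ≤ X.hi → HostCell I α T X) := by
  -- Strong induction on the code: the children recorded for an entry have smaller codes.
  induction hN : X.code I using Nat.strong_induction_on generalizing X with
  | _ N ih =>
    subst hN
    rcases eq_or_ne (X.code I) 0 with h0 | h0
    · obtain rfl := hX.eq_zero h0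
      exact ⟨fun _ => zero_planCell hT.val_zero, fun h => absurd h (by simp [Cell.zero])⟩
    obtain ⟨Y, m, hY, hm, ⟨ha₁, ha₂, ha₃⟩, hs⟩ := hT.exists_move hX h0 hfin
    obtain ⟨⟨hv₁, hlt₁⟩, ⟨hv₂, hlt₂⟩, ⟨hv₃, hlt₃⟩⟩ := moveOf_children hX hY hm h0
    have ih₁ := ih _ hlt₁ hv₁ ha₁ rfl
    have ih₂ := ih _ hlt₂ hv₂ ha₂ rfl
    have ih₃ := ih _ hlt₃ hv₃ ha₃ rfl
    rw [moveOf] at hm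
    split_ifs at hm with hmode hu hk hl hU hu hL hG
    · obtain rfl := Option.some_injective _ hm
      refine ⟨fun _ => ?_, fun h => by omega⟩
      have hval := hs.val
      simp only [Table.total, Cell.code_zero, hT.val_zero, add_zero] at hval
      have hu : X.u = 0 := by omega
      refine ⟨hval.ge, by rw [hu, G_zero]; exact zero_le, ∅, [], 1 + 1 + 1 + 1, ?_, by omega,
        by simp [hu], by rw [hval]; rfl, fun s₀ _ h => Plan.nil _ h⟩
      refine .silent _ [] [] [] _ _ _ ⟨h0, hX.code_lt⟩ hs.emit ?_ ?_ ?_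
      · rw [hs.c₁, Cell.code_zero]
        exact .zero
      · rw [hs.c₂, Cell.code_zero]
        exact .zero
      · rw [hs.c₃, Cell.code_zero]
        exact .zero
    · obtain rfl := Option.some_injective _ hm
      refine ⟨fun _ => ?_, fun h => by omega⟩
      obtain ⟨hv, hG, U, l, sz, hE, hsz, hU, he, hP⟩ := ih₁.1 (by simpa using hmode)
      have hval := hs.val
      simp only [Table.total, Cell.code_zero, hT.val_zero, add_zero, zero_add] at hval
      obtain ⟨k, hkk⟩ : ∃ k, X.k = k + 1 := ⟨X.k - 1, by omega⟩
      simp only [hkk, Nat.add_sub_cancel] at hv hG hE hsz hU he hP hval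
      refine ⟨by rw [hval]; exact hv, ?_, U, l ++ ([] ++ []), 1 + sz + 1 + 1, ?_, ?_, hU, ?_, ?_⟩
      · rw [hval, hkk]
        exact (G_succ_le _ _ _ _).trans hG
      · refine .silent _ _ [] [] _ _ _ ⟨h0, hX.code_lt⟩ hs.emit ?_ ?_ ?_
        · rw [hs.c₁]
          simpa only [hkk, Nat.add_sub_cancel] using hE
        · rw [hs.c₂, Cell.code_zero]
          exact .zero
        · rw [hs.c₃, Cell.code_zero]
          exact .zero
      · rw [hkk]
        nlinarith
      · rw [hval]
        simpa using he
      · intro s₀ h1 h2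
        rw [hkk]
        simpa using! (hP s₀ h1 h2).mono (Nat.le_succ k)
    · obtain rfl := Option.some_injective _ hm
      exact ⟨fun _ => use_planCell hY hX (by omega) (by omega) hU rfl rfl rfl rfl rfl
        ⟨h0, hX.code_lt⟩ hs
        (ih₁.1 rfl) (ih₂.2 rfl) (ih₃.1 rfl), fun h => by omega⟩
    · obtain rfl := Option.some_injective _ hm
      exact ⟨fun h => by omega, fun _ hle => last_hostCell hL (by omega) rfl rfl rfl rfl rfl rfl rfl
        rfl rfl ⟨h0, hX.code_lt⟩ hT.val_zero hs hle⟩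
    · obtain rfl := Option.some_injective _ hm
      exact ⟨fun h => by omega, fun _ _ => group_hostCell hG rfl rfl rfl rfl rfl rfl
        rfl rfl rfl ⟨h0, hX.code_lt⟩ hT.val_zero hs (ih₁.1 rfl) (ih₂.2 rfl)⟩

end SpeedScaling

end

noncomputable section

namespace SpeedScaling

/-! ## Completeness of the table -/

variable {n : ℕ} {I : Instance n} {J : Finset (Fin n)} {w : Fin n → ℕ → ℝ}

lemma time_eq_real (q h l : ℕ) {i : ℕ} (hi : 1 ≤ i) :
    (q : ℝ) + h * ((l : ℝ) / i) = ((q * i + h * l : ℕ) : ℝ) / i := by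
  have : (i : ℝ) ≠ 0 := by positivity
  push_cast
  field_simp

lemma mul_le_of_time_le_time {q h l i q' h' l' i' : ℕ} (hi : 1 ≤ i) (hi' : 1 ≤ i')
    (hle : (q : ℝ) + h * ((l : ℝ) / i) ≤ q' + h' * ((l' : ℝ) / i')) :
    (q * i + h * l) * i' ≤ (q' * i' + h' * l') * i := by
  rw [time_eq_real q h l hi, time_eq_real q' h' l' hi',
    div_le_div_iff₀ (by positivity) (by positivity)] at hle
  exact_mod_cast hle

lemma mul_le_of_time_le {q h l i m : ℕ} (hi : 1 ≤ i)
    (hle : (q : ℝ) + h * ((l : ℝ) / i) ≤ m) : q * i + h * l ≤ m * i := by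
  rw [time_eq_real q h l hi, div_le_iff₀ (by positivity)] at hle
  exact_mod_cast hle

lemma mul_le_of_le_time {q h l i m : ℕ} (hi : 1 ≤ i)
    (hle : (m : ℝ) ≤ q + h * ((l : ℝ) / i)) : m * i ≤ q * i + h * l := by
  rw [time_eq_real q h l hi, le_div_iff₀ (by positivity)] at hle
  exact_mod_cast hle

/-- Identifies the start of the third cell with the slot boundary after the last slot of the job. -/
lemma ceil_time {q h l i m : ℕ} (hi : 1 ≤ i) (hlo : (m : ℝ) < q + h * ((l : ℝ) / i))
    (hhi : (q : ℝ) + h * ((l : ℝ) / i) ≤ (m + 1 : ℕ)) : q + (h * l + i - 1) / i = m + 1 := by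
  have h1 := mul_le_of_time_le hi hhi
  rw [time_eq_real q h l hi, lt_div_iff₀ (by positivity)] at hlo
  have h2 : m * i < q * i + h * l := by exact_mod_cast hlo
  have : (h * l + i - 1 + q * i) / i = (h * l + i - 1) / i + q :=
    Nat.add_mul_div_right _ _ hi
  rw [add_comm, ← this]
  refine Nat.div_eq_of_lt_le ?_ ?_
  · have : (m + 1) * i = m * i + i := by ring
    omega
  · have : (m + 1 + 1) * i = (m + 1) * i + i := by ring
    omega

namespace Cell

/-- The cell of mode `0` with the given entries. -/
def plan (q h l i s u k : ℕ) : Cell := ⟨q, h, l, i, s, 0, 0, 0, u, 0, k⟩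

end Cell

lemma levelEnergy_union {α : ℝ} {A B : Finset (Fin n)} (h : Disjoint A B) :
    levelEnergy I w α (A ∪ B) = levelEnergy I w α A + levelEnergy I w α B :=
  Finset.sum_union h

lemma jobsIn_subset {k a b : ℕ} : jobsIn I J k a b ⊆ J := Finset.filter_subset _ _

lemma card_jobsIn_union {k a b c : ℕ} (hab : a ≤ b) (hbc : b ≤ c) :
    (jobsIn I J k a b).card + (jobsIn I J k b c).card = (jobsIn I J k a c).card := by
  rw [← jobsIn_union hab hbc, Finset.card_union_of_disjoint jobsIn_disjoint]

lemma levelWork_jobsIn_union {k a b c : ℕ} (hab : a ≤ b) (hbc : b ≤ c) (lam : ℝ) :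
    levelWork I w (jobsIn I J k a b) lam + levelWork I w (jobsIn I J k b c) lam =
      levelWork I w (jobsIn I J k a c) lam := by
  rw [← jobsIn_union hab hbc, levelWork_union jobsIn_disjoint]

lemma levelEnergy_jobsIn_union {α : ℝ} {k a b c : ℕ} (hab : a ≤ b) (hbc : b ≤ c) :
    levelEnergy I w α (jobsIn I J k a b) + levelEnergy I w α (jobsIn I J k b c) =
      levelEnergy I w α (jobsIn I J k a c) := by
  rw [← jobsIn_union hab hbc, levelEnergy_union jobsIn_disjoint]

lemma card_le_n (A : Finset (Fin n)) : A.card ≤ n := (Finset.card_le_univ A).trans (by simp)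

lemma jobsIn_succ_of_notMem {j : Fin n} {a b : ℕ} (h : j ∉ jobsIn I J (j + 1) a b) :
    jobsIn I J (j + 1) a b = jobsIn I J j a b := by
  ext x
  simp only [mem_jobsIn]
  constructor
  · rintro ⟨h1, h2, h3⟩
    refine ⟨h1, lt_of_le_of_ne (Nat.lt_succ_iff.1 h2) fun hx => h ?_, h3⟩
    obtain rfl := Fin.ext hx
    exact mem_jobsIn.2 ⟨h1, h2, h3⟩
  · rintro ⟨h1, h2, h3⟩
    exact ⟨h1, by omega, h3⟩

lemma jobsIn_succ_of_mem {j : Fin n} {a b : ℕ} (h : j ∈ jobsIn I J (j + 1) a b) :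
    jobsIn I J (j + 1) a b = insert j (jobsIn I J j a b) ∧ j ∉ jobsIn I J j a b := by
  refine ⟨?_, fun h' => absurd (mem_jobsIn.1 h').2.1 (lt_irrefl _)⟩
  ext x
  rw [Finset.mem_insert, mem_jobsIn, mem_jobsIn]
  constructor
  · rintro ⟨h1, h2, h3⟩
    rcases (Nat.lt_succ_iff.1 h2).eq_or_lt with hx | hx
    · exact Or.inl (Fin.ext hx)
    · exact Or.inr ⟨h1, hx, h3⟩
  · rintro (rfl | ⟨h1, h2, h3⟩)
    · exact mem_jobsIn.1 h
    · exact ⟨h1, by omega, h3⟩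

lemma moveOf_use {α : ℝ} {X : Cell} {Y : Choice} (hm : X.mode ≤ 0) (hu : ¬ X.u ≤ 0)
    (hk : ¬ X.k ≤ 0) (hl : ¬ Y.l ≤ 0) (h : UseOK I X Y) : moveOf I α X Y = some
      { c₁ := ⟨Y.qx, Y.hx, Y.l, Y.i, X.s, 0, 0, 0, Y.u₁, 0, X.k - 1⟩
        c₂ := ⟨Y.qy, Y.hy, Y.l, Y.i, Y.qx, Y.hx, Y.a, Y.h, Y.u₂, 1, X.k - 1⟩
        c₃ := ⟨X.q, X.h, X.l, X.i, Y.qy + (Y.hy * Y.l + Y.i - 1) / Y.i, 0, 0, 0,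
          X.u - Y.u₁ - Y.u₂ - 1, 0, X.k - 1⟩
        weight := ((Y.i : ℝ) / Y.l) ^ α * ((Y.l : ℝ) / Y.i) * I.pOr (X.k - 1) } := by
  rw [moveOf, if_pos hm, if_neg hu, if_neg hk, if_neg hl, if_pos h]

lemma moveOf_last {α : ℝ} {X : Cell} {Y : Choice} (hm : ¬ X.mode ≤ 0) (hu : X.u ≤ 0)
    (h : LastOK n X) : moveOf I α X Y = some
      { emit := 1
        job := X.k
        start := X.s + X.g * ((X.l : ℝ) / X.i)
        finish := X.q + X.h * ((X.l : ℝ) / X.i)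
        speed := (X.i : ℝ) / X.l } := by
  rw [moveOf, if_neg hm, if_pos hu, if_pos h]

lemma moveOf_group {α : ℝ} {X : Cell} {Y : Choice} (hm : ¬ X.mode ≤ 0) (hu : ¬ X.u ≤ 0)
    (h : GroupOK I X Y) : moveOf I α X Y = some
      { c₁ := ⟨I.rOr Y.u₂ + Y.a, Y.h, X.l, X.i, I.rOr Y.u₂, 0, 0, 0, Y.u₁, 0, X.k⟩
        c₂ := ⟨X.q, X.h, X.l, X.i, I.rOr Y.u₂ + Y.a, Y.h, X.a - Y.a, X.b - Y.h, X.u - Y.u₁, 1, X.k⟩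
        emit := 1
        job := X.k
        start := X.s + X.g * ((X.l : ℝ) / X.i)
        finish := I.rOr Y.u₂
        speed := (X.i : ℝ) / X.l } := by
  rw [moveOf, if_neg hm, if_neg hu, if_pos h]

namespace IsEDFOptimal

/-- The jobs of smaller index released by the time job `k` is processed are done. -/
lemma done (hw : IsEDFOptimal I J w) {k : Fin n} {s q : ℕ} (hk : 0 < w k q) {j : Fin n}
    (hj : j ∈ jobsIn I J k s (q + 1)) {q' : ℕ} (h : 0 < w j q') :
    (q' : ℝ) + fracBelow w (j + 1) q' ≤ q + fracBelow w k q := by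
  obtain ⟨-, hjk, -, hr⟩ := mem_jobsIn.1 hj
  have hle : q' ≤ q := by
    by_contra! hlt
    exact h.ne' (hw.finished le_rfl hk hjk (by omega) hlt)
  rcases hle.eq_or_lt with rfl | hlt
  · exact add_le_add le_rfl (hw.fracBelow_mono hjk _)
  · have h1 := hw.fracBelow_le_one (j + 1) q'
    have h2 := hw.fracBelow_nonneg k q
    have h3 : (q' : ℝ) + 1 ≤ q := by exact_mod_cast hlt
    linarith

lemma exists_first (hw : IsEDFOptimal I J w) {j : Fin n} (hj : j ∈ J) :
    ∃ q, 0 < w j q ∧ ∀ q', 0 < w j q' → q ≤ q' := by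
  classical
  have h := hw.exists_pos hj
  exact ⟨Nat.find h, Nat.find_spec h, fun q' hq' => Nat.find_min' h hq'⟩

lemma exists_last (hw : IsEDFOptimal I J w) {j : Fin n} (hj : j ∈ J) :
    ∃ q, 0 < w j q ∧ ∀ q', 0 < w j q' → q' ≤ q := by
  classical
  obtain ⟨q, hq⟩ := hw.exists_pos hj
  refine ⟨Nat.findGreatest (fun q => 0 < w j q) I.L,
    Nat.findGreatest_spec (P := fun q => 0 < w j q) (hw.lt_L hq).le hq,
    fun q' hq' => Nat.le_findGreatest (hw.lt_L hq').le hq'⟩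

/-- Sufficient conditions for a cell of mode `0` to be at most the energy of the jobs it stands
for: they are done by the end of its window. -/
def PlanBound (I : Instance n) (J : Finset (Fin n)) (w : Fin n → ℕ → ℝ) (α : ℝ) (T : Table)
    (k : ℕ) : Prop :=
  ∀ q h l i s T' : ℕ, q ≤ I.L → h ≤ I.P → l ≤ I.L → 1 ≤ i → i ≤ I.P → s ≤ I.L →
    (q : ℝ) + h * ((l : ℝ) / i) ≤ T' →
    (∀ j ∈ jobsIn I J k s T', ∀ q', 0 < w j q' →
      (q' : ℝ) + fracBelow w (j + 1) q' ≤ q + h * ((l : ℝ) / i)) →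
    T.fin ((Cell.plan q h l i s (jobsIn I J k s T').card k).code I) = 1 ∧
    T.val ((Cell.plan q h l i s (jobsIn I J k s T').card k).code I) ≤
      levelEnergy I w α (jobsIn I J k s T')

/-- Induction on the number of jobs that interrupt `k` after slot `qz`. The next group begins at the
earliest of their release dates and ends when `k` resumes, in some slot `q`. The group is handled by
`hC`, and the rest is the same statement with `q` in place of `qz`. -/
lemma hostBound (hw : IsEDFOptimal I J w) {α : ℝ} {T : Table}
    (hT : T.Correct I α (cellCount n I.L I.P)) {k : Fin n} (hC : PlanBound I J w α T k)
    {qy hy q₁ : ℕ} (hqy : qy ≤ I.L) (hhy : hy ≤ I.P) (h₁ : 0 < w k q₁)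
    (hlast : ∀ q, 0 < w k q → q ≤ q₁) {l i : ℕ} (hl : l = levelSlots w (level w k) 0 I.L)
    (hi : i = levelWork I w J (level w k))
    (hycode : (qy : ℝ) + hy * ((l : ℝ) / i) = q₁ + fracBelow w (k + 1) q₁) (u : ℕ) :
    ∀ {qz s g : ℕ}, s ≤ I.L → g ≤ I.P → 0 < w k qz →
      (s : ℝ) + g * ((l : ℝ) / i) = qz + fracBelow w k qz →
      (jobsIn I J k (qz + 1) (q₁ + 1)).card = u →
      ∀ X : Cell, X = ⟨qy, hy, l, i, s, g, otherSlots w (level w k) qz q₁,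
        levelWork I w (jobsIn I J k (qz + 1) (q₁ + 1)) (level w k), u, 1, k⟩ →
      T.fin (X.code I) = 1 ∧
      T.val (X.code I) ≤ levelEnergy I w α (jobsIn I J k (qz + 1) (q₁ + 1)) := by
  classical
  obtain ⟨hkJ, -, -⟩ := hw.support k q₁ h₁
  have hlev := hw.load_eq_level h₁
  have hl1 : 1 ≤ l := by
    rw [hl, ← hlev]
    exact levelSlots_pos (hw.lt_L h₁)
  have hi1 : 1 ≤ i := by
    rw [hi, ← hlev]
    exact hw.levelWork_pos (hw.lt_L h₁) (hw.load_pos h₁)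
  have hlL : l ≤ I.L := hl ▸ levelSlots_le _
  have hiP : i ≤ I.P := hi ▸ levelWork_le_P _ _
  have hother : ∀ a b, b ≤ I.L → otherSlots w (level w k) a b ≤ I.L := fun a b hb =>
    (Finset.card_filter_le _ _).trans (by simp; omega)
  have hq₁L := hw.lt_L h₁
  induction u using Nat.strong_induction_on with
  | _ u ih =>
  intro qz s g hs hg hz hzcode hcard X hX
  have hu : u ≤ n := hcard ▸ card_le_n _
  have hXv : X.Valid I := by
    rw [hX]
    exact ⟨⟨hqy, hhy, hlL, hiP⟩, ⟨hs, hg, hother _ _ hq₁L.le, levelWork_le_P _ _⟩, hu, le_rfl,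
      k.2.le⟩
  have hzq : qz ≤ q₁ := hlast qz hz
  rcases Nat.eq_zero_or_pos u with hu0 | hu0
  · have hempty : jobsIn I J k (qz + 1) (q₁ + 1) = ∅ := Finset.card_eq_zero.1 (hcard.trans hu0)
    -- Without further interruptions `k` runs alone, so both parts of the remaining duration vanish,
    -- as `LastOK` demands.
    have ha : otherSlots w (level w k) qz q₁ = 0 := by
      refine hw.otherSlots_eq_zero hz h₁ le_rfl (Finset.subset_empty.1 (hempty ▸ ?_))
      intro j
      simp only [mem_jobsIn]
      exact fun h => ⟨h.1, h.2.1, h.2.2.1, h.2.2.2.trans (Nat.lt_succ_self _)⟩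
    have hL : LastOK n X := by
      rw [hX]
      refine ⟨⟨ha.le, ?_⟩, k.2, hl1, hi1⟩
      change levelWork I w _ _ ≤ 0
      rw [hempty]
      simp [levelWork]
    have hX1 : ¬ X.mode ≤ 0 := by rw [hX]; simp
    have hX2 : X.u ≤ 0 := by rw [hX]; exact hu0.le
    have hm := moveOf_last (I := I) (α := α) (Y := ⟨0, 0, 0, 0, 0, 0, 0, 0, 0, 0⟩) hX1 hX2 hL
    obtain ⟨hf, hv⟩ := hT.le_total hXv (by simp [Choice.Valid]) hm (by
      simp [Table.Available, Cell.code_zero, hT.fin_zero])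
    refine ⟨hf, hv.trans ?_⟩
    simp [Table.total, Cell.code_zero, hT.val_zero, hempty, levelEnergy]
  -- the group starting with the earliest release date
  obtain ⟨j, hj, hmin⟩ := Finset.exists_min_image (jobsIn I J k (qz + 1) (q₁ + 1)) I.r
    (Finset.card_pos.1 (hcard ▸ hu0))
  obtain ⟨hjJ, hjk, hzj, hjq⟩ := mem_jobsIn.1 hj
  have hex : ∃ q, I.r j ≤ q ∧ 0 < w k q := ⟨q₁, by omega, h₁⟩
  obtain ⟨q, ⟨hsq, hkq⟩, hqmin⟩ : ∃ q, (I.r j ≤ q ∧ 0 < w k q) ∧ ∀ q', I.r j ≤ q' → 0 < w k q' →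
      q ≤ q' := ⟨Nat.find hex, Nat.find_spec hex, fun q' h1 h2 => Nat.find_min' hex ⟨h1, h2⟩⟩
  have hqq : q ≤ q₁ := hlast q hkq
  have hrk := (hw.support k qz hz).2.1
  -- Up to `q` job `k` is waiting by the minimality of `q`. Smaller jobs released before this group
  -- are finished: those released by `qz` because `k` was processed there, and the others would
  -- contradict the minimal release date.
  have hgroup := hw.group (k := k) (s := I.r j) (q := q) (by omega) hsq hkq
    (fun q' h1 h2 => by
      by_contra hne
      have := hqmin q' h1 (lt_of_le_of_ne (hw.nonneg k q') (Ne.symm hne))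
      omega)
    (fun j' hj' hr q' hq' => by
      rcases le_or_gt (I.r j') qz with h | h
      · exact hw.finished le_rfl hz hj' h (by omega)
      · by_contra hne
        have hpos := lt_of_le_of_ne (hw.nonneg j' q') (Ne.symm hne)
        have := hmin j' (mem_jobsIn.2 ⟨(hw.support j' q' hpos).1, hj', h, by omega⟩)
        omega)
  rw [← hl, ← hi] at hgroup
  have hempty : jobsIn I J k (qz + 1) (I.r j) = ∅ := by
    rw [Finset.eq_empty_iff_forall_notMem]
    intro x hx
    obtain ⟨h1, h2, h3, h4⟩ := mem_jobsIn.1 hx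
    have := hmin x (mem_jobsIn.2 ⟨h1, h2, h3, by omega⟩)
    omega
  -- Until the group is released `k` runs alone, so the slots of other loads counted by the digit
  -- `a` all lie after its start.
  have hzero := hw.otherSlots_eq_zero hz h₁ (s := I.r j) (by omega) hempty
  set lam := level w k with hlam
  have hB : jobsIn I J k (qz + 1) (q₁ + 1) = jobsIn I J k (I.r j) (q₁ + 1) := by
    rw [← jobsIn_union (b := I.r j) (by omega) (by omega), hempty, Finset.empty_union]
  have ha : otherSlots w lam qz q₁ = otherSlots w lam (I.r j) q + otherSlots w lam q q₁ := by
    rw [← otherSlots_add lam (b := I.r j) (by omega) (by omega), hzero, zero_add,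
      otherSlots_add lam hsq hqq]
  have hb := levelWork_jobsIn_union (I := I) (J := J) (w := w) (k := k) (a := I.r j) (b := q + 1)
    (c := q₁ + 1) (by omega) (by omega) lam
  have hc := card_jobsIn_union (I := I) (J := J) (k := k) (a := I.r j) (b := q + 1)
    (c := q₁ + 1) (by omega) (by omega)
  have he := levelEnergy_jobsIn_union (I := I) (J := J) (w := w) (α := α) (k := k) (a := I.r j)
    (b := q + 1) (c := q₁ + 1) (by omega) (by omega)
  rw [← hB] at hb hc he
  rw [hcard] at hc
  have hu₁ : 1 ≤ (jobsIn I J k (I.r j) (q + 1)).card :=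
    Finset.card_pos.2 ⟨j, mem_jobsIn.2 ⟨hjJ, hjk, le_rfl, by omega⟩⟩
  have ha' : I.r j + otherSlots w lam (I.r j) q ≤ q := by
    have h1 := levelSlots_add_otherSlots (w := w) lam hsq
    have h2 : (levelSlots w lam (I.r j) q : ℝ) + otherSlots w lam (I.r j) q + I.r j = q := by
      rw [h1]
      ring
    have h3 : levelSlots w lam (I.r j) q + otherSlots w lam (I.r j) q + I.r j = q := by
      exact_mod_cast h2
    omega
  have hgroup' : ((I.r j + otherSlots w lam (I.r j) q : ℕ) : ℝ) +
      levelWork I w (jobsIn I J k (I.r j) (q + 1)) lam * ((l : ℝ) / i) =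
        q + fracBelow w k q := by
    rw [← hgroup]
    push_cast
    rfl
  have hqL := hw.lt_L hkq
  have hfk := hw.fracBelow_le_one k q
  have hrL := (I.r_lt_L j).le
  -- The bound `q + 1` includes the jobs released at `q`: within a slot smaller indices come first,
  -- so they are done before `k` resumes.
  obtain ⟨hf₁, hv₁⟩ := hC (I.r j + otherSlots w lam (I.r j) q)
    (levelWork I w (jobsIn I J k (I.r j) (q + 1)) lam) l i (I.r j) (q + 1) (by omega)
    (levelWork_le_P _ _) hlL hi1 hiP hrL (by rw [hgroup']; push_cast; linarith)
    (fun j' hj' q' h => by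
      rw [hgroup']
      exact hw.done hkq hj' h)
  obtain ⟨hf₂, hv₂⟩ := ih (jobsIn I J k (q + 1) (q₁ + 1)).card (by omega)
    (s := I.r j + otherSlots w lam (I.r j) q)
    (g := levelWork I w (jobsIn I J k (I.r j) (q + 1)) lam) (by omega) (levelWork_le_P _ _) hkq
    hgroup' rfl _ rfl
  have hrj : I.rOr j = I.r j := I.rOr_val j
  have hX1 : ¬ X.mode ≤ 0 := by rw [hX]; simp
  have hX2 : ¬ X.u ≤ 0 := by rw [hX]; exact not_le.2 hu0
  have hG : GroupOK I X ⟨0, 0, 0, 0, 0, 0, otherSlots w lam (I.r j) q,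
      levelWork I w (jobsIn I J k (I.r j) (q + 1)) lam,
      (jobsIn I J k (I.r j) (q + 1)).card, j⟩ := by
    rw [hX]
    dsimp only [GroupOK]
    rw [hrj]
    have hqz : (qz : ℝ) + 1 ≤ I.r j := by exact_mod_cast hzj
    have hq₁r : (I.r j : ℝ) ≤ q₁ := by exact_mod_cast Nat.lt_succ_iff.1 hjq
    have hfz := hw.fracBelow_le_one k qz
    have hf1 := hw.fracBelow_nonneg (k + 1) q₁
    refine ⟨⟨k.2, hl1, hi1⟩, hjk.le, ⟨mul_le_of_time_le hi1 ?_, mul_le_of_le_time hi1 ?_⟩,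
      ⟨by omega, by omega⟩, ⟨?_, by omega⟩, hu₁, by omega⟩
    · rw [hzcode]
      linarith
    · rw [hycode]
      linarith
    · refine Nat.le_of_mul_le_mul_right (mul_le_of_time_le_time hi1 hi1 ?_) hi1
      rw [hgroup', hycode]
      rcases hqq.eq_or_lt with rfl | hlt
      · exact add_le_add le_rfl (hw.fracBelow_mono (Nat.le_succ _) _)
      · have : (q : ℝ) + 1 ≤ q₁ := by exact_mod_cast hlt
        linarith
  have hm := moveOf_group (α := α) hX1 hX2 hG
  simp only [hrj, hX] at hm
  rw [show otherSlots w lam qz q₁ - otherSlots w lam (I.r j) q = otherSlots w lam q q₁ by omega,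
    show levelWork I w (jobsIn I J k (qz + 1) (q₁ + 1)) lam -
      levelWork I w (jobsIn I J k (I.r j) (q + 1)) lam =
      levelWork I w (jobsIn I J k (q + 1) (q₁ + 1)) lam by omega,
    show u - (jobsIn I J k (I.r j) (q + 1)).card = (jobsIn I J k (q + 1) (q₁ + 1)).card by omega]
    at hm
  rw [hX] at hXv ⊢
  obtain ⟨hf, hv⟩ := hT.le_total hXv (by
    refine ⟨⟨?_, ?_, ?_, ?_⟩, ⟨?_, ?_, hother _ _ hqL.le, levelWork_le_P _ _⟩, card_le_n _, ?_⟩ <;>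
    simp [j.2.le]) hm ⟨hf₁.ge, hf₂.ge, by simp [Cell.code_zero, hT.fin_zero]⟩
  refine ⟨hf, hv.trans ?_⟩
  rw [Table.total, ← he]
  simp only [Cell.code_zero, hT.val_zero, add_zero, zero_add]
  exact add_le_add hv₁ hv₂

/-- Induction on the number of jobs allowed. The largest of them is either not among the jobs to be
done, and is dropped, or it runs from slot `q₀` to slot `q₁`. In the latter case the smaller jobs
split by release date into those up to `q₀`, those in `(q₀, q₁]` and those after `q₁`, and the level
energies add up along this splitting. -/
lemma planBound (hw : IsEDFOptimal I J w) {α : ℝ} {T : Table}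
    (hT : T.Correct I α (cellCount n I.L I.P)) (k : ℕ) (hkn : k ≤ n) :
    PlanBound I J w α T k := by
  induction k with
  | zero =>
    intro q h l i s T' hq hh hl hi1 hi hs ht hdone
    have hempty : jobsIn I J 0 s T' = ∅ := by
      rw [Finset.eq_empty_iff_forall_notMem]
      intro x hx
      exact absurd (mem_jobsIn.1 hx).2.1 (Nat.not_lt_zero _)
    rw [hempty, Finset.card_empty]
    have hm : moveOf I α (Cell.plan q h l i s 0 0) ⟨0, 0, 0, 0, 0, 0, 0, 0, 0, 0⟩ = some {} := by
      simp [moveOf, Cell.plan]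
    obtain ⟨hf, hv⟩ := hT.le_total (X := Cell.plan q h l i s 0 0)
      ⟨⟨hq, hh, hl, hi⟩, ⟨hs, by simp [Cell.plan], by simp [Cell.plan], by simp [Cell.plan]⟩,
        by simp [Cell.plan], by simp [Cell.plan], by simp [Cell.plan]⟩ (by simp [Choice.Valid]) hm
      (by simp [Table.Available, Cell.code_zero, hT.fin_zero])
    refine ⟨hf, hv.trans ?_⟩
    simp [Table.total, Cell.code_zero, hT.val_zero, levelEnergy]
  | succ k ih =>
    have ih := ih (by omega)
    intro q h l' i' s T' hq hh hl' hi1' hi' hs ht hdone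
    obtain ⟨j, rfl⟩ : ∃ j : Fin n, k = j := ⟨⟨k, by omega⟩, rfl⟩
    have hXv : (Cell.plan q h l' i' s (jobsIn I J (j + 1) s T').card (j + 1)).Valid I :=
      ⟨⟨hq, hh, hl', hi'⟩, ⟨hs, Nat.zero_le _, Nat.zero_le _, Nat.zero_le _⟩, card_le_n _,
        Nat.zero_le _, hkn⟩
    set X := Cell.plan q h l' i' s (jobsIn I J (j + 1) s T').card (j + 1) with hX
    have hX0 : X.mode ≤ 0 := Nat.zero_le _
    have hXk : ¬ X.k ≤ 0 := by simp [hX, Cell.plan]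
    have hXk1 : X.k - 1 = j := by simp [hX, Cell.plan]
    by_cases hu : X.u ≤ 0
    · have hm : moveOf I α X ⟨0, 0, 0, 0, 0, 0, 0, 0, 0, 0⟩ = some {} := by
        rw [moveOf, if_pos hX0, if_pos hu]
      obtain ⟨hf, hv⟩ := hT.le_total hXv (by simp [Choice.Valid]) hm
        (by simp [Table.Available, Cell.code_zero, hT.fin_zero])
      refine ⟨hf, hv.trans ?_⟩
      simp only [Table.total, Cell.code_zero, hT.val_zero, add_zero]
      exact hw.levelEnergy_nonneg α jobsIn_subset
    by_cases hj : j ∉ jobsIn I J (j + 1) s T'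
    · have hJ := jobsIn_succ_of_notMem hj
      have hm : moveOf I α X ⟨0, 0, 0, 0, 0, 0, 0, 0, 0, 0⟩ =
          some { c₁ := Cell.plan q h l' i' s (jobsIn I J j s T').card j } := by
        rw [moveOf, if_pos hX0, if_neg hu, if_neg hXk, if_pos le_rfl, ← hJ]
        rfl
      obtain ⟨hf₁, hv₁⟩ := ih q h l' i' s T' hq hh hl' hi1' hi' hs ht
        (fun x hx => hdone x (hJ.symm ▸ hx))
      obtain ⟨hf, hv⟩ := hT.le_total hXv (by simp [Choice.Valid]) hm
        ⟨hf₁.ge, by simp [Cell.code_zero, hT.fin_zero], by simp [Cell.code_zero, hT.fin_zero]⟩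
      refine ⟨hf, hv.trans ?_⟩
      simp only [Table.total, Cell.code_zero, hT.val_zero, add_zero, zero_add]
      rwa [hJ]
    rw [not_not] at hj
    obtain ⟨hJ, hjJ⟩ := jobsIn_succ_of_mem hj
    obtain ⟨hjJ', -, hsj, hjT⟩ := mem_jobsIn.1 hj
    obtain ⟨q₀, h₀, hfirst⟩ := hw.exists_first hjJ'
    obtain ⟨q₁, h₁, hlast⟩ := hw.exists_last hjJ'
    have h01 : q₀ ≤ q₁ := hfirst q₁ h₁
    obtain ⟨-, hrq, -⟩ := hw.support j q₀ h₀
    obtain ⟨-, -, hqd⟩ := hw.support j q₁ h₁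
    have hlev₀ := hw.load_eq_level h₀
    have hlev₁ := hw.load_eq_level h₁
    have hspan := hw.span h₀ h₁ hfirst hlast
    -- The start is preceded in slot `q₀` by the indices below `j`, and the end in slot `q₁`
    -- includes `j` itself, hence `j` and `j + 1`.
    obtain ⟨qx, hx, hqxL, hhx, hxcode⟩ := hw.exists_code j (hw.lt_L h₀) (hw.load_pos h₀)
    obtain ⟨qy, hy, hqyL, hhy, hycode⟩ := hw.exists_code (j + 1) (hw.lt_L h₁) (hw.load_pos h₁)
    rw [hlev₀] at hhx hxcode
    rw [hlev₁] at hhy hycode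
    have hl1 : 1 ≤ levelSlots w (level w j) 0 I.L := by
      rw [← hlev₁]
      exact levelSlots_pos (hw.lt_L h₁)
    have hi1 : 1 ≤ levelWork I w J (level w j) := by
      rw [← hlev₁]
      exact hw.levelWork_pos (hw.lt_L h₁) (hw.load_pos h₁)
    have hiP : levelWork I w J (level w j) ≤ I.P := levelWork_le_P _ _
    have hlL : levelSlots w (level w j) 0 I.L ≤ I.L := levelSlots_le _
    have hmul := hw.levelSlots_mul (level w j)
    obtain ⟨l, hl⟩ : ∃ l, l = levelSlots w (level w j) 0 I.L := ⟨_, rfl⟩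
    obtain ⟨i, hi⟩ : ∃ i, i = levelWork I w J (level w j) := ⟨_, rfl⟩
    rw [← hl, ← hi] at hspan hxcode hycode hmul
    rw [← hi] at hhx hhy hi1 hiP
    rw [← hl] at hl1 hlL
    have hq₀L := hw.lt_L h₀
    have hq₁L := hw.lt_L h₁
    have hf₀ := hw.fracBelow_le_one j q₀
    have hf₀' := hw.fracBelow_nonneg j q₀
    have hf₁ := hw.fracBelow_le_one (j + 1) q₁
    have hf₁' : 0 < fracBelow w (j + 1) q₁ := by
      refine div_pos ?_ (hw.load_pos h₁)
      rw [workBelow_succ]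
      exact add_pos_of_nonneg_of_pos (hw.workBelow_nonneg _ _) h₁
    -- The run ends strictly inside slot `q₁` or at its right end, so its ceiling is `q₁ + 1`, which
    -- is where the jobs released later begin.
    have hceil : qy + (hy * l + i - 1) / i = q₁ + 1 :=
      ceil_time hi1 (by rw [hycode]; linarith) (by rw [hycode]; push_cast; linarith)
    have hyt := hdone j hj q₁ h₁
    have hq₁T : q₁ + 1 ≤ T' := by
      have : (q₁ : ℝ) < T' := by linarith
      exact_mod_cast this
    have hother : otherSlots w (level w j) q₀ q₁ ≤ I.L := by
      classical
      exact (Finset.card_filter_le _ _).trans (by simp; omega)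
    obtain ⟨hfA, hvA⟩ := ih qx hx l i s (q₀ + 1) hqxL (hhx.trans hiP) hlL hi1 hiP hs
      (by rw [hxcode]; push_cast; linarith) (fun x hx' q' h => by
        rw [hxcode]
        exact hw.done h₀ hx' h)
    obtain ⟨hfB, hvB⟩ := hw.hostBound hT ih hqyL (hhy.trans hiP) h₁ hlast hl hi hycode _ hqxL
      (hhx.trans hiP) h₀ hxcode rfl _ rfl
    obtain ⟨hfC, hvC⟩ := ih q h l' i' (q₁ + 1) T' hq hh hl' hi1' hi' (by omega) ht
      (fun x hx => hdone x (by
        obtain ⟨h1, h2, h3, h4⟩ := mem_jobsIn.1 hx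
        exact mem_jobsIn.2 ⟨h1, by omega, by omega, h4⟩))
    have hc₁ := card_jobsIn_union (I := I) (J := J) (k := j) (a := s) (b := q₀ + 1)
      (c := T') (by omega) (by omega)
    have hc₂ := card_jobsIn_union (I := I) (J := J) (k := j) (a := q₀ + 1) (b := q₁ + 1)
      (c := T') (by omega) (by omega)
    have he₁ := levelEnergy_jobsIn_union (I := I) (J := J) (w := w) (α := α) (k := j) (a := s)
      (b := q₀ + 1) (c := T') (by omega) (by omega)
    have he₂ := levelEnergy_jobsIn_union (I := I) (J := J) (w := w) (α := α) (k := j)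
      (a := q₀ + 1) (b := q₁ + 1) (c := T') (by omega) (by omega)
    have hc : (jobsIn I J (j + 1) s T').card = (jobsIn I J j s T').card + 1 := by
      rw [hJ, Finset.card_insert_of_notMem hjJ]
    have he : levelEnergy I w α (jobsIn I J (j + 1) s T') =
        level w j ^ (α - 1) * I.p j + levelEnergy I w α (jobsIn I J j s T') := by
      rw [hJ, levelEnergy, Finset.sum_insert hjJ]
      rfl
    have hU : UseOK I X ⟨qy, hy, l, i, qx, hx, otherSlots w (level w j) q₀ q₁,
        levelWork I w (jobsIn I J j (q₀ + 1) (q₁ + 1)) (level w j),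
        (jobsIn I J j s (q₀ + 1)).card, (jobsIn I J j (q₀ + 1) (q₁ + 1)).card⟩ := by
      dsimp only [UseOK]
      rw [hXk1, I.rOr_val, I.dOr_val, I.pOr_val]
      have hq₀' : (q₀ : ℝ) + 1 ≤ I.L := by exact_mod_cast hq₀L
      have hq₁' : (q₁ : ℝ) + 1 ≤ I.L := by exact_mod_cast hq₁L
      have hrq' : (I.r j : ℝ) ≤ q₀ := by exact_mod_cast hrq
      have hqd' : (q₁ : ℝ) + 1 ≤ I.d j := by exact_mod_cast hqd
      refine ⟨⟨hi1', hi1, hhx, hhy⟩, ⟨mul_le_of_time_le hi1 ?_, mul_le_of_time_le hi1 ?_⟩, ?_,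
        ⟨hsj, mul_le_of_le_time hi1 ?_⟩, mul_le_of_time_le hi1 ?_,
        mul_le_of_time_le_time hi1 hi1' ?_, ?_⟩
      · rw [hxcode]
        linarith
      · rw [hycode]
        linarith
      -- The duration formula `hspan` with denominators cleared is the integer equation tested by
      -- `UseOK`.
      · rw [← hycode, ← hxcode, time_eq_real _ _ _ hi1, time_eq_real _ _ _ hi1] at hspan
        have hi0 : (i : ℝ) ≠ 0 := by positivity
        field_simp at hspan
        have : ((qy * i + hy * l : ℕ) : ℝ) = ((qx * i + hx * l +
            (otherSlots w (level w j) q₀ q₁ * i +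
            (I.p j + levelWork I w (jobsIn I J j (q₀ + 1) (q₁ + 1)) (level w j)) * l) : ℕ) :
              ℝ) := by
          push_cast at hspan ⊢
          linarith
        exact_mod_cast this
      · rw [hxcode]
        linarith
      · rw [hycode]
        linarith
      · rw [hycode]
        exact hyt
      · change _ ≤ (jobsIn I J (j + 1) s T').card
        omega
    have hXl : ¬ l ≤ 0 := by omega
    have hm := moveOf_use (α := α) hX0 hu hXk hXl hU
    have hXu : X.u = (jobsIn I J (j + 1) s T').card := rfl
    simp only [hXk1, hceil] at hm
    rw [show X.u - (jobsIn I J j s (q₀ + 1)).card - (jobsIn I J j (q₀ + 1) (q₁ + 1)).card - 1 =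
      (jobsIn I J j (q₁ + 1) T').card by omega] at hm
    obtain ⟨hf, hv⟩ := hT.le_total hXv ⟨⟨hqyL, hhy.trans hiP, hlL, hiP⟩,
      ⟨hqxL, hhx.trans hiP, hother, levelWork_le_P _ _⟩, card_le_n _, card_le_n _⟩ hm
      ⟨hfA.ge, hfB.ge, hfC.ge⟩
    refine ⟨hf, hv.trans ?_⟩
    -- The speed `i / l` equals the level of `j`, so the weight of the move is the level energy of
    -- `j`.
    have hweight : ((i : ℝ) / l) ^ α * ((l : ℝ) / i) * I.pOr j = level w j ^ (α - 1) * I.p j := by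
      rw [I.pOr_val, weight_eq hi1 hl1, ← hmul, mul_div_cancel_right₀]
      exact_mod_cast (Nat.pos_of_ne_zero (by omega) : 0 < l).ne'
    rw [he, ← he₁, ← he₂, ← add_assoc, ← add_assoc, Table.total]
    dsimp only
    rw [hweight]
    exact add_le_add (add_le_add (add_le_add le_rfl hvA) hvB) hvC

end IsEDFOptimal

/-! ### The root cells: table, recursion and least energies agree. -/

/-- The cell for `u` of all jobs in the whole schedule span. -/
def rootCell (I : Instance n) (u : ℕ) : Cell := Cell.plan I.L 0 1 1 0 u n

lemma rootCell_valid {u : ℕ} (hu : u ≤ n) : (rootCell I u).Valid I :=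
  ⟨⟨le_rfl, Nat.zero_le _, I.L_pos, I.P_pos⟩, ⟨Nat.zero_le _, Nat.zero_le _, Nat.zero_le _,
    Nat.zero_le _⟩, hu, Nat.zero_le _, le_rfl⟩

lemma rootCell_hi (u : ℕ) : (rootCell I u).hi = I.L := by
  simp [rootCell, Cell.hi, Cell.plan]

namespace Table.Correct

variable {T : Table} {α : ℝ}

/-- The value of the root is at most the energy of every schedule with enough jobs on time. -/
lemma root_le (hT : T.Correct I α (cellCount n I.L I.P)) (hα : 1 < α) (σ : Schedule n)
    (J : Finset (Fin n)) (hσ : ∀ j ∈ J, I.OnTime σ j) :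
    T.fin ((rootCell I J.card).code I) = 1 ∧
      ENNReal.ofReal (T.val ((rootCell I J.card).code I)) ≤ σ.energy α := by
  obtain ⟨w, hw⟩ := exists_isEDFOptimal I J
  -- Every job is released in `[0, L)`, so the root cell imposes no restriction on `J`.
  have hJ : jobsIn I J n 0 I.L = J := by
    ext j
    rw [mem_jobsIn]
    exact ⟨fun h => h.1, fun h => ⟨h, j.2, Nat.zero_le _, I.r_lt_L j⟩⟩
  obtain ⟨h1, h2⟩ := hw.planBound hT n le_rfl I.L 0 1 1 0 I.L le_rfl (Nat.zero_le _) I.L_pos le_rfl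
    I.P_pos (Nat.zero_le _) (by simp) (fun j _ q' h => by
      have h1 := hw.fracBelow_le_one (j + 1) q'
      have h2 : (q' : ℝ) + 1 ≤ I.L := by exact_mod_cast hw.lt_L h
      simp only [Nat.cast_zero, zero_mul, add_zero]
      linarith)
  rw [hJ] at h1 h2
  exact ⟨h1, (ENNReal.ofReal_le_ofReal h2).trans (hw.levelEnergy_le hα σ hσ)⟩

/-- The table determines the values of the dynamic program. -/
theorem root_spec (hT : T.Correct I α (cellCount n I.L I.P)) (hα : 1 < α) {u : ℕ} (hu : u ≤ n) :
    (1 ≤ T.fin ((rootCell I u).code I) →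
      I.G α n 0 I.L u = ENNReal.ofReal (T.val ((rootCell I u).code I)) ∧
      0 ≤ T.val ((rootCell I u).code I) ∧
      ∃ (U : Finset (Fin n)) (l : List (Piece n)) (sz : ℕ),
        T.Extract (cellCount n I.L I.P) ((rootCell I u).code I) l sz ∧
        sz ≤ 4 + 9 * n * u ∧ U.card = u ∧
        Piece.energy α l = T.val ((rootCell I u).code I) ∧ Plan I n U 0 I.L l) ∧
    (¬ 1 ≤ T.fin ((rootCell I u).code I) → I.G α n 0 I.L u = ⊤) := by
  -- This closes the cycle: a lower bound for the energies of all plans is a lower bound for `G`,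
  -- and by `hroot` the root entry is such a bound. If the root is not finite, no plan exists and
  -- `⊤` is one.
  have hG : ∀ z : ℝ≥0∞, (∀ U l, Plan I n U 0 I.L l → U.card = u →
      z ≤ ENNReal.ofReal (Piece.energy α l)) → z ≤ I.G α n 0 I.L u := by
    intro z hz
    refine le_trans ?_ (optPlan_le_G hα n 0 I.L u (by positivity))
    rw [Rat.cast_zero, Rat.cast_natCast]
    exact le_iInf fun U => le_iInf fun l => le_iInf fun h1 => le_iInf fun h2 => hz U l h1 h2
  have hroot : ∀ U l, Plan I n U 0 I.L l → U.card = u → T.fin ((rootCell I u).code I) = 1 ∧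
      ENNReal.ofReal (T.val ((rootCell I u).code I)) ≤ ENNReal.ofReal (Piece.energy α l) := by
    intro U l hP hU
    have := hT.root_le hα (Piece.toSchedule l) U fun j hj => (hP.onTime_iff j).2 hj
    rwa [hU, hP.chain.energy_toSchedule (by linarith)] at this
  refine ⟨fun hfin => ?_, fun hfin => ?_⟩
  · obtain ⟨hv, hle, U, l, sz, hE, hsz, hU, he, hP⟩ := (hT.sound (rootCell_valid hu) hfin).1 rfl
    refine ⟨le_antisymm ?_ (hG _ fun U l hP hU => (hroot U l hP hU).2), hv, U, l, sz, hE, hsz, hU,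
      he, ?_⟩
    · rw [rootCell_hi] at hle
      simpa using! hle
    · rw [rootCell_hi] at hP
      simpa using! hP 0 (by simp [rootCell, Cell.plan]) (by simp)
  · refine le_antisymm le_top (hG _ fun U l hP hU => ?_)
    exact absurd (hroot U l hP hU).1.ge hfin

end Table.Correct

end SpeedScaling

end

noncomputable section

namespace SpeedScaling

/-! ## Reasoning about programs -/

variable {K : ℕ} {α : ℝ} {S W : ℕ}

/-- Started in `st`, the command halts after at most `B` steps in a state with property `Q`. -/
def Runs (α : ℝ) (S W : ℕ) (c : Cmd K) (st : State K) (B : ℕ) (Q : State K → Prop) : Prop :=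
  ∃ st' T, Exec α S W c st st' T ∧ T ≤ B ∧ Q st'

lemma Runs.mono {c : Cmd K} {st : State K} {B B' : ℕ} {Q Q' : State K → Prop}
    (h : Runs α S W c st B Q) (hB : B ≤ B') (hQ : ∀ st', Q st' → Q' st') :
    Runs α S W c st B' Q' := by
  obtain ⟨st', T, h1, h2, h3⟩ := h
  exact ⟨st', T, h1, h2.trans hB, hQ _ h3⟩

lemma Runs.seq {c₁ c₂ : Cmd K} {st : State K} {B₁ B₂ : ℕ} {Q R : State K → Prop}
    (h₁ : Runs α S W c₁ st B₁ R) (h₂ : ∀ st', R st' → Runs α S W c₂ st' B₂ Q) :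
    Runs α S W (.seq c₁ c₂) st (B₁ + B₂) Q := by
  obtain ⟨st₁, T₁, h1, h2, h3⟩ := h₁
  obtain ⟨st₂, T₂, h4, h5, h6⟩ := h₂ _ h3
  exact ⟨st₂, T₁ + T₂, .seq _ _ _ _ _ _ _ h1 h4, by omega, h6⟩

/-- A loop with a counted invariant. -/
lemma Runs.while {b : BExp K} {c : Cmd K} {B m : ℕ} (Inv : ℕ → State K → Prop)
    (hstep : ∀ i < m, ∀ st, Inv i st →
      (b.Safe α S st ∧ b.Holds α st) ∧ Runs α S W c st B (Inv (i + 1)))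
    (hend : ∀ st, Inv m st → b.Safe α S st ∧ ¬ b.Holds α st) {st : State K} (h0 : Inv 0 st) :
    Runs α S W (.while b c) st (m * (b.cost + 1 + B) + (b.cost + 1)) (Inv m) := by
  have key : ∀ k i, i + k = m → ∀ st, Inv i st →
      Runs α S W (.while b c) st (k * (b.cost + 1 + B) + (b.cost + 1)) (Inv m) := by
    intro k
    induction k with
    | zero =>
      intro i hi st h
      obtain rfl : i = m := by omega
      obtain ⟨h1, h2⟩ := hend st h
      exact ⟨st, _, .whileFalse _ _ _ h1 h2, by omega, h⟩
    | succ k ih =>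
      intro i hi st h
      obtain ⟨⟨h1, h2⟩, st₁, T₁, h3, h4, h5⟩ := hstep i (by omega) st h
      obtain ⟨st₂, T₂, h6, h7, h8⟩ := ih (i + 1) (by omega) st₁ h5
      refine ⟨st₂, _, .whileTrue _ _ _ _ _ _ _ h1 h2 h3 h6, ?_, h8⟩
      rw [Nat.succ_mul]
      omega
  exact key m 0 (by omega) st h0

namespace Cmd

/-- A bound on the number of steps of a command without loops. -/
def bound : Cmd K → ℕ
  | skip => 1
  | iset _ e => e.cost + 1
  | rset _ e => e.cost + 1
  | iput _ idx e => idx.cost + e.cost + 1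
  | rput _ idx e => idx.cost + e.cost + 1
  | seq c₁ c₂ => c₁.bound + c₂.bound
  | ite b c₁ c₂ => b.cost + 1 + (c₁.bound + c₂.bound)
  | .while _ _ => 0

/-- The weakest precondition of a command without loops. -/
def wp (α : ℝ) (S W : ℕ) : Cmd K → (State K → Prop) → State K → Prop
  | skip, Q, st => Q st
  | iset v e, Q, st => e.Safe S st ∧ e.eval st ≤ W ∧ Q (st.setI v (e.eval st))
  | rset v e, Q, st => e.Safe α S st ∧ Q (st.setR v (e.eval α st))
  | iput arr idx e, Q, st => idx.Safe S st ∧ idx.eval st < S ∧ e.Safe S st ∧ e.eval st ≤ W ∧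
      Q (st.putI arr (idx.eval st) (e.eval st))
  | rput arr idx e, Q, st => idx.Safe S st ∧ idx.eval st < S ∧ e.Safe α S st ∧
      Q (st.putR arr (idx.eval st) (e.eval α st))
  | seq c₁ c₂, Q, st => wp α S W c₁ (wp α S W c₂ Q) st
  | ite b c₁ c₂, Q, st => b.Safe α S st ∧ (b.Holds α st → wp α S W c₁ Q st) ∧
      (¬ b.Holds α st → wp α S W c₂ Q st)
  | .while _ _, _, _ => False

/-- Straight-line code is verified by computing its precondition. Loops have precondition `False`,
so their bound `0` does no harm; they are treated by `Runs.while`. -/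
lemma wp_sound (c : Cmd K) {st : State K} {Q : State K → Prop} (h : c.wp α S W Q st) :
    Runs α S W c st c.bound Q := by
  induction c generalizing st Q with
  | skip => exact ⟨_, _, .skip _, le_rfl, h⟩
  | iset v e => exact ⟨_, _, .iset _ _ _ h.1 h.2.1, le_rfl, h.2.2⟩
  | rset v e => exact ⟨_, _, .rset _ _ _ h.1, le_rfl, h.2⟩
  | iput arr idx e =>
    exact ⟨_, _, .iput _ _ _ _ h.1 h.2.1 h.2.2.1 h.2.2.2.1, le_rfl, h.2.2.2.2⟩
  | rput arr idx e => exact ⟨_, _, .rput _ _ _ _ h.1 h.2.1 h.2.2.1, le_rfl, h.2.2.2⟩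
  | seq c₁ c₂ ih₁ ih₂ => exact (ih₁ h).seq fun st' h' => ih₂ h'
  | ite b c₁ c₂ ih₁ ih₂ =>
    obtain ⟨hs, h1, h2⟩ := h
    by_cases hb : b.Holds α st
    · obtain ⟨st', T, h3, h4, h5⟩ := ih₁ (h1 hb)
      exact ⟨st', _, .iteTrue _ _ _ _ _ _ hs hb h3, by simp only [bound]; omega, h5⟩
    · obtain ⟨st', T, h3, h4, h5⟩ := ih₂ (h2 hb)
      exact ⟨st', _, .iteFalse _ _ _ _ _ _ hs hb h3, by simp only [bound]; omega, h5⟩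
  | _ b c => exact h.elim

end Cmd

namespace IExp

/-- The expression for a digit. -/
def digit : List (IExp K) → ℕ → IExp K → IExp K
  | [], _, x => x
  | b :: _, 0, x => mod x b
  | b :: bs, m + 1, x => digit bs m (div x b)

/-- The expression for the number with the given digits. -/
def encode : List (IExp K) → List (IExp K) → IExp K
  | b :: bs, x :: xs => add x (mul b (encode bs xs))
  | _, _ => const 0

/-- The expression for a product. -/
def prod : List (IExp K) → IExp K
  | [] => const 1
  | b :: bs => mul b (prod bs)

variable {st : State K}

lemma eval_digit (bs : List (IExp K)) (m : ℕ) (x : IExp K) : (digit bs m x).eval st =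
    SpeedScaling.digit (bs.map fun b => b.eval st) m (x.eval st) := by
  induction bs generalizing m x with
  | nil => rfl
  | cons b bs ih =>
    cases m with
    | zero => rfl
    | succ m => exact ih _ _

lemma safe_digit {bs : List (IExp K)} (hb : ∀ b ∈ bs, b.Safe S st ∧ b.eval st ≠ 0) (m : ℕ)
    {x : IExp K} (hx : x.Safe S st) : (digit bs m x).Safe S st := by
  induction bs generalizing m x with
  | nil => exact hx
  | cons b bs ih =>
    have h := hb b (by simp)
    cases m with
    | zero => exact ⟨hx, h⟩
    | succ m => exact ih (fun b' hb' => hb b' (by simp [hb'])) _ ⟨hx, h⟩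

lemma eval_encode (bs xs : List (IExp K)) : (encode bs xs).eval st =
    SpeedScaling.encode (bs.map fun b => b.eval st) (xs.map fun x => x.eval st) := by
  induction bs generalizing xs with
  | nil => cases xs <;> rfl
  | cons b bs ih =>
    cases xs with
    | nil => rfl
    | cons x xs => simp [encode, SpeedScaling.encode, eval, ih]

lemma safe_encode {bs xs : List (IExp K)} (hb : ∀ b ∈ bs, b.Safe S st)
    (hx : ∀ x ∈ xs, x.Safe S st) : (encode bs xs).Safe S st := by
  induction bs generalizing xs with
  | nil => cases xs <;> trivial
  | cons b bs ih =>
    cases xs with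
    | nil => trivial
    | cons x xs =>
      exact ⟨hx x (by simp), hb b (by simp), ih (fun b' hb' => hb b' (by simp [hb']))
        fun x' hx' => hx x' (by simp [hx'])⟩

lemma eval_prod (bs : List (IExp K)) :
    (prod bs).eval st = (bs.map fun b => b.eval st).prod := by
  induction bs with
  | nil => rfl
  | cons b bs ih => simp [prod, eval, ih]

lemma safe_prod {bs : List (IExp K)} (hb : ∀ b ∈ bs, b.Safe S st) : (prod bs).Safe S st := by
  induction bs with
  | nil => trivial
  | cons b bs ih => exact ⟨hb b (by simp), ih fun b' hb' => hb b' (by simp [hb'])⟩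

end IExp

end SpeedScaling

end

noncomputable section

namespace SpeedScaling

/-! ## The program for one move -/

section Expressions

variable {K : ℕ} {st : State K} {α : ℝ} {S W : ℕ}

instance : Add (IExp K) := ⟨.add⟩
instance : Sub (IExp K) := ⟨.sub⟩
instance : Mul (IExp K) := ⟨.mul⟩
instance : Div (IExp K) := ⟨.div⟩
instance : Add (RExp K) := ⟨.add⟩
instance : Mul (RExp K) := ⟨.mul⟩
instance : Div (RExp K) := ⟨.div⟩

lemma IExp.eval_sub' (a b : IExp K) : (a - b).eval st = a.eval st - b.eval st := rfl
lemma IExp.eval_div' (a b : IExp K) : (a / b).eval st = a.eval st / b.eval st := rfl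
lemma IExp.safe_sub (a b : IExp K) : (a - b).Safe S st ↔ a.Safe S st ∧ b.Safe S st := Iff.rfl
lemma IExp.safe_div (a b : IExp K) :
    (a / b).Safe S st ↔ a.Safe S st ∧ b.Safe S st ∧ b.eval st ≠ 0 := Iff.rfl
lemma RExp.eval_div' (a b : RExp K) : (a / b).eval α st = a.eval α st / b.eval α st := rfl
lemma RExp.safe_div (a b : RExp K) :
    (a / b).Safe α S st ↔ a.Safe α S st ∧ b.Safe α S st ∧ b.eval α st ≠ 0 := Iff.rfl

/-- The conjunction of a list of tests. -/
def BExp.all : List (BExp K) → BExp K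
  | [] => .ile (.const 0) (.const 0)
  | b :: bs => .and b (all bs)

lemma BExp.holds_all (bs : List (BExp K)) : (all bs).Holds α st ↔ ∀ b ∈ bs, b.Holds α st := by
  induction bs with
  | nil => simp [all, Holds, IExp.eval]
  | cons b bs ih => simp [all, Holds, ih]

lemma BExp.safe_all (bs : List (BExp K)) : (all bs).Safe α S st ↔ ∀ b ∈ bs, b.Safe α S st := by
  induction bs with
  | nil => simp [all, Safe, IExp.Safe]
  | cons b bs ih => simp [all, Safe, ih]

/-- Replaces the index and the stored expression by their known values, so that the states in later
goals stay small. -/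
lemma Cmd.wp_iput {arr : Fin (K + 4)} {idx e : IExp K} {q v : ℕ} {Q : State K → Prop}
    (h1 : idx.Safe S st ∧ idx.eval st = q) (h2 : q < S) (h3 : e.Safe S st ∧ e.eval st = v)
    (h4 : v ≤ W) (h : Q (st.putI arr q v)) : (Cmd.iput arr idx e).wp α S W Q st := by
  obtain ⟨h1, rfl⟩ := h1
  obtain ⟨h3, rfl⟩ := h3
  exact ⟨h1, h2, h3, h4, h⟩

lemma Cmd.wp_rput {arr : Fin (K + 4)} {idx : IExp K} {e : RExp K} {q : ℕ} {v : ℝ}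
    {Q : State K → Prop} (h1 : idx.Safe S st ∧ idx.eval st = q) (h2 : q < S)
    (h3 : e.Safe α S st ∧ e.eval α st = v) (h : Q (st.putR arr q v)) :
    (Cmd.rput arr idx e).wp α S W Q st := by
  obtain ⟨h1, rfl⟩ := h1
  obtain ⟨h3, rfl⟩ := h3
  exact ⟨h1, h2, h3, h⟩

end Expressions

/-- The bases of the digits of a cell, from the registers `0`, `1`, `2` holding `n`, `L`, `P`. -/
def cellBasesE : List (IExp 6) :=
  let n := .reg 0 + .const 1
  let L := .reg 1 + .const 1
  let P := .reg 2 + .const 1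
  [L, P, L, P, L, P, L, P, n, .const 2, n]

/-- The bases of the digits of a choice. -/
def choiceBasesE : List (IExp 6) :=
  let n := .reg 0 + .const 1
  let L := .reg 1 + .const 1
  let P := .reg 2 + .const 1
  [L, P, L, P, L, P, L, P, n, n]

/-- A digit of the current cell, whose index is in register `5`. -/
def cellE (m : ℕ) : IExp 6 := IExp.digit cellBasesE m (.reg 5)

/-- A digit of the current choice, whose index is in register `6`. -/
def choiceE (m : ℕ) : IExp 6 := IExp.digit choiceBasesE m (.reg 6)

/-- The expressions for the components of a move. -/
structure MoveE where
  c₁ : IExp 6 := .const 0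
  c₂ : IExp 6 := .const 0
  c₃ : IExp 6 := .const 0
  emit : IExp 6 := .const 0
  job : IExp 6 := .const 0
  weight : RExp 6 := .ofInt (.const 0)
  start : RExp 6 := .ofInt (.const 0)
  finish : RExp 6 := .ofInt (.const 0)
  speed : RExp 6 := .ofInt (.const 0)

/-- Record a move for the current cell. -/
def store (m : MoveE) : Cmd 6 :=
  .seq (.iput 4 (.reg 5) m.c₁) <| .seq (.iput 5 (.reg 5) m.c₂) <|
  .seq (.iput 6 (.reg 5) m.c₃) <| .seq (.iput 7 (.reg 5) m.emit) <|
  .seq (.iput 8 (.reg 5) m.job) <| .seq (.rput 4 (.reg 5) (.reg 1)) <|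
  .seq (.rput 5 (.reg 5) m.start) <| .seq (.rput 6 (.reg 5) m.finish) <|
  .seq (.rput 7 (.reg 5) m.speed) (.iput 3 (.reg 5) (.const 1))

/-- Record a move for the current cell if it is available and an improvement. -/
def consider (m : MoveE) : Cmd 6 :=
  .ite (.all [.ile (.const 1) (.get 3 m.c₁), .ile (.const 1) (.get 3 m.c₂),
      .ile (.const 1) (.get 3 m.c₃)])
    (.seq (.rset 1 (m.weight + .get 4 m.c₁ + .get 4 m.c₂ + .get 4 m.c₃))
      (.ite (.and (.ile (.const 1) (.get 3 (.reg 5))) (.rle (.get 4 (.reg 5)) (.reg 1)))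
        .skip (store m)))
    .skip

/-- The test for `UseOK`. -/
def useE : BExp 6 :=
  let k := cellE 10 - .const 1
  let x := choiceE 4 * choiceE 3 + choiceE 5 * choiceE 2
  let y := choiceE 0 * choiceE 3 + choiceE 1 * choiceE 2
  let yx := x + (choiceE 6 * choiceE 3 + (.get 2 k + choiceE 7) * choiceE 2)
  .all [.ile (.const 1) (cellE 3), .ile (.const 1) (choiceE 3), .ile (choiceE 5) (choiceE 3),
    .ile (choiceE 1) (choiceE 3), .ile x (.reg 1 * choiceE 3), .ile y (.reg 1 * choiceE 3),
    .ile y yx, .ile yx y, .ile (cellE 4) (.get 0 k), .ile (.get 0 k * choiceE 3) x,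
    .ile y (.get 1 k * choiceE 3),
    .ile (y * cellE 3) ((cellE 0 * cellE 3 + cellE 1 * cellE 2) * choiceE 3),
    .ile (choiceE 8 + choiceE 9 + .const 1) (cellE 8)]

/-- The test for `GroupOK`. -/
def groupE : BExp 6 :=
  let r := .get 0 (choiceE 9)
  let y := cellE 0 * cellE 3 + cellE 1 * cellE 2
  .all [.ile (cellE 10 + .const 1) (.reg 0), .ile (.const 1) (cellE 2), .ile (.const 1) (cellE 3),
    .ile (choiceE 9) (cellE 10), .ile (cellE 4 * cellE 3 + cellE 5 * cellE 2) (r * cellE 3),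
    .ile (r * cellE 3) y, .ile (choiceE 6) (cellE 6), .ile (choiceE 7) (cellE 7),
    .ile ((r + choiceE 6) * cellE 3 + choiceE 7 * cellE 2) y, .ile (r + choiceE 6) (.reg 1),
    .ile (.const 1) (choiceE 8), .ile (choiceE 8) (cellE 8)]

/-- The test for `LastOK`. -/
def lastE : BExp 6 :=
  .all [.ile (cellE 6) (.const 0), .ile (cellE 7) (.const 0),
    .ile (cellE 10 + .const 1) (.reg 0), .ile (.const 1) (cellE 2), .ile (.const 1) (cellE 3)]

/-- The move that does not use the last job. -/
def dropMove : MoveE where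
  c₁ := .encode cellBasesE [cellE 0, cellE 1, cellE 2, cellE 3, cellE 4, cellE 5, cellE 6, cellE 7,
    cellE 8, cellE 9, cellE 10 - .const 1]

/-- The move that uses the last job. -/
def useMove : MoveE where
  c₁ := .encode cellBasesE [choiceE 4, choiceE 5, choiceE 2, choiceE 3, cellE 4, .const 0, .const 0,
    .const 0, choiceE 8, .const 0, cellE 10 - .const 1]
  c₂ := .encode cellBasesE [choiceE 0, choiceE 1, choiceE 2, choiceE 3, choiceE 4, choiceE 5,
    choiceE 6, choiceE 7, choiceE 9, .const 1, cellE 10 - .const 1]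
  c₃ := .encode cellBasesE [cellE 0, cellE 1, cellE 2, cellE 3,
    choiceE 0 + (choiceE 1 * choiceE 2 + choiceE 3 - .const 1) / choiceE 3, .const 0, .const 0,
    .const 0, cellE 8 - choiceE 8 - choiceE 9 - .const 1, .const 0, cellE 10 - .const 1]
  weight := .power (.ofInt (choiceE 3) / .ofInt (choiceE 2)) *
    (.ofInt (choiceE 2) / .ofInt (choiceE 3)) * .ofInt (.get 2 (cellE 10 - .const 1))

/-- The move that ends a job. -/
def lastMove : MoveE where
  emit := .const 1
  job := cellE 10
  start := .ofInt (cellE 4) + .ofInt (cellE 5) * (.ofInt (cellE 2) / .ofInt (cellE 3))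
  finish := .ofInt (cellE 0) + .ofInt (cellE 1) * (.ofInt (cellE 2) / .ofInt (cellE 3))
  speed := .ofInt (cellE 3) / .ofInt (cellE 2)

/-- The move that interrupts a job. -/
def groupMove : MoveE where
  c₁ := .encode cellBasesE [.get 0 (choiceE 9) + choiceE 6, choiceE 7, cellE 2, cellE 3,
    .get 0 (choiceE 9), .const 0, .const 0, .const 0, choiceE 8, .const 0, cellE 10]
  c₂ := .encode cellBasesE [cellE 0, cellE 1, cellE 2, cellE 3, .get 0 (choiceE 9) + choiceE 6,
    choiceE 7, cellE 6 - choiceE 6, cellE 7 - choiceE 7, cellE 8 - choiceE 8, .const 1, cellE 10]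
  emit := .const 1
  job := cellE 10
  start := .ofInt (cellE 4) + .ofInt (cellE 5) * (.ofInt (cellE 2) / .ofInt (cellE 3))
  finish := .ofInt (.get 0 (choiceE 9))
  speed := .ofInt (cellE 3) / .ofInt (cellE 2)

/-- Consider the current choice for the current cell. -/
def tryChoice : Cmd 6 :=
  .ite (.ile (cellE 9) (.const 0))
    (.ite (.ile (cellE 8) (.const 0)) (consider {})
      (.ite (.ile (cellE 10) (.const 0)) .skip
        (.ite (.ile (choiceE 2) (.const 0)) (consider dropMove)
          (.ite useE (consider useMove) .skip))))
    (.ite (.ile (cellE 8) (.const 0)) (.ite lastE (consider lastMove) .skip)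
      (.ite groupE (consider groupMove) .skip))

/-- The table in the memory. -/
def tableOf (st : State 6) : Table where
  fin := st.iarr 3
  c₁ := st.iarr 4
  c₂ := st.iarr 5
  c₃ := st.iarr 6
  emit := st.iarr 7
  job := st.iarr 8
  val := st.rarr 4
  start := st.rarr 5
  finish := st.rarr 6
  speed := st.rarr 7

variable {n : ℕ}

/-- The memory holds the instance, the sizes of the table, and the indices `x` of the current
cell and `c` of the current choice. -/
structure Ready (I : Instance n) (E : ℝ) (x c : ℕ) (st : State 6) : Prop where
  reg_n : st.ireg 0 = n
  reg_L : st.ireg 1 = I.L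
  reg_P : st.ireg 2 = I.P
  reg_cells : st.ireg 3 = cellCount n I.L I.P
  reg_choices : st.ireg 4 = choiceCount n I.L I.P
  reg_cell : st.ireg 5 = x
  reg_choice : st.ireg 6 = c
  reg_E : st.rreg 0 = E
  arr_r : st.iarr 0 = I.rOr
  arr_d : st.iarr 1 = I.dOr
  arr_p : st.iarr 2 = I.pOr

variable {I : Instance n} {E : ℝ} {x c : ℕ} {st : State 6} {S W : ℕ} {α : ℝ}

namespace Ready

lemma putI (h : Ready I E x c st) {arr : Fin 10} (ha : 3 ≤ arr) (q v : ℕ) :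
    Ready I E x c (st.putI arr q v) where
  reg_n := h.reg_n
  reg_L := h.reg_L
  reg_P := h.reg_P
  reg_cells := h.reg_cells
  reg_choices := h.reg_choices
  reg_cell := h.reg_cell
  reg_choice := h.reg_choice
  reg_E := h.reg_E
  arr_r := (Function.update_of_ne (by rintro rfl; exact absurd ha (by decide)) _ _).trans h.arr_r
  arr_d := (Function.update_of_ne (by rintro rfl; exact absurd ha (by decide)) _ _).trans h.arr_d
  arr_p := (Function.update_of_ne (by rintro rfl; exact absurd ha (by decide)) _ _).trans h.arr_p

lemma putR (h : Ready I E x c st) (arr : Fin 10) (q : ℕ) (v : ℝ) :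
    Ready I E x c (st.putR arr q v) where
  __ := h

lemma setR (h : Ready I E x c st) (v : ℝ) : Ready I E x c (st.setR 1 v) where
  __ := h
  reg_E := h.reg_E

lemma eval_cellBasesE (h : Ready I E x c st) :
    cellBasesE.map (fun b => b.eval st) = cellBases n I.L I.P := by
  simp [cellBasesE, cellBases, IExp.eval, h.reg_n, h.reg_L, h.reg_P]

lemma eval_choiceBasesE (h : Ready I E x c st) :
    choiceBasesE.map (fun b => b.eval st) = choiceBases n I.L I.P := by
  simp [choiceBasesE, choiceBases, IExp.eval, h.reg_n, h.reg_L, h.reg_P]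

lemma eval_cellE (h : Ready I E x c st) (m : ℕ) :
    (cellE m).eval st = digit (cellBases n I.L I.P) m x := by
  rw [cellE, IExp.eval_digit, h.eval_cellBasesE, IExp.eval, h.reg_cell]

lemma eval_choiceE (h : Ready I E x c st) (m : ℕ) :
    (choiceE m).eval st = digit (choiceBases n I.L I.P) m c := by
  rw [choiceE, IExp.eval_digit, h.eval_choiceBasesE, IExp.eval, h.reg_choice]

end Ready

lemma safe_cellBasesE (st : State 6) : ∀ b ∈ cellBasesE, b.Safe S st ∧ b.eval st ≠ 0 := by
  simp [cellBasesE, IExp.Safe, IExp.eval]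

lemma safe_choiceBasesE (st : State 6) : ∀ b ∈ choiceBasesE, b.Safe S st ∧ b.eval st ≠ 0 := by
  simp [choiceBasesE, IExp.Safe, IExp.eval]

lemma safe_cellE (st : State 6) (m : ℕ) : (cellE m).Safe S st :=
  IExp.safe_digit (safe_cellBasesE st) m trivial

lemma safe_choiceE (st : State 6) (m : ℕ) : (choiceE m).Safe S st :=
  IExp.safe_digit (safe_choiceBasesE st) m trivial

/-- The expressions of `me` evaluate to the components of `m`. -/
def MoveE.Denotes (me : MoveE) (I : Instance n) (E α : ℝ) (x c S : ℕ) (m : Move) : Prop :=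
  ∀ st : State 6, Ready I E x c st →
    ((me.c₁.Safe S st ∧ me.c₁.eval st = m.c₁.code I) ∧
      (me.c₂.Safe S st ∧ me.c₂.eval st = m.c₂.code I) ∧
      (me.c₃.Safe S st ∧ me.c₃.eval st = m.c₃.code I)) ∧
    ((me.emit.Safe S st ∧ me.emit.eval st = m.emit) ∧
      (me.job.Safe S st ∧ me.job.eval st = m.job)) ∧
    (me.weight.Safe α S st ∧ me.weight.eval α st = m.weight) ∧
    (me.start.Safe α S st ∧ me.start.eval α st = m.start) ∧
    (me.finish.Safe α S st ∧ me.finish.eval α st = m.finish) ∧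
    (me.speed.Safe α S st ∧ me.speed.eval α st = m.speed)

/-- The effect of considering a move for the entry `x`. -/
def Table.Step (T T' : Table) (I : Instance n) (x : ℕ) : Option Move → Prop
  | none => T' = T
  | some m => (¬ T.Available I m ∧ T' = T) ∨
      (T.Available I m ∧ 1 ≤ T.fin x ∧ T.val x ≤ T.total I m ∧ T' = T) ∨
      (T.Available I m ∧ ¬ (1 ≤ T.fin x ∧ T.val x ≤ T.total I m) ∧
        ∃ v, v = T.total I m ∧ T' =
          { fin := Function.update T.fin x 1
            c₁ := Function.update T.c₁ x (m.c₁.code I)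
            c₂ := Function.update T.c₂ x (m.c₂.code I)
            c₃ := Function.update T.c₃ x (m.c₃.code I)
            emit := Function.update T.emit x m.emit
            job := Function.update T.job x m.job
            val := Function.update T.val x v
            start := Function.update T.start x m.start
            finish := Function.update T.finish x m.finish
            speed := Function.update T.speed x m.speed })

/-- The expressions are evaluated while earlier writes have already changed the entry. This is
harmless: the writes leave the instance and the registers of `Ready` alone, and `Denotes` holds in
every ready state. The total is computed beforehand and kept in a register. -/
lemma consider_wp {me : MoveE} {m : Move} (hm : me.Denotes I E α x c S m)
    (h : Ready I E x c st) (hx : x < S) (h₁ : m.c₁.code I < S ∧ m.c₁.code I ≤ W)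
    (h₂ : m.c₂.code I < S ∧ m.c₂.code I ≤ W) (h₃ : m.c₃.code I < S ∧ m.c₃.code I ≤ W)
    (hemit : m.emit ≤ W) (hjob : m.job ≤ W) (hW : 1 ≤ W) :
    (consider me).wp α S W
      (fun st' => Ready I E x c st' ∧ (tableOf st).Step (tableOf st') I x (some m)) st := by
  obtain ⟨⟨⟨s₁, e₁⟩, ⟨s₂, e₂⟩, s₃, e₃⟩, -, ⟨sw, ew⟩, -⟩ := hm st h
  have havail : (BExp.all [.ile (.const 1) (.get 3 me.c₁), .ile (.const 1) (.get 3 me.c₂),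
      .ile (.const 1) (.get 3 me.c₃)] : BExp 6).Holds α st ↔ (tableOf st).Available I m := by
    simp only [BExp.holds_all, List.mem_cons, List.not_mem_nil, or_false, forall_eq_or_imp,
      forall_eq, BExp.Holds, IExp.eval, e₁, e₂, e₃]
    rfl
  refine ⟨?_, fun hb => ?_, fun hb => ⟨h, Or.inl ⟨fun ha => hb (havail.2 ha), rfl⟩⟩⟩
  · simp [BExp.safe_all, BExp.Safe, IExp.Safe, s₁, s₂, s₃, e₁, e₂, e₃, h₁.1, h₂.1, h₃.1]
  have ha := havail.1 hb
  refine ⟨?_, ?_⟩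
  · simp [RExp.Safe, s₁, s₂, s₃, e₁, e₂, e₃, h₁.1, h₂.1, h₃.1, sw]
  have htot : (me.weight + .get 4 me.c₁ + .get 4 me.c₂ + .get 4 me.c₃ : RExp 6).eval α st =
      (tableOf st).total I m := by
    simp only [RExp.eval, e₁, e₂, e₃, ew]
    rfl
  rw [htot]
  have h' := h.setR ((tableOf st).total I m)
  have hcmp : (BExp.and (.ile (.const 1) (.get 3 (.reg 5))) (.rle (.get 4 (.reg 5)) (.reg 1)) :
      BExp 6).Holds α (st.setR 1 ((tableOf st).total I m)) ↔
        (1 ≤ (tableOf st).fin x ∧ (tableOf st).val x ≤ (tableOf st).total I m) := by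
    simp only [BExp.Holds, IExp.eval, RExp.eval, h'.reg_cell]
    rfl
  refine ⟨?_, fun hb => ⟨h', Or.inr (Or.inl ⟨ha, (hcmp.1 hb).1, (hcmp.1 hb).2, rfl⟩)⟩,
    fun hb => ?_⟩
  · simp [BExp.Safe, IExp.Safe, RExp.Safe, IExp.eval, h'.reg_cell, hx]
  have hb' := fun hh => hb (hcmp.2 hh)
  -- From here on the total is a fixed number, unaffected by the writes to the table.
  generalize hv : (tableOf st).total I m = v at h' hb'
  have key : ∀ st', Ready I E x c st' →
      (IExp.reg 5 : IExp 6).Safe S st' ∧ (IExp.reg 5 : IExp 6).eval st' = x :=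
    fun st' h => ⟨trivial, h.reg_cell⟩
  have r₀ := h'
  have r₁ := r₀.putI (arr := 4) (by decide) x (m.c₁.code I)
  have r₂ := r₁.putI (arr := 5) (by decide) x (m.c₂.code I)
  have r₃ := r₂.putI (arr := 6) (by decide) x (m.c₃.code I)
  have r₄ := r₃.putI (arr := 7) (by decide) x m.emit
  have r₅ := r₄.putI (arr := 8) (by decide) x m.job
  have r₆ := r₅.putR 4 x v
  have r₇ := r₆.putR 5 x m.start
  have r₈ := r₇.putR 6 x m.finish
  have r₉ := r₈.putR 7 x m.speed
  have r₁₀ := r₉.putI (arr := 3) (by decide) x 1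
  refine Cmd.wp_iput (α := α) (key _ r₀) hx (hm _ r₀).1.1 h₁.2 ?_
  refine Cmd.wp_iput (α := α) (key _ r₁) hx (hm _ r₁).1.2.1 h₂.2 ?_
  refine Cmd.wp_iput (α := α) (key _ r₂) hx (hm _ r₂).1.2.2 h₃.2 ?_
  refine Cmd.wp_iput (α := α) (key _ r₃) hx (hm _ r₃).2.1.1 hemit ?_
  refine Cmd.wp_iput (α := α) (key _ r₄) hx (hm _ r₄).2.1.2 hjob ?_
  refine Cmd.wp_rput (W := W) (key _ r₅) hx (v := v) ⟨trivial, rfl⟩ ?_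
  refine Cmd.wp_rput (W := W) (key _ r₆) hx (hm _ r₆).2.2.2.1 ?_
  refine Cmd.wp_rput (W := W) (key _ r₇) hx (hm _ r₇).2.2.2.2.1 ?_
  refine Cmd.wp_rput (W := W) (key _ r₈) hx (hm _ r₈).2.2.2.2.2 ?_
  refine Cmd.wp_iput (α := α) (key _ r₉) hx (v := 1) ⟨trivial, rfl⟩ hW ?_
  refine ⟨r₁₀, Or.inr (Or.inr ⟨ha, by rwa [hv], v, hv.symm, ?_⟩)⟩
  rfl

end SpeedScaling

end

noncomputable section

namespace SpeedScaling

/-! ## Correctness of the program for one move -/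

variable {n : ℕ} {I : Instance n} {E : ℝ} {x c : ℕ} {st : State 6} {S W : ℕ} {α : ℝ}

lemma Ready.eval_code (h : Ready I E x c st) (xs : List (IExp 6)) :
    (IExp.encode cellBasesE xs).eval st =
      encode (cellBases n I.L I.P) (xs.map fun e => e.eval st) := by
  rw [IExp.eval_encode, h.eval_cellBasesE]

lemma safe_code {xs : List (IExp 6)} (hx : ∀ e ∈ xs, e.Safe S st) :
    (IExp.encode cellBasesE xs).Safe S st :=
  IExp.safe_encode (fun b hb => (safe_cellBasesE st b hb).1) hx

lemma digit_k_le (x : ℕ) : digit (cellBases n I.L I.P) 10 x ≤ n := by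
  have := (Cell.decode_valid (I := I) x).2.2.2.2
  simpa only [Cell.decode] using this

lemma digit_u₂_le (c : ℕ) : digit (choiceBases n I.L I.P) 9 c ≤ n := by
  have := (Choice.decode_valid (I := I) c).2.2.2
  simpa only [Choice.decode] using this

namespace Ready

/-- The machine tests only `≤`, so the equation between the two times is checked by two
inequalities. -/
lemma useE_iff (h : Ready I E x c st) :
    useE.Holds α st ↔ UseOK I (Cell.decode I x) (Choice.decode I c) := by
  simp only [useE, BExp.holds_all, List.mem_cons, List.not_mem_nil, or_false, forall_eq_or_imp,
    forall_eq, BExp.Holds, IExp.eval, IExp.eval_sub', h.eval_cellE, h.eval_choiceE, h.arr_r,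
    h.arr_d, h.arr_p,
    h.reg_L, UseOK, Cell.decode, Choice.decode, and_assoc, le_antisymm_iff]

lemma groupE_iff (h : Ready I E x c st) :
    groupE.Holds α st ↔ GroupOK I (Cell.decode I x) (Choice.decode I c) := by
  simp only [groupE, BExp.holds_all, List.mem_cons, List.not_mem_nil, or_false, forall_eq_or_imp,
    forall_eq, BExp.Holds, IExp.eval, h.eval_cellE, h.eval_choiceE, h.arr_r, h.reg_n,
    h.reg_L, GroupOK, Cell.decode, Choice.decode, and_assoc]

lemma lastE_iff (h : Ready I E x c st) :
    lastE.Holds α st ↔ LastOK n (Cell.decode I x) := by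
  simp only [lastE, BExp.holds_all, List.mem_cons, List.not_mem_nil, or_false, forall_eq_or_imp,
    forall_eq, BExp.Holds, IExp.eval, h.eval_cellE, h.reg_n, LastOK, Cell.decode, and_assoc]

lemma cellE_le_zero (h : Ready I E x c st) (m : ℕ) :
    (BExp.ile (cellE m) (.const 0)).Holds α st ↔ digit (cellBases n I.L I.P) m x ≤ 0 := by
  rw [BExp.Holds, h.eval_cellE, IExp.eval]

lemma useE_safe (h : Ready I E x c st) (hS : n < S) : useE.Safe α S st := by
  have hk : digit (cellBases n I.L I.P) 10 x - 1 < S :=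
    (Nat.sub_le _ _).trans_lt ((digit_k_le x).trans_lt hS)
  simp [useE, BExp.safe_all, BExp.Safe, IExp.Safe, IExp.safe_sub, IExp.eval, IExp.eval_sub',
    h.eval_cellE, safe_cellE,
    safe_choiceE, hk]

lemma groupE_safe (h : Ready I E x c st) (hS : n < S) : groupE.Safe α S st := by
  have hk : digit (choiceBases n I.L I.P) 9 c < S := (digit_u₂_le c).trans_lt hS
  simp [groupE, BExp.safe_all, BExp.Safe, IExp.Safe, h.eval_choiceE, safe_cellE,
    safe_choiceE, hk]

end Ready

lemma lastE_safe : lastE.Safe α S st := by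
  simp [lastE, BExp.safe_all, BExp.Safe, IExp.Safe, safe_cellE]

lemma empty_denotes : MoveE.Denotes {} I E α x c S {} := by
  intro st h
  simp [IExp.Safe, IExp.eval, RExp.Safe, RExp.eval, Cell.code_zero]

lemma dropMove_denotes : dropMove.Denotes I E α x c S
    { c₁ := { Cell.decode I x with k := (Cell.decode I x).k - 1 } } := by
  intro st h
  refine ⟨⟨⟨safe_code ?_, ?_⟩, ?_⟩, ?_⟩
  · simp [IExp.Safe, IExp.safe_sub, safe_cellE]
  · simp only [dropMove, h.eval_code, List.map_cons, List.map_nil, h.eval_cellE, IExp.eval,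
      IExp.eval_sub',
      Cell.code, Cell.decode]
  · simp [dropMove, IExp.Safe, IExp.eval, Cell.code_zero]
  · simp [dropMove, IExp.Safe, IExp.eval, RExp.Safe, RExp.eval]

lemma useMove_denotes (hS : n < S) (hl : ¬ (Choice.decode I c).l ≤ 0)
    (hU : UseOK I (Cell.decode I x) (Choice.decode I c)) : useMove.Denotes I E α x c S
      { c₁ := ⟨(Choice.decode I c).qx, (Choice.decode I c).hx, (Choice.decode I c).l,
          (Choice.decode I c).i, (Cell.decode I x).s, 0, 0, 0, (Choice.decode I c).u₁, 0,
          (Cell.decode I x).k - 1⟩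
        c₂ := ⟨(Choice.decode I c).qy, (Choice.decode I c).hy, (Choice.decode I c).l,
          (Choice.decode I c).i, (Choice.decode I c).qx, (Choice.decode I c).hx,
          (Choice.decode I c).a, (Choice.decode I c).h, (Choice.decode I c).u₂, 1,
          (Cell.decode I x).k - 1⟩
        c₃ := ⟨(Cell.decode I x).q, (Cell.decode I x).h, (Cell.decode I x).l, (Cell.decode I x).i,
          (Choice.decode I c).qy + ((Choice.decode I c).hy * (Choice.decode I c).l +
            (Choice.decode I c).i - 1) / (Choice.decode I c).i, 0, 0, 0,
          (Cell.decode I x).u - (Choice.decode I c).u₁ - (Choice.decode I c).u₂ - 1, 0,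
          (Cell.decode I x).k - 1⟩
        weight := (((Choice.decode I c).i : ℝ) / (Choice.decode I c).l) ^ α *
          (((Choice.decode I c).l : ℝ) / (Choice.decode I c).i) *
          I.pOr ((Cell.decode I x).k - 1) } := by
  intro st h
  have hk : digit (cellBases n I.L I.P) 10 x - 1 < S :=
    (Nat.sub_le _ _).trans_lt ((digit_k_le x).trans_lt hS)
  have hi : digit (choiceBases n I.L I.P) 3 c ≠ 0 := by
    have := hU.1.2.1
    simp only [Choice.decode] at this
    omega
  have hl : digit (choiceBases n I.L I.P) 2 c ≠ 0 := by
    simp only [Choice.decode] at hl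
    omega
  refine ⟨⟨⟨safe_code ?_, ?_⟩, ⟨safe_code ?_, ?_⟩, safe_code ?_, ?_⟩, ?_, ⟨?_, ?_⟩, ?_⟩
  · simp [IExp.Safe, IExp.safe_sub, safe_cellE, safe_choiceE]
  · simp only [useMove, h.eval_code, List.map_cons, List.map_nil, h.eval_cellE, h.eval_choiceE,
      IExp.eval, IExp.eval_sub', Cell.code, Cell.decode, Choice.decode]
  · simp [IExp.Safe, IExp.safe_sub, safe_cellE, safe_choiceE]
  · simp only [useMove, h.eval_code, List.map_cons, List.map_nil, h.eval_cellE, h.eval_choiceE,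
      IExp.eval, IExp.eval_sub', Cell.code, Cell.decode, Choice.decode]
  · simp [IExp.Safe, IExp.safe_sub, IExp.safe_div, safe_cellE, safe_choiceE, h.eval_choiceE, hi]
  · simp only [useMove, h.eval_code, List.map_cons, List.map_nil, h.eval_cellE, h.eval_choiceE,
      IExp.eval, IExp.eval_sub', IExp.eval_div', Cell.code, Cell.decode, Choice.decode]
  · simp [useMove, IExp.Safe, IExp.eval]
  · simp only [useMove, RExp.Safe, RExp.safe_div, IExp.Safe, IExp.safe_sub, safe_cellE,
      safe_choiceE, RExp.eval, RExp.eval_div', IExp.eval, IExp.eval_sub',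
      h.eval_choiceE, h.eval_cellE, true_and, and_true, ne_eq, Nat.cast_eq_zero, hi, hl,
      not_false_eq_true, hk]
    positivity
  · simp only [useMove, RExp.eval, RExp.eval_div', IExp.eval, IExp.eval_sub', h.eval_choiceE,
      h.eval_cellE, h.arr_p, Cell.decode,
      Choice.decode]
  · simp [useMove, RExp.Safe, IExp.Safe, RExp.eval, IExp.eval]

lemma lastMove_denotes (hL : LastOK n (Cell.decode I x)) : lastMove.Denotes I E α x c S
      { emit := 1
        job := (Cell.decode I x).k
        start := (Cell.decode I x).s + (Cell.decode I x).g *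
          (((Cell.decode I x).l : ℝ) / (Cell.decode I x).i)
        finish := (Cell.decode I x).q + (Cell.decode I x).h *
          (((Cell.decode I x).l : ℝ) / (Cell.decode I x).i)
        speed := ((Cell.decode I x).i : ℝ) / (Cell.decode I x).l } := by
  intro st h
  have hl : digit (cellBases n I.L I.P) 2 x ≠ 0 := by
    have := hL.2.2.1
    simp only [Cell.decode] at this
    omega
  have hi : digit (cellBases n I.L I.P) 3 x ≠ 0 := by
    have := hL.2.2.2
    simp only [Cell.decode] at this
    omega
  refine ⟨?_, ?_⟩
  · simp [lastMove, IExp.Safe, IExp.eval, Cell.code_zero]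
  · simp [lastMove, RExp.Safe, RExp.safe_div, IExp.Safe, safe_cellE, RExp.eval, RExp.eval_div',
      IExp.eval, h.eval_cellE,
      Cell.decode, hl, hi]

lemma groupMove_denotes (hS : n < S) (hG : GroupOK I (Cell.decode I x) (Choice.decode I c)) :
    groupMove.Denotes I E α x c S
      { c₁ := ⟨I.rOr (Choice.decode I c).u₂ + (Choice.decode I c).a, (Choice.decode I c).h,
          (Cell.decode I x).l, (Cell.decode I x).i, I.rOr (Choice.decode I c).u₂, 0, 0, 0,
          (Choice.decode I c).u₁, 0, (Cell.decode I x).k⟩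
        c₂ := ⟨(Cell.decode I x).q, (Cell.decode I x).h, (Cell.decode I x).l, (Cell.decode I x).i,
          I.rOr (Choice.decode I c).u₂ + (Choice.decode I c).a, (Choice.decode I c).h,
          (Cell.decode I x).a - (Choice.decode I c).a, (Cell.decode I x).b - (Choice.decode I c).h,
          (Cell.decode I x).u - (Choice.decode I c).u₁, 1, (Cell.decode I x).k⟩
        emit := 1
        job := (Cell.decode I x).k
        start := (Cell.decode I x).s + (Cell.decode I x).g *
          (((Cell.decode I x).l : ℝ) / (Cell.decode I x).i)
        finish := I.rOr (Choice.decode I c).u₂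
        speed := ((Cell.decode I x).i : ℝ) / (Cell.decode I x).l } := by
  intro st h
  have hk : digit (choiceBases n I.L I.P) 9 c < S := (digit_u₂_le c).trans_lt hS
  have hl : digit (cellBases n I.L I.P) 2 x ≠ 0 := by
    have := hG.1.2.1
    simp only [Cell.decode] at this
    omega
  have hi : digit (cellBases n I.L I.P) 3 x ≠ 0 := by
    have := hG.1.2.2
    simp only [Cell.decode] at this
    omega
  refine ⟨⟨⟨safe_code ?_, ?_⟩, ⟨safe_code ?_, ?_⟩, ?_⟩, ?_⟩
  · simp [IExp.Safe, safe_cellE, safe_choiceE, h.eval_choiceE, hk]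
  · simp only [groupMove, h.eval_code, List.map_cons, List.map_nil, h.eval_cellE, h.eval_choiceE,
      IExp.eval, Cell.code, Cell.decode, Choice.decode, h.arr_r]
  · simp [IExp.Safe, IExp.safe_sub, safe_cellE, safe_choiceE, h.eval_choiceE, hk]
  · simp only [groupMove, h.eval_code, List.map_cons, List.map_nil, h.eval_cellE, h.eval_choiceE,
      IExp.eval, IExp.eval_sub', Cell.code, Cell.decode, Choice.decode, h.arr_r]
  · simp [groupMove, IExp.Safe, IExp.eval, Cell.code_zero]
  · simp [groupMove, RExp.Safe, RExp.safe_div, IExp.Safe, safe_cellE, safe_choiceE, RExp.eval,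
      RExp.eval_div', IExp.eval,
      h.eval_cellE, h.eval_choiceE, h.arr_r, Cell.decode, Choice.decode, hl, hi, hk]

lemma moveOf_emit_job {X : Cell} {Y : Choice} {m : Move} (hX : X.Valid I)
    (h : moveOf I α X Y = some m) : m.emit ≤ 1 ∧ m.job ≤ n := by
  have hk := hX.2.2.2.2
  rw [moveOf] at h
  split_ifs at h <;> obtain rfl := Option.some_injective _ h <;> simp [hk]

/-- The effect of trying one choice for the current cell. -/
lemma tryChoice_wp (h : Ready I E x c st) (h0 : 0 < x) (hx : x < cellCount n I.L I.P) (hn : n < S)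
    (hS : cellCount n I.L I.P ≤ S) (hW : cellCount n I.L I.P ≤ W) (hnW : n ≤ W) :
    tryChoice.wp α S W (fun st' => Ready I E x c st' ∧ (tableOf st).Step (tableOf st') I x
      (moveOf I α (Cell.decode I x) (Choice.decode I c))) st := by
  have hX := Cell.decode_valid (I := I) x
  have hxc := Cell.code_decode (I := I) hx
  -- Children have codes below `x`, which keeps every table access in bounds and every stored word
  -- small.
  have key : ∀ (me : MoveE) (m : Move), me.Denotes I E α x c S m →
      moveOf I α (Cell.decode I x) (Choice.decode I c) = some m →
      (consider me).wp α S W (fun st' => Ready I E x c st' ∧ (tableOf st).Step (tableOf st') I x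
        (moveOf I α (Cell.decode I x) (Choice.decode I c))) st := by
    intro me m hm he
    rw [he]
    obtain ⟨⟨-, h1⟩, ⟨-, h2⟩, -, h3⟩ := moveOf_children hX (Choice.decode_valid c) he
      (by rw [hxc]; omega)
    rw [hxc] at h1 h2 h3
    obtain ⟨h4, h5⟩ := moveOf_emit_job hX he
    exact consider_wp hm h (hx.trans_le hS) ⟨by omega, by omega⟩ ⟨by omega, by omega⟩
      ⟨by omega, by omega⟩ (by omega) (by omega) (by omega)
  have hmode : digit (cellBases n I.L I.P) 9 x = (Cell.decode I x).mode := by rw [Cell.decode]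
  have hu : digit (cellBases n I.L I.P) 8 x = (Cell.decode I x).u := by rw [Cell.decode]
  have hk : digit (cellBases n I.L I.P) 10 x = (Cell.decode I x).k := by rw [Cell.decode]
  have hl : digit (choiceBases n I.L I.P) 2 c = (Choice.decode I c).l := by rw [Choice.decode]
  have safe : ∀ m, (BExp.ile (cellE m) (.const 0)).Safe α S st :=
    fun m => ⟨safe_cellE st m, trivial⟩
  have skip : moveOf I α (Cell.decode I x) (Choice.decode I c) = none →
      Cmd.skip.wp α S W (fun st' => Ready I E x c st' ∧ (tableOf st).Step (tableOf st') I x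
        (moveOf I α (Cell.decode I x) (Choice.decode I c))) st := by
    intro he
    rw [he]
    exact ⟨h, rfl⟩
  refine ⟨safe 9, fun h1 => ⟨safe 8, fun h2 => key _ _ empty_denotes ?_, fun h2 => ⟨safe 10,
    fun h3 => skip ?_, fun h3 => ⟨⟨safe_choiceE st 2, trivial⟩, fun h4 =>
    key _ _ dropMove_denotes ?_, fun h4 => ⟨h.useE_safe hn, fun h5 => ?_, fun h5 => skip ?_⟩⟩⟩⟩,
    fun h1 => ⟨safe 8, fun h2 => ⟨lastE_safe, fun h3 => ?_, fun h3 => skip ?_⟩,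
    fun h2 => ⟨h.groupE_safe hn, fun h3 => ?_, fun h3 => skip ?_⟩⟩⟩
  all_goals
    rw [h.cellE_le_zero, hmode] at h1
    rw [h.cellE_le_zero, hu] at h2
  · rw [moveOf, if_pos h1, if_pos h2]
  · rw [h.cellE_le_zero, hk] at h3
    rw [moveOf, if_pos h1, if_neg h2, if_pos h3]
  all_goals
    try rw [h.cellE_le_zero, hk] at h3
    try rw [BExp.Holds, h.eval_choiceE, hl, IExp.eval] at h4
    try rw [h.useE_iff] at h5
    try rw [h.lastE_iff] at h3
    try rw [h.groupE_iff] at h3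
  · rw [moveOf, if_pos h1, if_neg h2, if_neg h3, if_pos h4]
  · exact key _ _ (useMove_denotes hn h4 h5) (moveOf_use h1 h2 h3 h4 h5)
  · rw [moveOf, if_pos h1, if_neg h2, if_neg h3, if_neg h4, if_neg h5]
  · exact key _ _ (lastMove_denotes h3) (moveOf_last h1 h2 h3)
  · rw [moveOf, if_neg h1, if_pos h2, if_neg h3]
  · exact key _ _ (groupMove_denotes hn h3) (moveOf_group h1 h2 h3)
  · rw [moveOf, if_neg h1, if_neg h2, if_neg h3]

end SpeedScaling

end

noncomputable section

namespace SpeedScaling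

/-! ## Filling the table -/

variable {n : ℕ} {I : Instance n} {E : ℝ} {x c : ℕ} {st : State 6} {S W : ℕ} {α : ℝ}

namespace Table

/-- Two tables have the same entry `y`. -/
structure AgreeAt (T T' : Table) (y : ℕ) : Prop where
  fin : T'.fin y = T.fin y
  c₁ : T'.c₁ y = T.c₁ y
  c₂ : T'.c₂ y = T.c₂ y
  c₃ : T'.c₃ y = T.c₃ y
  emit : T'.emit y = T.emit y
  job : T'.job y = T.job y
  val : T'.val y = T.val y
  start : T'.start y = T.start y
  finish : T'.finish y = T.finish y
  speed : T'.speed y = T.speed y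

variable {T T' : Table}

lemma Step.agreeAt {o : Option Move} (h : T.Step T' I x o) {y : ℕ} (hy : y ≠ x) :
    T.AgreeAt T' y := by
  have hsame : T' = T → T.AgreeAt T' y := by
    rintro rfl
    exact ⟨rfl, rfl, rfl, rfl, rfl, rfl, rfl, rfl, rfl, rfl⟩
  cases o with
  | none => exact hsame h
  | some m =>
    rcases h with ⟨-, h⟩ | ⟨-, -, -, h⟩ | ⟨-, -, v, -, rfl⟩
    · exact hsame h
    · exact hsame h
    · constructor <;> exact Function.update_of_ne hy _ _

/-- A move refers only to smaller codes, so its availability and total are unaffected by changes at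
`x` and beyond. -/
lemma available_congr (h : ∀ y < x, T.AgreeAt T' y) (h0 : 0 < x) (hx : x < cellCount n I.L I.P)
    {m : Move} (hm : moveOf I α (Cell.decode I x) (Choice.decode I c) = some m) :
    (T'.Available I m ↔ T.Available I m) ∧ T'.total I m = T.total I m := by
  obtain ⟨⟨-, h1⟩, ⟨-, h2⟩, -, h3⟩ := moveOf_children (Cell.decode_valid x) (Choice.decode_valid c)
    hm (by rw [Cell.code_decode hx]; omega)
  rw [Cell.code_decode hx] at h1 h2 h3
  rw [Available, Available, total, total, (h _ h1).fin, (h _ h2).fin, (h _ h3).fin, (h _ h1).val,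
    (h _ h2).val, (h _ h3).val]
  exact ⟨Iff.rfl, rfl⟩

lemma CellOK.congr {C : ℕ} (hT : T.CellOK I α C x) (h : ∀ y ≤ x, T.AgreeAt T' y) (h0 : 0 < x)
    (hx : x < cellCount n I.L I.P) : T'.CellOK I α C x := by
  have key : ∀ c m, moveOf I α (Cell.decode I x) (Choice.decode I c) = some m →
      (T'.Available I m ↔ T.Available I m) ∧ T'.total I m = T.total I m :=
    fun c m hm => available_congr (fun y hy => h y hy.le) h0 hx hm
  have hxx := h x le_rfl
  rcases hT with ⟨h1, h2⟩ | ⟨⟨c, hc, m, hm, ha, hs⟩, h2⟩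
  · exact Or.inl ⟨hxx.fin.trans h1, fun c hc m hm ha => h2 c hc m hm ((key c m hm).1.1 ha)⟩
  · refine Or.inr ⟨⟨c, hc, m, hm, (key c m hm).1.2 ha, ?_⟩, fun c hc m hm ha => ?_⟩
    · exact ⟨hxx.fin.trans hs.fin, hxx.c₁.trans hs.c₁, hxx.c₂.trans hs.c₂, hxx.c₃.trans hs.c₃,
        hxx.emit.trans hs.emit, hxx.job.trans hs.job,
        hxx.val.trans (hs.val.trans (key c m hm).2.symm), hxx.start.trans hs.start,
        hxx.finish.trans hs.finish, hxx.speed.trans hs.speed⟩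
    · rw [hxx.val, (key c m hm).2]
      exact h2 c hc m hm ((key c m hm).1.1 ha)

/-- The entry holds a running minimum. Totals of earlier choices remain valid because writing entry
`x` does not touch the cells they refer to. -/
lemma CellOK.step (hT : T.CellOK I α c x)
    (h : T.Step T' I x (moveOf I α (Cell.decode I x) (Choice.decode I c))) (h0 : 0 < x)
    (hx : x < cellCount n I.L I.P) : T'.CellOK I α (c + 1) x := by
  have key : ∀ c' m, moveOf I α (Cell.decode I x) (Choice.decode I c') = some m →
      (T'.Available I m ↔ T.Available I m) ∧ T'.total I m = T.total I m :=
    fun c' m hm => available_congr (fun y hy => h.agreeAt hy.ne) h0 hx hm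
  have hextend : ∀ p : ℕ → Prop, (∀ c' < c, p c') → p c → ∀ c' < c + 1, p c' :=
    fun p h1 h2 c' hc' => (Nat.lt_succ_iff_lt_or_eq.1 hc').elim (h1 c') fun e => e ▸ h2
  rcases ho : moveOf I α (Cell.decode I x) (Choice.decode I c) with _ | m
  · rw [ho] at h
    obtain rfl : T' = T := h
    rcases hT with ⟨h1, h2⟩ | ⟨⟨c', hc', hs⟩, h2⟩
    · exact Or.inl ⟨h1, hextend _ h2 fun m hm => by simp [ho] at hm⟩
    · exact Or.inr ⟨⟨c', by omega, hs⟩, hextend _ h2 fun m hm => by simp [ho] at hm⟩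
  have hm : ∀ m', moveOf I α (Cell.decode I x) (Choice.decode I c) = some m' → m' = m :=
    fun m' hm' => Option.some_injective _ (hm'.symm.trans ho)
  have hkey := key c m ho
  rw [ho] at h
  rcases h with ⟨hna, rfl⟩ | ⟨ha, hf, hv, rfl⟩ | ⟨ha, hnot, v, rfl, hT'⟩
  · rcases hT with ⟨h1, h2⟩ | ⟨⟨c', hc', hs⟩, h2⟩
    · exact Or.inl ⟨h1, hextend _ h2 fun m' hm' => hm m' hm' ▸ hna⟩
    · exact Or.inr ⟨⟨c', by omega, hs⟩, hextend _ h2 fun m' hm' h' =>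
        absurd (hm m' hm' ▸ h') hna⟩
  · rcases hT with ⟨h1, h2⟩ | ⟨⟨c', hc', hs⟩, h2⟩
    · omega
    · exact Or.inr ⟨⟨c', by omega, hs⟩, hextend _ h2 fun m' hm' _ => by
        rw [hm m' hm']
        exact hv⟩
  · have hval : T'.val x = T.total I m := by rw [hT']; exact Function.update_self _ _ _
    refine Or.inr ⟨⟨c, Nat.lt_succ_self c, m, ho, hkey.1.2 ha, ?_⟩, fun c' hc' m' hm' ha' => ?_⟩
    · refine ⟨?_, ?_, ?_, ?_, ?_, ?_, hval.trans hkey.2.symm, ?_, ?_, ?_⟩ <;> rw [hT'] <;>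
        exact Function.update_self _ _ _
    · rw [hval, (key c' m' hm').2]
      rcases Nat.lt_succ_iff_lt_or_eq.1 hc' with hlt | rfl
      · rw [(key c' m' hm').1] at ha'
        rcases hT with ⟨h1, h2⟩ | ⟨⟨c₀, -, m₀, -, -, hs⟩, h2⟩
        · exact absurd ha' (h2 c' hlt m' hm')
        -- An entry already present is overwritten only by a strictly smaller total, so the new
        -- value is still below all earlier ones.
        · have hlt' : T.total I m < T.val x := by
            by_contra! hle
            exact hnot ⟨hs.fin.ge, hle⟩
          exact hlt'.le.trans (h2 c' hlt m' hm' ha')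
      · rw [hm m' hm']

/-- The entries below `x` are correct and the entries from `x'` on are untouched. -/
structure Partial (T : Table) (I : Instance n) (α : ℝ) (x x' : ℕ) : Prop where
  correct : T.Correct I α x
  untouched : ∀ y, x' ≤ y → T.fin y = 0

lemma Partial.step {x' : ℕ} (hT : T.Partial I α x x') {o : Option Move} (h : T.Step T' I x o)
    (h0 : 0 < x) (hx : x < x') (hxN : x < cellCount n I.L I.P) : T'.Partial I α x x' := by
  refine ⟨⟨?_, ?_, fun y hy hyx => ?_⟩, fun y hy => ?_⟩
  · rw [(h.agreeAt h0.ne).fin, hT.correct.fin_zero]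
  · rw [(h.agreeAt h0.ne).val, hT.correct.val_zero]
  · exact (hT.correct.cell y hy hyx).congr (fun z hz => h.agreeAt (by omega)) hy (by omega)
  · rw [(h.agreeAt (by omega)).fin, hT.untouched y hy]

end Table

/-- Array length and word size are large enough. -/
structure Fits (n L P S W : ℕ) : Prop where
  cells : cellCount n L P ≤ S
  jobs : n + 1 < S
  stack : 9 * n * n + 7 ≤ S
  words : S ≤ W
  choices : choiceCount n L P ≤ W
  span : L ≤ W
  work : P ≤ W

/-- Consider all choices for the current cell. -/
def fillCell : Cmd 6 :=
  .while (.not (.ile (.reg 4) (.reg 6))) (.seq tryChoice (.iset 6 (.reg 6 + .const 1)))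

/-- Fill the table. -/
def fillTable : Cmd 6 :=
  .while (.not (.ile (.reg 3) (.reg 5)))
    (.seq (.iset 6 (.const 0)) (.seq fillCell (.iset 5 (.reg 5 + .const 1))))

lemma Ready.setChoice (h : Ready I E x c st) (c' : ℕ) : Ready I E x c' (st.setI 6 c') where
  __ := h
  reg_n := h.reg_n
  reg_L := h.reg_L
  reg_P := h.reg_P
  reg_cells := h.reg_cells
  reg_choices := h.reg_choices
  reg_cell := h.reg_cell
  reg_choice := rfl

lemma Ready.setCell (h : Ready I E x c st) (x' : ℕ) : Ready I E x' c (st.setI 5 x') where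
  __ := h
  reg_n := h.reg_n
  reg_L := h.reg_L
  reg_P := h.reg_P
  reg_cells := h.reg_cells
  reg_choices := h.reg_choices
  reg_cell := rfl
  reg_choice := h.reg_choice

lemma Cmd.wp_mono {K : ℕ} {c : Cmd K} {st : State K} {Q Q' : State K → Prop}
    (h : c.wp α S W Q st) (hQ : ∀ st', Q st' → Q' st') : c.wp α S W Q' st := by
  induction c generalizing st Q Q' with
  | skip => exact hQ _ h
  | iset v e => exact ⟨h.1, h.2.1, hQ _ h.2.2⟩
  | rset v e => exact ⟨h.1, hQ _ h.2⟩
  | iput arr idx e => exact ⟨h.1, h.2.1, h.2.2.1, h.2.2.2.1, hQ _ h.2.2.2.2⟩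
  | rput arr idx e => exact ⟨h.1, h.2.1, h.2.2.1, hQ _ h.2.2.2⟩
  | seq c₁ c₂ ih₁ ih₂ => exact ih₁ h fun st' h' => ih₂ h' hQ
  | ite b c₁ c₂ ih₁ ih₂ =>
    exact ⟨h.1, fun hb => ih₁ (h.2.1 hb) hQ, fun hb => ih₂ (h.2.2 hb) hQ⟩
  | _ b c => exact h.elim

/-- The time to fill one cell, with `M` choices. -/
def fillCellTime (M : ℕ) : ℕ :=
  M * (4 + 1 + (tryChoice.bound + (IExp.reg 6 + IExp.const 1 : IExp 6).cost + 1)) + (4 + 1)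

lemma fillCell_runs (hfit : Fits n I.L I.P S W) (h : Ready I E x 0 st) (h0 : 0 < x)
    (hx : x < cellCount n I.L I.P) (hT : (tableOf st).Partial I α x x) :
    Runs α S W fillCell st (fillCellTime (choiceCount n I.L I.P)) fun st' =>
      Ready I E x (choiceCount n I.L I.P) st' ∧ (tableOf st').Partial I α (x + 1) (x + 1) := by
  have hcells := hfit.cells
  have hjobs := hfit.jobs
  have hwords := hfit.words
  have hchoices := hfit.choices
  have := Runs.while (α := α) (S := S) (W := W) (m := choiceCount n I.L I.P)
    (b := .not (.ile (.reg 4) (.reg 6))) (c := .seq tryChoice (.iset 6 (.reg 6 + .const 1)))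
    (B := tryChoice.bound + (IExp.reg 6 + IExp.const 1 : IExp 6).cost + 1)
    (fun c st => Ready I E x c st ∧ (tableOf st).Partial I α x (x + 1) ∧
      (tableOf st).CellOK I α c x)
    (fun c hc st h => ⟨⟨⟨trivial, trivial⟩, ?_⟩, ?_⟩) (fun st h => ⟨⟨trivial, trivial⟩, ?_⟩)
    ⟨h, ⟨hT.correct, fun y hy => hT.untouched y (by omega)⟩,
      -- Initially the entry is empty and no choice has been considered.
      Or.inl ⟨hT.untouched x le_rfl, fun c hc => absurd hc (Nat.not_lt_zero c)⟩⟩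
  · refine Runs.mono this le_rfl fun st' ⟨h1, h2, h3⟩ => ⟨h1, ⟨h2.correct.fin_zero,
      h2.correct.val_zero, fun y hy hyx => ?_⟩, h2.untouched⟩
    rcases Nat.lt_succ_iff_lt_or_eq.1 hyx with hlt | rfl
    · exact h2.correct.cell y hy hlt
    · exact h3
  · rw [BExp.Holds, BExp.Holds, IExp.eval, IExp.eval, h.1.reg_choices, h.1.reg_choice]
    omega
  · have htry := tryChoice_wp (α := α) (W := W) h.1 h0 hx (by omega) hcells (by omega) (by omega)
    refine Cmd.wp_sound (.seq tryChoice (.iset 6 (.reg 6 + .const 1)))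
      (Cmd.wp_mono (c := tryChoice) htry ?_)
    rintro st' ⟨h1, h2⟩
    have he : (IExp.reg 6 + IExp.const 1 : IExp 6).eval st' = c + 1 := by
      change st'.ireg 6 + 1 = c + 1
      rw [h1.reg_choice]
    refine ⟨⟨trivial, trivial⟩, ?_, ?_⟩ <;> rw [he]
    · omega
    · exact ⟨h1.setChoice _, h.2.1.step h2 h0 (Nat.lt_succ_self x) hx, h.2.2.step h2 h0 hx⟩
  · rw [BExp.Holds, BExp.Holds, IExp.eval, IExp.eval, h.1.reg_choices, h.1.reg_choice]
    simp

/-- The time to fill the table, with `N` cells and `M` choices. -/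
def fillTableTime (N M : ℕ) : ℕ :=
  N * (4 + 1 + (2 + (fillCellTime M + ((IExp.reg 5 + IExp.const 1 : IExp 6).cost + 1)))) + (4 + 1)

lemma fillTable_runs (hfit : Fits n I.L I.P S W) (h : Ready I E 1 0 st)
    (hN : 1 ≤ cellCount n I.L I.P) (hT : (tableOf st).Partial I α 1 1) :
    Runs α S W fillTable st (fillTableTime (cellCount n I.L I.P) (choiceCount n I.L I.P))
      fun st' => (∃ x c, Ready I E x c st') ∧
        (tableOf st').Correct I α (cellCount n I.L I.P) := by
  have hcells := hfit.cells
  have hwords := hfit.words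
  -- One cell fewer than the table has, because cell `0` is preset and the loop starts at `1`.
  have := Runs.while (α := α) (S := S) (W := W) (m := cellCount n I.L I.P - 1)
    (b := .not (.ile (.reg 3) (.reg 5)))
    (c := .seq (.iset 6 (.const 0)) (.seq fillCell (.iset 5 (.reg 5 + .const 1))))
    (B := 2 + (fillCellTime (choiceCount n I.L I.P) +
      ((IExp.reg 5 + IExp.const 1 : IExp 6).cost + 1)))
    (fun i st => ∃ c, Ready I E (i + 1) c st ∧ (tableOf st).Partial I α (i + 1) (i + 1))
    (fun i hi st h => ?_) (fun st h => ?_) ⟨0, h, hT⟩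
  · refine Runs.mono this ?_ fun st' ⟨c, h1, h2⟩ => ⟨⟨_, c, h1⟩, ?_⟩
    · rw [fillTableTime]
      exact Nat.add_le_add_right (Nat.mul_le_mul_right _ (Nat.sub_le _ _)) _
    · rw [Nat.sub_add_cancel hN] at h2
      exact h2.correct
  · obtain ⟨c, h1, h2⟩ := h
    refine ⟨⟨⟨trivial, trivial⟩, ?_⟩, ?_⟩
    · rw [BExp.Holds, BExp.Holds, IExp.eval, IExp.eval, h1.reg_cells, h1.reg_cell]
      omega
    · refine Runs.seq (Cmd.wp_sound (.iset 6 (.const 0)) (Q := fun st' => Ready I E (i + 1) 0 st' ∧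
        (tableOf st').Partial I α (i + 1) (i + 1)) ⟨trivial, Nat.zero_le _, h1.setChoice _, h2⟩)
        fun st' ⟨h3, h4⟩ => Runs.seq (fillCell_runs hfit h3 (Nat.succ_pos i) (by omega) h4)
        fun st'' ⟨h5, h6⟩ => Cmd.wp_sound (.iset 5 (.reg 5 + .const 1)) ?_
      have he : (IExp.reg 5 + IExp.const 1 : IExp 6).eval st'' = i + 1 + 1 := by
        change st''.ireg 5 + 1 = i + 1 + 1
        rw [h5.reg_cell]
      refine ⟨⟨trivial, trivial⟩, ?_, ?_⟩ <;> rw [he]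
      · omega
      · exact ⟨_, h5.setCell _, h6⟩
  · obtain ⟨c, h1, -⟩ := h
    refine ⟨⟨trivial, trivial⟩, ?_⟩
    rw [BExp.Holds, BExp.Holds, IExp.eval, IExp.eval, h1.reg_cells, h1.reg_cell]
    omega

/-! ### Initialisation: span, total work and first entry. -/

/-- Take one job into account in the schedule span and the total work. -/
def sizesBody : Cmd 6 :=
  .seq (.ite (.ile (.get 1 (.reg 7)) (.reg 1)) .skip (.iset 1 (.get 1 (.reg 7))))
    (.seq (.iset 2 (.reg 2 + .get 2 (.reg 7))) (.iset 7 (.reg 7 + .const 1)))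

/-- Compute the schedule span and the total work. -/
def sizes : Cmd 6 := .while (.not (.ile (.reg 0) (.reg 7))) sizesBody

/-- Compute the sizes of the table and its first entry. -/
def firstCell : Cmd 6 :=
  .seq (.iset 3 (.prod cellBasesE)) (.seq (.iset 4 (.prod choiceBasesE))
    (.seq (.iput 3 (.const 0) (.const 1)) (.iset 5 (.const 1))))

lemma Instance.L_eq (I : Instance n) : I.L = (Finset.range n).sup I.dOr := by
  refine le_antisymm (Finset.sup_le fun j _ => ?_) (Finset.sup_le fun j hj => ?_)
  · rw [← I.dOr_val]
    exact Finset.le_sup (f := I.dOr) (Finset.mem_range.2 j.2)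
  · rw [← Fin.val_mk (Finset.mem_range.1 hj), I.dOr_val]
    exact I.d_le_L _

lemma Instance.P_eq (I : Instance n) : I.P = ∑ j ∈ Finset.range n, I.pOr j := by
  rw [Finset.sum_range]
  simp [Instance.P]

/-- The state after the sizes of the first `i` jobs have been taken into account. -/
structure SizesAt (I : Instance n) (E : ℝ) (i : ℕ) (st : State 6) : Prop where
  reg_n : st.ireg 0 = n
  reg_L : st.ireg 1 = (Finset.range i).sup I.dOr
  reg_P : st.ireg 2 = ∑ j ∈ Finset.range i, I.pOr j
  reg_choice : st.ireg 6 = 0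
  reg_loop : st.ireg 7 = i
  reg_E : st.rreg 0 = E
  arr_r : st.iarr 0 = I.rOr
  arr_d : st.iarr 1 = I.dOr
  arr_p : st.iarr 2 = I.pOr
  arr_fin : ∀ y, st.iarr 3 y = 0
  arr_val : ∀ y, st.rarr 4 y = 0

lemma sizesAt_init : SizesAt I E 0 (initState 6 I E) := by
  constructor <;> simp only [initState]
  · rfl
  · rfl
  · rfl
  · rfl
  · rfl
  · rfl
  · rfl
  · rfl
  · rfl
  · intro y
    split_ifs <;> first | rfl | exact absurd ‹(3 : Fin (6 + 4)) = _› (by decide)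
  · exact fun _ => trivial

lemma sizesAt_succ (hfit : Fits n I.L I.P S W) {i : ℕ} (hi : i < n) (h : SizesAt I E i st) :
    sizesBody.wp α S W (SizesAt I E (i + 1)) st := by
  have hiS : i < S := by have := hfit.jobs; omega
  have hd : I.dOr i ≤ I.L := by
    rw [I.L_eq]
    exact Finset.le_sup (f := I.dOr) (Finset.mem_range.2 hi)
  have hP : (∑ j ∈ Finset.range i, I.pOr j) + I.pOr i ≤ I.P := by
    rw [← Finset.sum_range_succ, I.P_eq]
    exact Finset.sum_le_sum_of_subset (Finset.range_subset_range.2 hi)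
  have hspan := hfit.span
  have hwork := hfit.work
  have hjobs := hfit.jobs
  have hwords := hfit.words
  have e1 : (Finset.range (i + 1)).sup I.dOr = max (I.dOr i) ((Finset.range i).sup I.dOr) := by
    rw [Finset.range_add_one, Finset.sup_insert]
  -- Between the two commands only the register of the span is ahead of the invariant, so the
  -- invariant is assumed with that register reset.
  have key : ∀ st' : State 6, SizesAt I E i { st' with
      ireg := Function.update st'.ireg 1 ((Finset.range i).sup I.dOr) } →
      st'.ireg 1 = (Finset.range (i + 1)).sup I.dOr →
      (Cmd.seq (.iset 2 (.reg 2 + .get 2 (.reg 7))) (.iset 7 (.reg 7 + .const 1))).wp α S W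
        (SizesAt I E (i + 1)) st' := by
    intro st' h' hL
    have hi7 : st'.ireg 7 = i := h'.reg_loop
    have h2 : st'.ireg 2 = _ := h'.reg_P
    have hp : st'.iarr 2 = _ := h'.arr_p
    refine ⟨⟨trivial, trivial, ?_⟩, ?_, ⟨trivial, trivial⟩, ?_, ?_⟩
    · rw [IExp.eval, hi7]
      exact hiS
    · change st'.ireg 2 + st'.iarr 2 (st'.ireg 7) ≤ W
      rw [h2, hp, hi7]
      omega
    · change st'.ireg 7 + 1 ≤ W
      omega
    · refine ⟨h'.reg_n, hL, ?_, h'.reg_choice, ?_, h'.reg_E, h'.arr_r, h'.arr_d, hp, h'.arr_fin,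
        h'.arr_val⟩
      · change st'.ireg 2 + st'.iarr 2 (st'.ireg 7) = _
        rw [h2, hp, hi7, Finset.sum_range_succ]
      · change st'.ireg 7 + 1 = i + 1
        rw [hi7]
  have hget : (IExp.get 1 (.reg 7) : IExp 6).eval st = I.dOr i := by
    rw [IExp.eval, IExp.eval, h.reg_loop, h.arr_d]
  have hsafe : (IExp.get 1 (.reg 7) : IExp 6).Safe S st := by
    refine ⟨trivial, ?_⟩
    rw [IExp.eval, h.reg_loop]
    exact hiS
  refine ⟨⟨hsafe, trivial⟩, fun hb => key _ ?_ ?_, fun hb => ⟨hsafe, ?_, key _ ?_ ?_⟩⟩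
  · rw [← h.reg_L, Function.update_eq_self]
    exact h
  · rw [BExp.Holds, hget, IExp.eval, h.reg_L] at hb
    rw [e1, max_eq_right hb, h.reg_L]
  · rw [hget]
    omega
  · rw [State.setI, Function.update_idem, ← h.reg_L, Function.update_eq_self]
    exact h
  · rw [BExp.Holds, hget, IExp.eval, h.reg_L] at hb
    rw [e1, max_eq_left (by omega), hget]
    rfl

/-- The time for the initialisation. -/
def setupTime (n : ℕ) : ℕ := n * (4 + 1 + sizesBody.bound) + (4 + 1) + firstCell.bound

lemma cellCount_pos (n L P : ℕ) : 1 ≤ cellCount n L P := by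
  rw [cellCount]
  exact Nat.pos_of_ne_zero (by simp [cellBases])

lemma setup_runs (hfit : Fits n I.L I.P S W) :
    Runs α S W (.seq sizes firstCell) (initState 6 I E) (setupTime n) fun st' =>
      Ready I E 1 0 st' ∧ (tableOf st').Partial I α 1 1 := by
  have hcells := hfit.cells
  have hwords := hfit.words
  have hjobs := hfit.jobs
  refine Runs.seq (Runs.while (α := α) (S := S) (W := W) (b := .not (.ile (.reg 0) (.reg 7)))
    (c := sizesBody) (m := n) (B := sizesBody.bound) (SizesAt I E)
    (fun i hi st h => ⟨⟨⟨trivial, trivial⟩, ?_⟩, Cmd.wp_sound sizesBody (sizesAt_succ hfit hi h)⟩)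
    (fun st h => ⟨⟨trivial, trivial⟩, ?_⟩) sizesAt_init) fun st h => Cmd.wp_sound _ ?_
  · rw [BExp.Holds, BExp.Holds, IExp.eval, IExp.eval, h.reg_n, h.reg_loop]
    omega
  · rw [BExp.Holds, BExp.Holds, IExp.eval, IExp.eval, h.reg_n, h.reg_loop]
    simp
  have hL : st.ireg 1 = I.L := h.reg_L.trans I.L_eq.symm
  have hP : st.ireg 2 = I.P := h.reg_P.trans I.P_eq.symm
  have hc : ∀ st' : State 6, st'.ireg 0 = n → st'.ireg 1 = I.L → st'.ireg 2 = I.P →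
      (IExp.prod cellBasesE).eval st' = cellCount n I.L I.P ∧
      (IExp.prod choiceBasesE).eval st' = choiceCount n I.L I.P := by
    intro st' h0 h1 h2
    rw [IExp.eval_prod, IExp.eval_prod, cellCount, choiceCount]
    simp [cellBasesE, cellBases, choiceBasesE, choiceBases, IExp.eval, h0, h1, h2]
  refine ⟨IExp.safe_prod fun b hb => (safe_cellBasesE st b hb).1, ?_,
    IExp.safe_prod fun b hb => (safe_choiceBasesE _ b hb).1, ?_, trivial, ?_, trivial, ?_, trivial,
    ?_, ?_⟩
  · rw [(hc st h.reg_n hL hP).1]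
    omega
  · exact (hc (st.setI 3 _) h.reg_n hL hP).2.trans_le hfit.choices
  · change 0 < S
    omega
  · change 1 ≤ W
    omega
  · change 1 ≤ W
    omega
  · refine ⟨⟨h.reg_n, hL, hP, (hc st h.reg_n hL hP).1, (hc (st.setI 3 _) h.reg_n hL hP).2,
      rfl, h.reg_choice, h.reg_E, h.arr_r, h.arr_d, h.arr_p⟩,
      ⟨?_, h.arr_val 0, fun y h1 h2 => by omega⟩, fun y hy => ?_⟩
    · rfl
    · exact (Function.update_of_ne (by change y ≠ 0; omega) _ _).trans (h.arr_fin y)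

end SpeedScaling

end

noncomputable section

namespace SpeedScaling

/-! ## Output -/

variable {n : ℕ} {I : Instance n} {E : ℝ} {st : State 6} {S W : ℕ} {α : ℝ} {T : Table} {N : ℕ}

/-- The index of the root cell for the number of jobs in register `v`. -/
def rootE (v : Fin 10) : IExp 6 :=
  .encode cellBasesE [.reg 1, .const 0, .const 1, .const 1, .const 0, .const 0, .const 0, .const 0,
    .reg v, .const 0, .reg 0]

/-- The root of the table for `u` jobs is within the budget. -/
def Table.Affordable (T : Table) (I : Instance n) (E : ℝ) (u : ℕ) : Prop :=
  1 ≤ T.fin ((rootCell I u).code I) ∧ T.val ((rootCell I u).code I) ≤ E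

lemma Table.Correct.fin_le_one (hT : T.Correct I α N) {x : ℕ} (hx : x < N) : T.fin x ≤ 1 := by
  rcases Nat.eq_zero_or_pos x with rfl | h0
  · exact hT.fin_zero.le
  · rcases hT.cell x h0 hx with ⟨h, -⟩ | ⟨⟨c, -, m, -, -, h⟩, -⟩
    · omega
    · exact h.fin.le

/-- The output of the values for fewer than `i` jobs has been completed, and register `8` holds
the largest of these numbers of jobs that is affordable. -/
structure ValuesAt (T : Table) (I : Instance n) (E : ℝ) (i : ℕ) (st : State 6) : Prop where
  reg_n : st.ireg 0 = n
  reg_L : st.ireg 1 = I.L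
  reg_P : st.ireg 2 = I.P
  reg_loop : st.ireg 7 = i
  reg_E : st.rreg 0 = E
  table : tableOf st = T
  arr_fin : ∀ u < i, st.iarr 1 u = T.fin ((rootCell I u).code I)
  arr_val : ∀ u < i, st.rarr 3 u = T.val ((rootCell I u).code I)
  best_le : st.ireg 8 ≤ n
  best_affordable : T.Affordable I E (st.ireg 8)
  le_best : ∀ u < i, T.Affordable I E u → u ≤ st.ireg 8

lemma safe_rootE (v : Fin 10) : (rootE v).Safe S st :=
  safe_code (by simp [IExp.Safe])

lemma eval_rootE (h0 : st.ireg 0 = n) (h1 : st.ireg 1 = I.L) (h2 : st.ireg 2 = I.P) (v : Fin 10) :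
    (rootE v).eval st = (rootCell I (st.ireg v)).code I := by
  rw [rootE, IExp.eval_encode, Cell.code]
  simp [cellBasesE, cellBases, IExp.eval, h0, h1, h2, rootCell, Cell.plan]

/-- Output the values for the number of jobs in register `7`. -/
def valuesBody : Cmd 6 :=
  .seq (.iput 1 (.reg 7) (.get 3 (rootE 7))) <| .seq (.rput 3 (.reg 7) (.get 4 (rootE 7))) <|
  .seq (.ite (.and (.ile (.const 1) (.get 3 (rootE 7))) (.rle (.get 4 (rootE 7)) (.reg 0)))
    (.iset 8 (.reg 7)) .skip) (.iset 7 (.reg 7 + .const 1))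

/-- Output the values of the dynamic program and find the maximum throughput. -/
def values : Cmd 6 :=
  .seq (.seq (.iset 7 (.const 0)) (.iset 8 (.const 0))) (.while (.ile (.reg 7) (.reg 0)) valuesBody)

/-- Numbers of jobs are tried in increasing order, so overwriting register `8` at every affordable
one leaves the largest. -/
lemma ValuesAt.step (hfit : Fits n I.L I.P S W) (hT : T.Correct I α (cellCount n I.L I.P)) {i : ℕ}
    (hi : i ≤ n) (h : ValuesAt T I E i st) : valuesBody.wp α S W (ValuesAt T I E (i + 1)) st := by
  have hcells := hfit.cells
  have hjobs := hfit.jobs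
  have hwords := hfit.words
  have hroot := (rootCell_valid (I := I) hi).code_lt
  have hfin := hT.fin_le_one hroot
  have eroot : ∀ st' : State 6, st'.ireg 0 = n → st'.ireg 1 = I.L → st'.ireg 2 = I.P →
      st'.ireg 7 = i → (rootE 7).eval st' = (rootCell I i).code I := by
    intro st' h0 h1 h2 h7
    rw [eval_rootE h0 h1 h2, h7]
  generalize hx : (rootCell I i).code I = x at hroot hfin eroot
  have e1 := eroot st h.reg_n h.reg_L h.reg_P h.reg_loop
  have tfin : st.iarr 3 = T.fin := by rw [← h.table]; rfl
  have tval : st.rarr 4 = T.val := by rw [← h.table]; rfl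
  have hlast : ∀ st' : State 6, ValuesAt T I E i st' → st'.iarr 1 i = T.fin x →
      st'.rarr 3 i = T.val x → (T.Affordable I E i → i ≤ st'.ireg 8) →
      (Cmd.iset 7 (.reg 7 + .const 1) : Cmd 6).wp α S W (ValuesAt T I E (i + 1)) st' := by
    intro st' h' hf hv hb
    have h7 : st'.ireg 7 + 1 = i + 1 := by rw [h'.reg_loop]
    refine ⟨⟨trivial, trivial⟩, ?_, ⟨h'.reg_n, h'.reg_L, h'.reg_P, h7, h'.reg_E, h'.table,
      fun u hu => ?_, fun u hu => ?_, h'.best_le, h'.best_affordable, fun u hu ha => ?_⟩⟩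
    · change st'.ireg 7 + 1 ≤ W
      omega
    all_goals rcases Nat.lt_succ_iff_lt_or_eq.1 hu with hlt | rfl
    · exact h'.arr_fin u hlt
    · exact hf.trans (by rw [hx])
    · exact h'.arr_val u hlt
    · exact hv.trans (by rw [hx])
    · exact h'.le_best u hlt ha
    · exact hb ha
  rw [valuesBody]
  refine Cmd.wp_iput (α := α) (q := i) (v := T.fin x) ⟨trivial, h.reg_loop⟩ (by omega)
    ⟨⟨safe_rootE _, by omega⟩, by rw [IExp.eval, e1, tfin]⟩ (by omega) ?_
  refine Cmd.wp_rput (W := W) (q := i) (v := T.val x) ⟨trivial, h.reg_loop⟩ (by omega)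
    ⟨⟨safe_rootE _, ?_⟩, ?_⟩ ?_
  · rw [eroot (st.putI 1 i (T.fin x)) h.reg_n h.reg_L h.reg_P h.reg_loop]
    omega
  · rw [RExp.eval, eroot (st.putI 1 i (T.fin x)) h.reg_n h.reg_L h.reg_P h.reg_loop]
    exact congrFun tval x
  set st₁ := (st.putI 1 i (T.fin x)).putR 3 i (T.val x) with hst₁
  have hfin₁ : ∀ u, st₁.iarr 1 u = Function.update (st.iarr 1) i (T.fin x) u := fun u => rfl
  have hval₁ : ∀ u, st₁.rarr 3 u = Function.update (st.rarr 3) i (T.val x) u := fun u => rfl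
  have h₁ : ValuesAt T I E i st₁ := by
    refine ⟨h.reg_n, h.reg_L, h.reg_P, h.reg_loop, h.reg_E, h.table, fun u hu => ?_,
      fun u hu => ?_, h.best_le, h.best_affordable, h.le_best⟩
    · rw [hfin₁, Function.update_of_ne hu.ne]
      exact h.arr_fin u hu
    · rw [hval₁, Function.update_of_ne hu.ne]
      exact h.arr_val u hu
  have e2 := eroot st₁ h₁.reg_n h₁.reg_L h₁.reg_P h₁.reg_loop
  have hf : st₁.iarr 1 i = T.fin x := by rw [hfin₁, Function.update_self]
  have hv : st₁.rarr 3 i = T.val x := by rw [hval₁, Function.update_self]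
  have hcond : (BExp.and (.ile (.const 1) (.get 3 (rootE 7))) (.rle (.get 4 (rootE 7)) (.reg 0)) :
      BExp 6).Holds α st₁ ↔ T.Affordable I E i := by
    rw [Table.Affordable, hx, ← h₁.table, ← h₁.reg_E]
    simp only [BExp.Holds, IExp.eval, RExp.eval, e2]
    rfl
  refine ⟨⟨⟨trivial, safe_rootE _, by omega⟩, ⟨safe_rootE _, by omega⟩, trivial⟩, fun hb => ?_,
    fun hb => hlast st₁ h₁ hf hv fun ha => absurd (hcond.2 ha) hb⟩
  have h8 : ((st₁.setI 8 ((IExp.reg 7 : IExp 6).eval st₁))).ireg 8 = i := h₁.reg_loop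
  refine ⟨trivial, ?_, hlast _ ⟨h₁.reg_n, h₁.reg_L, h₁.reg_P, h₁.reg_loop, h₁.reg_E, h₁.table,
    h₁.arr_fin, h₁.arr_val, ?_, ?_, fun u hu _ => ?_⟩ hf hv fun _ => h8.ge⟩
  · rw [IExp.eval, h₁.reg_loop]
    omega
  · rw [h8]
    exact hi
  · rw [h8]
    exact hcond.1 hb
  · rw [h8]
    exact hu.le

/-- The time for the output of the values. -/
def valuesTime (n : ℕ) : ℕ := 4 + ((n + 1) * (3 + 1 + valuesBody.bound) + (3 + 1))

/-- Affordability of zero jobs justifies the initial value `0` of register `8`, so the root selected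
at the end is always finite. -/
lemma values_runs (hfit : Fits n I.L I.P S W) (hT : T.Correct I α (cellCount n I.L I.P))
    (h0 : T.Affordable I E 0) {x c : ℕ} (h : Ready I E x c st) (ht : tableOf st = T) :
    Runs α S W values st (valuesTime n) (ValuesAt T I E (n + 1)) := by
  refine Runs.seq (R := ValuesAt T I E 0) (Cmd.wp_sound _ ⟨trivial, Nat.zero_le _, trivial,
    Nat.zero_le _, ⟨h.reg_n, h.reg_L, h.reg_P, rfl, h.reg_E, ht, fun u hu => by omega,
      fun u hu => by omega, Nat.zero_le _, h0, fun u hu => by omega⟩⟩)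
    fun st' h' => Runs.while (α := α) (S := S) (W := W) (b := .ile (.reg 7) (.reg 0))
      (c := valuesBody) (m := n + 1) (B := valuesBody.bound) (ValuesAt T I E)
      (fun i hi st h => ⟨⟨⟨trivial, trivial⟩, ?_⟩,
        Cmd.wp_sound _ (h.step hfit hT (by omega))⟩)
      (fun st h => ⟨⟨trivial, trivial⟩, ?_⟩) h'
  · rw [BExp.Holds, IExp.eval, IExp.eval, h.reg_n, h.reg_loop]
    omega
  · rw [BExp.Holds, IExp.eval, IExp.eval, h.reg_n, h.reg_loop]
    omega

/-! ### Reading the optimal schedule off the table. -/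

namespace Table

lemma Extract.one_le {x s : ℕ} {l : List (Piece n)} (h : T.Extract N x l s) : 1 ≤ s := by
  cases h <;> omega

lemma Extract.length_le {x s : ℕ} {l : List (Piece n)} (h : T.Extract N x l s) :
    l.length ≤ s := by
  induction h with
  | zero => simp
  | silent => simp only [List.length_append]; omega
  | emit => simp only [List.length_append, List.length_cons]; omega

lemma Extract.lt {x s : ℕ} {l : List (Piece n)} (h : T.Extract N x l s) (hN : 0 < N) : x < N := by
  cases h with
  | zero => exact hN
  | silent _ _ _ _ _ _ _ hx => exact hx.2
  | emit _ _ _ _ _ _ _ _ hx => exact hx.2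

/-- The list of pieces obtained by extracting the entries `xs` in turn, and the number of entries
visited. -/
inductive Pending (T : Table) (N : ℕ) : List ℕ → List (Piece n) → ℕ → Prop where
  | nil : Pending T N [] [] 0
  | cons (x : ℕ) (xs : List ℕ) (l l' : List (Piece n)) (s s' : ℕ) (h : T.Extract N x l s)
      (h' : Pending T N xs l' s') : Pending T N (x :: xs) (l ++ l') (s + s')

lemma Pending.length_le {xs : List ℕ} {l : List (Piece n)} {s : ℕ} (h : T.Pending N xs l s) :
    xs.length ≤ s ∧ l.length ≤ s := by
  induction h with
  | nil => simp
  | cons x xs l l' s s' h _ ih =>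
    have h1 := h.one_le
    have h2 := h.length_le
    simp only [List.length_cons, List.length_append]
    omega

end Table

/-- The array `A` holds the stack `xs`, its top being the head of the list. -/
def OnStack (A : ℕ → ℕ) : List ℕ → Prop
  | [] => True
  | x :: xs => A xs.length = x ∧ OnStack A xs

lemma OnStack.update {A : ℕ → ℕ} {xs : List ℕ} (h : OnStack A xs) {q : ℕ} (hq : xs.length ≤ q)
    (v : ℕ) : OnStack (Function.update A q v) xs := by
  induction xs with
  | nil => trivial
  | cons x xs ih =>
    rw [List.length_cons] at hq
    refine ⟨?_, ih h.2 (by omega)⟩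
    rw [Function.update_of_ne (by omega)]
    exact h.1

lemma OnStack.push {A : ℕ → ℕ} {xs : List ℕ} (h : OnStack A xs) (v : ℕ) :
    OnStack (Function.update A xs.length v) (v :: xs) :=
  ⟨Function.update_self _ _ _, h.update le_rfl v⟩

/-- The memory holds the list of pieces `l`. -/
def Written (st : State 6) (l : List (Piece n)) : Prop :=
  ∀ (q : ℕ) (h : q < l.length), st.iarr 0 q = l[q].job ∧ st.rarr 0 q = l[q].start ∧
    st.rarr 1 q = l[q].finish ∧ st.rarr 2 q = l[q].speed

/-- The state while the schedule is read off the table: `xs` is the stack of entries still to be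
visited and `l` the list of pieces found so far. -/
structure Unwinding (T : Table) (xs : List ℕ) (l : List (Piece n)) (v : ℕ → ℕ) (w : ℕ → ℝ)
    (st : State 6) : Prop where
  reg_stack : st.ireg 7 = xs.length
  stack : OnStack (st.iarr 9) xs
  reg_count : st.ireg 9 = l.length
  written : Written st l
  table : tableOf st = T
  arr_fin : st.iarr 1 = v
  arr_val : st.rarr 3 = w

/-- Take an entry from the stack. -/
def pop : Cmd 6 := .seq (.iset 7 (.reg 7 - .const 1)) (.iset 5 (.get 9 (.reg 7)))

/-- Output the piece recorded in the current entry, if any. -/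
def output : Cmd 6 :=
  .ite (.ile (.const 1) (.get 7 (.reg 5)))
    (.seq (.iput 0 (.reg 9) (.get 8 (.reg 5))) <| .seq (.rput 0 (.reg 9) (.get 5 (.reg 5))) <|
      .seq (.rput 1 (.reg 9) (.get 6 (.reg 5))) <| .seq (.rput 2 (.reg 9) (.get 7 (.reg 5))) <|
      .iset 9 (.reg 9 + .const 1))
    .skip

/-- Put the children of the current entry on the stack. -/
def push : Cmd 6 :=
  .seq (.iput 9 (.reg 7) (.get 6 (.reg 5))) <|
  .seq (.iput 9 (.reg 7 + .const 1) (.get 5 (.reg 5))) <|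
  .seq (.iput 9 (.reg 7 + .const 2) (.get 4 (.reg 5))) (.iset 7 (.reg 7 + .const 3))

/-- Visit one entry. -/
def visit : Cmd 6 := .seq pop (.ite (.ile (.const 1) (.reg 5)) (.seq output push) .skip)

/-- Read the optimal schedule off the table. -/
def unwind : Cmd 6 :=
  .seq (.seq (.iput 9 (.const 0) (rootE 8)) (.seq (.iset 7 (.const 1)) (.iset 9 (.const 0))))
    (.seq (.while (.ile (.const 1) (.reg 7)) visit) (.iset 0 (.reg 9)))

namespace Unwinding

variable {xs : List ℕ} {l : List (Piece n)} {v : ℕ → ℕ} {w : ℕ → ℝ} {x : ℕ}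

lemma pop_wp (h : Unwinding T (x :: xs) l v w st) (hS : xs.length < S) (hSW : S ≤ W)
    (hx : x ≤ W) :
    pop.wp α S W (fun st' => Unwinding T xs l v w st' ∧ st'.ireg 5 = x) st := by
  have h7 : st.ireg 7 - 1 = xs.length := by rw [h.reg_stack]; rfl
  have e5 : (IExp.get 9 (.reg 7) : IExp 6).eval
      (st.setI 7 ((IExp.reg 7 - IExp.const 1 : IExp 6).eval st)) = x :=
    (congrArg (st.iarr 9) h7).trans h.stack.1
  refine ⟨⟨trivial, trivial⟩, ?_, ⟨trivial, ?_⟩, ?_, ⟨h7, h.stack.2, h.reg_count, h.written,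
    h.table, h.arr_fin, h.arr_val⟩, e5⟩
  · change st.ireg 7 - 1 ≤ W
    omega
  · change st.ireg 7 - 1 < S
    omega
  · rw [e5]
    exact hx

/-- The third child is pushed first, so the first child is visited first and the pieces come out in
chronological order. -/
lemma push_wp (h : Unwinding T xs l v w st) (h5 : st.ireg 5 = x) (hx : x < S)
    (hS : xs.length + 2 < S) (hSW : S ≤ W)
    (hc : T.c₁ x ≤ W ∧ T.c₂ x ≤ W ∧ T.c₃ x ≤ W) :
    push.wp α S W (Unwinding T (T.c₁ x :: T.c₂ x :: T.c₃ x :: xs) l v w) st := by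
  have h7 := h.reg_stack
  have t1 : st.iarr 4 = T.c₁ := by rw [← h.table]; rfl
  have t2 : st.iarr 5 = T.c₂ := by rw [← h.table]; rfl
  have t3 : st.iarr 6 = T.c₃ := by rw [← h.table]; rfl
  have hsafe : ∀ (arr : Fin 10) (st' : State 6), st'.ireg 5 = x →
      (IExp.get arr (.reg 5) : IExp 6).Safe S st' :=
    fun arr st' h' => ⟨trivial, by rw [IExp.eval, h']; exact hx⟩
  rw [push]
  refine Cmd.wp_iput (α := α) (q := xs.length) (v := T.c₃ x) ⟨trivial, h7⟩ (by omega)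
    ⟨hsafe _ _ h5, by rw [IExp.eval, IExp.eval, h5, t3]⟩ hc.2.2 ?_
  refine Cmd.wp_iput (α := α) (q := xs.length + 1) (v := T.c₂ x) ⟨⟨trivial, trivial⟩, ?_⟩
    (by omega) ⟨hsafe _ _ h5, ?_⟩ hc.2.1 ?_
  · change st.ireg 7 + 1 = _
    rw [h7]
  · change st.iarr 5 (st.ireg 5) = _
    rw [h5, t2]
  refine Cmd.wp_iput (α := α) (q := xs.length + 2) (v := T.c₁ x) ⟨⟨trivial, trivial⟩, ?_⟩
    (by omega) ⟨hsafe _ _ h5, ?_⟩ hc.1 ?_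
  · change st.ireg 7 + 2 = _
    rw [h7]
  · change st.iarr 4 (st.ireg 5) = _
    rw [h5, t1]
  refine ⟨⟨trivial, trivial⟩, ?_, ⟨?_, ((h.stack.push _).push _).push _, h.reg_count, h.written,
    h.table, h.arr_fin, h.arr_val⟩⟩
  · change st.ireg 7 + 3 ≤ W
    omega
  · change st.ireg 7 + 3 = _
    rw [h7]
    rfl

lemma output_skip (h : Unwinding T xs l v w st) (h5 : st.ireg 5 = x) (hx : x < S)
    (he : T.emit x = 0) :
    output.wp α S W (fun st' => Unwinding T xs l v w st' ∧ st'.ireg 5 = x) st := by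
  have t : st.iarr 7 = T.emit := by rw [← h.table]; rfl
  refine ⟨⟨trivial, trivial, by rw [IExp.eval, h5]; exact hx⟩, fun hb => ?_, fun _ => ⟨h, h5⟩⟩
  rw [BExp.Holds, IExp.eval, IExp.eval, IExp.eval, h5, t, he] at hb
  omega

/-- Array `0`, which held the release dates, is overwritten. The table is complete by then, and
`Unwinding` no longer refers to the instance. -/
lemma output_piece (h : Unwinding T xs l v w st) (h5 : st.ireg 5 = x) (hx : x < S)
    (hl : l.length < S) (hSW : S ≤ W) (hn : n ≤ W) {p : Piece n} (he : T.emit x = 1)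
    (hj : T.job x = p.job) (hs : T.start x = p.start) (ht : T.finish x = p.finish)
    (hv : T.speed x = p.speed) :
    output.wp α S W (fun st' => Unwinding T xs (l ++ [p]) v w st' ∧ st'.ireg 5 = x) st := by
  have h9 := h.reg_count
  have t0 : st.iarr 7 = T.emit := by rw [← h.table]; rfl
  have t1 : st.iarr 8 = T.job := by rw [← h.table]; rfl
  have t2 : st.rarr 5 = T.start := by rw [← h.table]; rfl
  have t3 : st.rarr 6 = T.finish := by rw [← h.table]; rfl
  have t4 : st.rarr 7 = T.speed := by rw [← h.table]; rfl
  have hp : (p.job : ℕ) ≤ W := p.job.2.le.trans hn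
  have hsafe : ∀ (arr : Fin 10) (st' : State 6), st'.ireg 5 = x →
      (IExp.get arr (.reg 5) : IExp 6).Safe S st' :=
    fun arr st' h' => ⟨trivial, by rw [IExp.eval, h']; exact hx⟩
  have hsafe' : ∀ (arr : Fin 10) (st' : State 6), st'.ireg 5 = x →
      (RExp.get arr (.reg 5) : RExp 6).Safe α S st' :=
    fun arr st' h' => ⟨trivial, by rw [IExp.eval, h']; exact hx⟩
  refine ⟨⟨trivial, hsafe _ _ h5⟩, fun _ => ?_, fun hb => ?_⟩
  · refine Cmd.wp_iput (α := α) (q := l.length) (v := p.job) ⟨trivial, h9⟩ hl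
      ⟨hsafe _ _ h5, by rw [IExp.eval, IExp.eval, h5, t1, hj]⟩ hp ?_
    refine Cmd.wp_rput (W := W) (q := l.length) (v := p.start) ⟨trivial, h9⟩ hl
      ⟨hsafe' _ _ h5, ?_⟩ ?_
    · change st.rarr 5 (st.ireg 5) = _
      rw [h5, t2, hs]
    refine Cmd.wp_rput (W := W) (q := l.length) (v := p.finish) ⟨trivial, h9⟩ hl
      ⟨hsafe' _ _ h5, ?_⟩ ?_
    · change st.rarr 6 (st.ireg 5) = _
      rw [h5, t3, ht]
    refine Cmd.wp_rput (W := W) (q := l.length) (v := p.speed) ⟨trivial, h9⟩ hl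
      ⟨hsafe' _ _ h5, ?_⟩ ?_
    · change st.rarr 7 (st.ireg 5) = _
      rw [h5, t4, hv]
    refine ⟨⟨trivial, trivial⟩, ?_, ⟨h.reg_stack, h.stack, ?_, fun q hq => ?_, h.table, h.arr_fin,
      h.arr_val⟩, h5⟩
    · change st.ireg 9 + 1 ≤ W
      omega
    · change st.ireg 9 + 1 = _
      rw [h9, List.length_append, List.length_singleton]
    · change Function.update (st.iarr 0) l.length p.job q = _ ∧
        Function.update (st.rarr 0) l.length p.start q = _ ∧
        Function.update (st.rarr 1) l.length p.finish q = _ ∧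
        Function.update (st.rarr 2) l.length (p.speed : ℝ) q = _
      rw [List.length_append, List.length_singleton] at hq
      rcases Nat.lt_succ_iff_lt_or_eq.1 hq with hlt | rfl
      · rw [Function.update_of_ne hlt.ne, Function.update_of_ne hlt.ne,
          Function.update_of_ne hlt.ne, Function.update_of_ne hlt.ne, List.getElem_append_left hlt]
        exact h.written q hlt
      · simp
  · refine absurd ?_ hb
    rw [BExp.Holds, IExp.eval, IExp.eval, IExp.eval, h5, t0, he]

/-- The pieces already written followed by those pending on the stack remain the same list, and each
visit uses up exactly one of the pending visits. Every stacked entry needs at least one visit, which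
bounds the height of the stack. -/
lemma visit_wp (h : Unwinding T (x :: xs) l v w st) (hN : 0 < N) (hNS : N ≤ S) (hSW : S ≤ W)
    (hn : n ≤ W) {r r' : List (Piece n)} {s s' : ℕ} (hx : T.Extract N x r s)
    (hxs : T.Pending N xs r' s') (hS : l.length + (s + s') ≤ S) :
    visit.wp α S W (fun st' => ∃ xs₁ l₁ r₁ s₁, T.Pending N xs₁ r₁ s₁ ∧
      l₁ ++ r₁ = l ++ (r ++ r') ∧ l₁.length + s₁ ≤ l.length + (s + s') ∧ s₁ + 1 = s + s' ∧
      Unwinding T xs₁ l₁ v w st') st := by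
  have hxN := hx.lt hN
  have hlen := hxs.length_le.1
  have hsz := hx.one_le
  refine Cmd.wp_mono (c := pop) (h.pop_wp (by omega) hSW (by omega)) fun st₁ ⟨h₁, h5⟩ =>
    ⟨⟨trivial, trivial⟩, fun hb => ?_, fun hb => ?_⟩
  · rw [BExp.Holds, IExp.eval, IExp.eval, h5] at hb
    cases hx with
    | zero => omega
    | silent _ l₁ l₂ l₃ s₁ s₂ s₃ hx he hc₁ hc₂ hc₃ =>
      have hp := Table.Pending.cons _ _ _ _ _ _ hc₁
        (.cons _ _ _ _ _ _ hc₂ (.cons _ _ _ _ _ _ hc₃ hxs))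
      have hple := hp.length_le.1
      simp only [List.length_cons] at hple
      refine Cmd.wp_mono (c := output) (h₁.output_skip h5 (by omega) he) fun st₂ ⟨h₂, h5⟩ =>
        Cmd.wp_mono (c := push) (h₂.push_wp h5 (by omega) (by omega) hSW
          ⟨by have := hc₁.lt hN; omega, by have := hc₂.lt hN; omega,
            by have := hc₃.lt hN; omega⟩) fun st₃ h₃ => ⟨_, _, _, _, hp, ?_, ?_, ?_, h₃⟩
      · simp
      · omega
      · omega
    | emit _ p l₁ l₂ l₃ s₁ s₂ s₃ hx he hj hs ht hv hc₁ hc₂ hc₃ =>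
      have hp := Table.Pending.cons _ _ _ _ _ _ hc₁
        (.cons _ _ _ _ _ _ hc₂ (.cons _ _ _ _ _ _ hc₃ hxs))
      have hple := hp.length_le.1
      simp only [List.length_cons] at hple
      refine Cmd.wp_mono (c := output) (h₁.output_piece h5 (by omega) (by omega) hSW hn he hj hs
        ht hv) fun st₂ ⟨h₂, h5⟩ => Cmd.wp_mono (c := push) (h₂.push_wp h5 (by omega) (by omega) hSW
          ⟨by have := hc₁.lt hN; omega, by have := hc₂.lt hN; omega,
            by have := hc₃.lt hN; omega⟩) fun st₃ h₃ => ⟨_, _, _, _, hp, ?_, ?_, ?_, h₃⟩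
      · simp
      · simp only [List.length_append, List.length_singleton]
        omega
      · omega
  · rw [BExp.Holds, IExp.eval, IExp.eval, h5] at hb
    cases hx with
    | zero => exact ⟨_, _, _, _, hxs, by simp, by omega, by omega, h₁⟩
    | silent _ _ _ _ _ _ _ hx => omega
    | emit _ _ _ _ _ _ _ _ hx => omega

end Unwinding

/-- The time for reading off the schedule when `m` entries are visited. -/
def unwindTime (m : ℕ) : ℕ :=
  (1 + (rootE 8).cost + 1 + 4) + (m * (3 + 1 + visit.bound) + (3 + 1) + 2)

/-- The number of pending visits counts the iterations: it starts at `s` and drops by one each time.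
At zero the stack is empty and nothing remains to be written. -/
lemma unwind_runs (hfit : Fits n I.L I.P S W) {u : ℕ} (hu : u ≤ n) (h : ValuesAt T I E (n + 1) st)
    (h8 : st.ireg 8 = u) {l : List (Piece n)} {s : ℕ}
    (hl : T.Extract (cellCount n I.L I.P) ((rootCell I u).code I) l s) (hs : s ≤ S) :
    Runs α S W unwind st (unwindTime s) fun st' => st'.ireg 0 = l.length ∧ Written st' l ∧
      (∀ u ≤ n, st'.iarr 1 u = T.fin ((rootCell I u).code I)) ∧
      ∀ u ≤ n, st'.rarr 3 u = T.val ((rootCell I u).code I) := by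
  have hcells := hfit.cells
  have hjobs := hfit.jobs
  have hwords := hfit.words
  have hroot := (rootCell_valid (I := I) hu).code_lt
  have e8 : (rootE 8).eval st = (rootCell I u).code I := by
    rw [eval_rootE h.reg_n h.reg_L h.reg_P, h8]
  refine Runs.seq (R := Unwinding T [(rootCell I u).code I] ([] : List (Piece n)) (st.iarr 1)
    (st.rarr 3)) (Cmd.wp_sound (.seq (.iput 9 (.const 0) (rootE 8)) (.seq (.iset 7 (.const 1))
      (.iset 9 (.const 0)))) (Cmd.wp_iput (α := α) (q := 0) (v := (rootCell I u).code I)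
      ⟨trivial, rfl⟩ (by omega) ⟨safe_rootE _, e8⟩ (by omega)
      ⟨trivial, ?_, trivial, Nat.zero_le _, ⟨rfl, ⟨rfl, trivial⟩, rfl,
        fun q hq => absurd hq (Nat.not_lt_zero q), h.table, rfl, rfl⟩⟩)) fun st₁ h₁ =>
    Runs.seq (Runs.while (α := α) (S := S) (W := W) (b := .ile (.const 1) (.reg 7)) (c := visit)
      (m := s) (B := visit.bound)
      (fun i st' => ∃ xs l₁ r s', T.Pending (cellCount n I.L I.P) xs r s' ∧ l₁ ++ r = l ∧
        l₁.length + s' ≤ s ∧ i + s' = s ∧ Unwinding T xs l₁ (st.iarr 1) (st.rarr 3) st')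
      (fun i hi st' ⟨xs, l₁, r, s', hp, hlr, hle, his, hU⟩ => ?_)
      (fun st' ⟨xs, l₁, r, s', hp, hlr, hle, his, hU⟩ => ⟨⟨trivial, trivial⟩, ?_⟩)
      ⟨_, [], _, _, .cons _ _ _ _ _ _ hl .nil, by simp, by simp, by simp, h₁⟩)
    fun st₂ ⟨xs, l₁, r, s', hp, hlr, hle, his, hU⟩ => Cmd.wp_sound (.iset 0 (.reg 9))
      ⟨trivial, ?_, ?_, ?_, fun u hu => ?_, fun u hu => ?_⟩
  · change 1 ≤ W
    omega
  · cases hp with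
    | nil => omega
    | cons x xs r₁ r₂ s₁ s₂ hx hxs =>
      refine ⟨⟨⟨trivial, trivial⟩, ?_⟩, Cmd.wp_sound visit (Cmd.wp_mono
        (hU.visit_wp (cellCount_pos _ _ _) hcells hwords (by omega) hx hxs (by omega)) ?_)⟩
      · rw [BExp.Holds, IExp.eval, IExp.eval, hU.reg_stack, List.length_cons]
        omega
      · rintro st₂ ⟨xs', l', r', s₃, hp, hlr', hle', hs', hU'⟩
        exact ⟨xs', l', r', s₃, hp, hlr'.trans hlr, by omega, by omega, hU'⟩
  · have := hp.length_le.1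
    rw [BExp.Holds, IExp.eval, IExp.eval, hU.reg_stack]
    omega
  · rw [IExp.eval, hU.reg_count]
    omega
  all_goals
    have h1 := hp.length_le.2
    obtain rfl : r = [] := List.eq_nil_of_length_eq_zero (by omega)
    rw [List.append_nil] at hlr
    subst hlr
  · exact hU.reg_count
  · exact hU.written
  · exact (congrFun hU.arr_fin u).trans (h.arr_fin u (by omega))
  · exact (congrFun hU.arr_val u).trans (h.arr_val u (by omega))

end SpeedScaling

end

noncomputable section

namespace SpeedScaling

/-! ## The program -/

variable {n : ℕ} {I : Instance n} {E α : ℝ} {T : Table} {S W : ℕ} {st : State 6}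

namespace Table.Correct

lemma affordable_iff (hT : T.Correct I α (cellCount n I.L I.P)) (hα : 1 < α) (hE : 0 ≤ E) {u : ℕ}
    (hu : u ≤ n) : T.Affordable I E u ↔ I.G α n 0 I.L u ≤ ENNReal.ofReal E := by
  obtain ⟨h1, h2⟩ := hT.root_spec hα hu
  by_cases hfin : 1 ≤ T.fin ((rootCell I u).code I)
  · rw [Table.Affordable, (h1 hfin).1, ENNReal.ofReal_le_ofReal_iff hE]
    exact and_iff_right hfin
  · rw [h2 hfin]
    simp [Table.Affordable, hfin]

lemma affordable_zero (hT : T.Correct I α (cellCount n I.L I.P)) (hα : 1 < α) (hE : 0 ≤ E) :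
    T.Affordable I E 0 := by
  rw [hT.affordable_iff hα hE (Nat.zero_le n), G_zero]
  exact zero_le

/-- A plan of maximum affordable size and the value of its root is optimal. -/
lemma optimal (hT : T.Correct I α (cellCount n I.L I.P)) (hα : 1 < α) (hE : 0 ≤ E)
    {U : Finset (Fin n)} {l : List (Piece n)} (hU : T.Affordable I E U.card)
    (hmax : ∀ u ≤ n, T.Affordable I E u → u ≤ U.card) (hl : Plan I n U 0 I.L l)
    (he : Piece.energy α l = T.val ((rootCell I U.card).code I)) :
    I.Optimal α E (Piece.toSchedule l) := by
  have h0 : 0 < α := by linarith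
  -- `J` is the set of all jobs that `τ` completes on time; the lower bound holds for any schedule,
  -- and the budget enters only afterwards.
  have key : ∀ τ : Schedule n, ∃ J : Finset (Fin n), J.card = I.throughput τ ∧
      T.fin ((rootCell I J.card).code I) = 1 ∧
      ENNReal.ofReal (T.val ((rootCell I J.card).code I)) ≤ τ.energy α := by
    classical
    intro τ
    refine ⟨Finset.univ.filter (I.OnTime τ), ?_, hT.root_le hα τ _ fun j hj => by simpa using hj⟩
    rw [Instance.throughput, ← Set.ncard_coe_finset]
    simp
  refine ⟨hl.feasible h0 (he.trans_le hU.2), fun τ hτ => ?_, fun τ hτ hcard => ?_⟩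
  · obtain ⟨J, hJ, h1, h2⟩ := key τ
    rw [hl.throughput, ← hJ]
    exact hmax _ (by simpa using Finset.card_le_univ J)
      ⟨h1.ge, (ENNReal.ofReal_le_ofReal_iff hE).1 (h2.trans hτ.energy_le)⟩
  · obtain ⟨J, hJ, -, h2⟩ := key τ
    rw [hl.throughput, ← hJ] at hcard
    rwa [hl.chain.energy_toSchedule h0, he, ← hcard]

lemma encodesValues (hT : T.Correct I α (cellCount n I.L I.P)) (hα : 1 < α) (hS : n < S)
    (hfin : ∀ u ≤ n, st.iarr 1 u = T.fin ((rootCell I u).code I))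
    (hval : ∀ u ≤ n, st.rarr 3 u = T.val ((rootCell I u).code I)) :
    EncodesValues n S st fun u => I.G α n 0 I.L u := by
  refine ⟨hS, fun u hu => ?_⟩
  obtain ⟨h1, h2⟩ := hT.root_spec hα hu
  have h3 := hT.fin_le_one (rootCell_valid (I := I) hu).code_lt
  rw [hfin u hu, hval u hu]
  by_cases h : 1 ≤ T.fin ((rootCell I u).code I)
  · obtain ⟨h4, h5, -⟩ := h1 h
    exact Or.inr ⟨by omega, h4.trans_ne ENNReal.ofReal_ne_top,
      ((congrArg ENNReal.toReal h4).trans (ENNReal.toReal_ofReal h5)).symm⟩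
  · exact Or.inl ⟨by omega, h2 h⟩

end Table.Correct

lemma Written.encodesSchedule {l : List (Piece n)} (h : Written st l) (hlen : st.ireg 0 = l.length)
    (hS : l.length ≤ S) {a b : ℝ} (hl : Piece.Chain a l b) :
    EncodesSchedule S st (Piece.toSchedule l) := by
  refine ⟨hlen.trans_le hS, fun q hq t ht => ?_, fun t ht => ?_⟩
  · rw [hlen] at hq
    obtain ⟨h1, h2, h3, h4⟩ := h q hq
    rw [h2, h3] at ht
    rw [h1, h4]
    have hmem := List.getElem_mem hq
    exact ⟨congrArg (Option.map Fin.val) (hl.eval_of_mem _ _ hmem ht),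
      congrArg NNReal.toReal (hl.eval_of_mem _ _ hmem ht)⟩
  · have hno : ∀ p ∈ l, t ∉ Set.Ico p.start p.finish := by
      intro p hp
      obtain ⟨q, hq, rfl⟩ := List.getElem_of_mem hp
      have := ht q (hlen ▸ hq)
      rwa [(h q hq).2.1, (h q hq).2.2.1] at this
    exact ⟨Piece.eval_of_notMem _ _ hno, Piece.eval_of_notMem _ _ hno⟩

/-- The dynamic program. -/
def program : Cmd 6 := .seq (.seq sizes firstCell) (.seq fillTable (.seq values unwind))

/-- The time for the program. -/
def programTime (n N M : ℕ) : ℕ :=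
  setupTime n + (fillTableTime N M + (valuesTime n + unwindTime (4 + 9 * n * n)))

lemma program_spec (hfit : Fits n I.L I.P S W) (hα : 1 < α) (hE : 0 ≤ E) :
    Runs α S W program (initState 6 I E)
      (programTime n (cellCount n I.L I.P) (choiceCount n I.L I.P)) fun final =>
      ∃ σ, EncodesValues n S final (fun u => I.G α n 0 I.L u) ∧ EncodesSchedule S final σ ∧
        I.Optimal α E σ ∧
        IsGreatest {u : ℕ | u ≤ n ∧ I.G α n 0 I.L u ≤ ENNReal.ofReal E} (I.throughput σ) := by
  have hstack := hfit.stack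
  refine Runs.seq (setup_runs (α := α) hfit) fun st₁ ⟨h₁, hT₁⟩ =>
    Runs.seq (fillTable_runs hfit h₁ (cellCount_pos _ _ _) hT₁) fun st₂ ⟨⟨x, c, h₂⟩, hT⟩ =>
    Runs.seq (values_runs hfit hT (hT.affordable_zero hα hE) h₂ rfl) fun st₃ h₃ => ?_
  obtain ⟨-, -, U, l, s, hl, hs, hU, he, hP⟩ :=
    (hT.root_spec hα h₃.best_le).1 h₃.best_affordable.1
  have hs' : s ≤ 4 + 9 * n * n :=
    hs.trans (Nat.add_le_add_left (Nat.mul_le_mul_left _ h₃.best_le) _)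
  refine Runs.mono (unwind_runs hfit h₃.best_le h₃ rfl hl (by omega)) ?_
    fun st₄ ⟨hlen, hw, hf, hv⟩ => ⟨Piece.toSchedule l,
      hT.encodesValues hα (by have := hfit.jobs; omega) hf hv,
      hw.encodesSchedule hlen (hl.length_le.trans (by omega)) hP.chain, ?_, ?_⟩
  · rw [unwindTime, unwindTime]
    gcongr
  all_goals
    have hA := h₃.best_affordable
    have hmax : ∀ u ≤ n, (tableOf st₂).Affordable I E u → u ≤ st₃.ireg 8 :=
      fun u hu => h₃.le_best u (by omega)
    have hle := h₃.best_le
    rw [← hU] at he hA hmax hle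
  · exact hT.optimal hα hE hA hmax hP he
  · rw [hP.throughput]
    exact ⟨⟨hle, (hT.affordable_iff hα hE hle).1 hA⟩,
      fun u hu => hmax u hu.1 ((hT.affordable_iff hα hE hu.1).2 hu.2)⟩

/-! ### Explicit bounds on time and space. -/

lemma choiceCount_le {n L P : ℕ} (hn : 1 ≤ n) (hL : 1 ≤ L) (hP : 1 ≤ P) :
    choiceCount n L P ≤ 1024 * (n ^ 2 * L ^ 4 * P ^ 4) := by
  have h : choiceCount n L P = (n + 1) ^ 2 * (L + 1) ^ 4 * (P + 1) ^ 4 := by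
    rw [choiceCount]
    simp only [choiceBases, List.prod_cons, List.prod_nil]
    ring
  rw [h]
  calc (n + 1) ^ 2 * (L + 1) ^ 4 * (P + 1) ^ 4 ≤ (2 * n) ^ 2 * (2 * L) ^ 4 * (2 * P) ^ 4 := by
        gcongr <;> omega
    _ = _ := by ring

lemma cellCount_eq (n L P : ℕ) : cellCount n L P = 2 * choiceCount n L P := by
  rw [choiceCount, cellCount]
  simp only [choiceBases, cellBases, List.prod_cons, List.prod_nil]
  ring

/-- With `M` choices there are `2 M` cells, so the dominant term is of order `M ^ 2`, where `M ≤
1024 n ^ 2 L ^ 4 P ^ 4`. All other terms are linear in `M` or at most quadratic in `n`. -/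
lemma exists_time_bound : ∃ C : ℕ, ∀ n L P : ℕ, 1 ≤ n → 1 ≤ L → 1 ≤ P →
    programTime n (cellCount n L P) (choiceCount n L P) ≤ C * (n ^ 6 * L ^ 9 * P ^ 9) := by
  simp only [programTime, setupTime, fillTableTime, fillCellTime, valuesTime, unwindTime,
    cellCount_eq]
  generalize sizesBody.bound = b₁
  generalize firstCell.bound = b₂
  generalize tryChoice.bound = b₃
  generalize (IExp.reg 6 + IExp.const 1 : IExp 6).cost = b₄
  generalize (IExp.reg 5 + IExp.const 1 : IExp 6).cost = b₅
  generalize valuesBody.bound = b₆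
  generalize (rootE 8).cost = b₇
  generalize visit.bound = b₈
  -- Here `2 ^ 21` is twice `1024 ^ 2` and `2048` twice `1024`, the factor two being the ratio of
  -- cells to choices; `13 = 4 + 9` bounds the visits during read-off relative to `n ^ 2`.
  refine ⟨b₁ + b₂ + 10 + (2 ^ 21 * (6 + b₃ + b₄) + 2048 * (13 + b₅) + 5) + (16 + 2 * b₆) +
    (12 + b₇ + 13 * (4 + b₈)), fun n L P hn hL hP => ?_⟩
  have hM := choiceCount_le hn hL hP
  generalize choiceCount n L P = M at hM
  have hMM : M * M ≤ 2 ^ 20 * (n ^ 6 * L ^ 9 * P ^ 9) := by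
    calc M * M ≤ (1024 * (n ^ 2 * L ^ 4 * P ^ 4)) * (1024 * (n ^ 2 * L ^ 4 * P ^ 4)) :=
          Nat.mul_le_mul hM hM
      _ = 2 ^ 20 * (n ^ 4 * L ^ 8 * P ^ 8) := by ring
      _ ≤ _ := by gcongr <;> omega
  have hM' : M ≤ 1024 * (n ^ 6 * L ^ 9 * P ^ 9) := hM.trans (by gcongr <;> omega)
  have hnn : n * n ≤ n ^ 6 * L ^ 9 * P ^ 9 := by
    calc n * n = n ^ 2 * 1 ^ 9 * 1 ^ 9 := by ring
      _ ≤ _ := by gcongr; omega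
  generalize n ^ 6 * L ^ 9 * P ^ 9 = y at hMM hM' hnn
  have hn' : n ≤ y := (Nat.le_mul_self n).trans hnn
  have h1 : 1 ≤ y := hn.trans hn'
  have e : ∀ a b k : ℕ, a ≤ k * y → a * b ≤ k * y * b := fun a b k h => Nat.mul_le_mul_right b h
  have e1 := e n b₁ 1 (by omega)
  have e2 := e 1 b₂ 1 (by omega)
  have e3 := e (M * M) (6 + b₃ + b₄) (2 ^ 20) hMM
  have e4 := e M (13 + b₅) 1024 hM'
  have e5 := e (n + 1) (4 + b₆) 2 (by omega)
  have e6 := e (4 + 9 * n * n) (4 + b₈) 13 (by nlinarith)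
  have e7 := e 1 b₇ 1 (by omega)
  nlinarith

/-- The program solves every instance within the time and the space of the dynamic program. -/
lemma program_runs {C : ℕ} (hC : ∀ n L P : ℕ, 1 ≤ n → 1 ≤ L → 1 ≤ P →
    programTime n (cellCount n L P) (choiceCount n L P) ≤ C * (n ^ 6 * L ^ 9 * P ^ 9))
    (I : Instance n) (hα : 1 < α) (hE : 0 ≤ E) :
    ∃ (S T : ℕ) (final : State 6) (σ : Schedule n),
      Exec α S ((C + 50000) * (n + I.L + I.P) ^ 10) program (initState 6 I E) final T ∧
      T ≤ (C + 50000) * (n ^ 6 * I.L ^ 9 * I.P ^ 9) ∧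
      memoryCells 6 S ≤ (C + 50000) * (n * I.L ^ 6 * I.P ^ 6) ∧
      EncodesValues n S final (fun u => I.G α n 0 I.L u) ∧ EncodesSchedule S final σ ∧
      I.Optimal α E σ ∧
      IsGreatest {u : ℕ | u ≤ n ∧ I.G α n 0 I.L u ≤ ENNReal.ofReal E} (I.throughput σ) := by
  have hn := I.n_pos
  have hL := I.L_pos
  have hP := I.P_pos
  have hnP := I.n_le_P
  have hM := choiceCount_le hn hL hP
  have hN := cellCount_eq n I.L I.P
  have htime := hC n I.L I.P hn hL hP
  -- One common array length for the table, the values and the stack, as `Fits` requires.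
  set S := cellCount n I.L I.P + 9 * n * n + n + 7 with hS
  set z := n + I.L + I.P with hz
  have hx : n * n ≤ n ^ 2 * I.L ^ 4 * I.P ^ 4 := by
    calc n * n = n ^ 2 * 1 ^ 4 * 1 ^ 4 := by ring
      _ ≤ _ := by gcongr <;> assumption
  have hnn : n ≤ n * n := Nat.le_mul_self n
  -- `2065 = 2048 + 9 + 1 + 7`, one summand for each term of `S`.
  have hSx : S ≤ 2065 * (n ^ 2 * I.L ^ 4 * I.P ^ 4) := by
    rw [hS, mul_assoc 9]
    omega
  have hxz : n ^ 2 * I.L ^ 4 * I.P ^ 4 ≤ z ^ 10 := by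
    calc n ^ 2 * I.L ^ 4 * I.P ^ 4 ≤ z ^ 2 * z ^ 4 * z ^ 4 := by gcongr <;> omega
      _ = z ^ 10 := by ring
  have hzz : z ≤ z ^ 10 := Nat.le_self_pow (by norm_num) z
  have hW : 50000 * z ^ 10 ≤ (C + 50000) * z ^ 10 := Nat.mul_le_mul_right _ (by omega)
  -- One factor `n` is replaced by `P`, since every job has positive work. The `20 + 20 S` cells
  -- then number at most `41320` times this bound, below `50000`.
  have hxy : n ^ 2 * I.L ^ 4 * I.P ^ 4 ≤ n * I.L ^ 6 * I.P ^ 6 := by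
    calc n ^ 2 * I.L ^ 4 * I.P ^ 4 = n * n * I.L ^ 4 * I.P ^ 4 := by ring
      _ ≤ n * I.P * I.L ^ 6 * I.P ^ 5 := by gcongr <;> omega
      _ = _ := by ring
  have hfit : Fits n I.L I.P S ((C + 50000) * z ^ 10) := by
    constructor <;> omega
  obtain ⟨final, T, h1, h2, σ, h3⟩ := program_spec hfit hα hE
  refine ⟨S, T, final, σ, h1, h2.trans (htime.trans (Nat.mul_le_mul_right _ (by omega))), ?_, h3⟩
  refine le_trans ?_ (Nat.mul_le_mul_right (n * I.L ^ 6 * I.P ^ 6) (Nat.le_add_left 50000 C))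
  rw [memoryCells]
  omega

end SpeedScaling

end

theorem mainTheorem1 :
    ∃ (K : ℕ) (prog : SpeedScaling.Cmd K) (C c : ℕ),
      ∀ (n : ℕ) (I : SpeedScaling.Instance n) (α E : ℝ), 1 < α → 0 ≤ E →
        ∃ (S T : ℕ) (final : SpeedScaling.State K) (σ : SpeedScaling.Schedule n),
          SpeedScaling.Exec α S (C * (n + I.L + I.P) ^ c) prog
            (SpeedScaling.initState K I E) final T ∧
          T ≤ C * (n ^ 6 * I.L ^ 9 * I.P ^ 9) ∧
          SpeedScaling.memoryCells K S ≤ C * (n * I.L ^ 6 * I.P ^ 6) ∧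
          SpeedScaling.EncodesValues n S final (fun u => I.G α n 0 I.L u) ∧
          SpeedScaling.EncodesSchedule S final σ ∧
          I.Optimal α E σ ∧
          IsGreatest {u : ℕ | u ≤ n ∧ I.G α n 0 I.L u ≤ ENNReal.ofReal E} (I.throughput σ) := by
  obtain ⟨C, hC⟩ := SpeedScaling.exists_time_bound
  refine ⟨6, SpeedScaling.program, C + 50000, 10, fun n I α E hα hE => ?_⟩
  obtain ⟨S, T, final, σ, h1, h2, h3, h4⟩ := SpeedScaling.program_runs hC I hα hE
  exact ⟨S, T, final, σ, h1, h2, h3, h4⟩
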